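/- Let $U\subseteq\mathbb R$ be open, let $h,c,p,s$ be smooth on $U$, let $\lambda\in\mathbb R$, and suppose $p=\tfrac35\,c\,c'+\lambda c^3$ on $U$. Put $$c_h=c\,h''',\qquad p_h=p\,h'''+\tfrac{3}{10}c^2h^{(4)},$$ $$s_h=s\,h'''-\tfrac{cc''}{8}h^{(4)}-\tfrac{cc'}{8}h^{(5)}-\tfrac{c^2}{24}h^{(6)}-\tfrac{p'}{6}h^{(4)}-\tfrac p6h^{(5)},$$ $$H_h=\int\Big(h-\tfrac{\varepsilon^2}{2}c_h u_x^2+\varepsilon^4\big(p_hu_{xx}^2+s_hu_x^4\big)\Big)dx .$$ For a formal functional $K=\int\kappa(u,u_x,u_{xx})\,dx$ let $\frac{\delta K}{\delta u}=\kappa_u-\partial_x\kappa_{u_x}+\partial_x^2\kappa_{u_{xx}}$; $\{v(x),K\}=\partial_x\frac{\delta K}{\delta u}\big|_{u=v}$; and let $\{F[v](x),K\}$ be the derivative of $F$ at $v$ in the direction $\partial_x\frac{\delta K}{\delta u}\big|_{u=v}$. Write $W=1+t\,h'''(u)u_x$, let $\Omega=\{(t,u,u_x,u_{xx}):u\in U,\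 W>0\}$, and let $K_1=-\frac12\int c\,u_x\log W\,dx$. There is a smooth density $\kappa_3(t,u,u_x,u_{xx})$ on $\Omega$, equal to $0$ if $t=0$ or if $h'''$ vanishes in a neighbourhood of $u$, and given for $t\neq0$, $h'''(u)\ne0$ by $$\begin{aligned} \kappa_3=&-\Big(\Big(\tfrac{c}{(h''')^2}\Big)'''+\tfrac{c'''}{(h''')^2}\Big)\frac{c\,u_x\log W}{8t^2} -\frac{c^2(h''')^3t^3u_{xx}^3\,(5+5th'''u_x+t^2(h''')^2u_x^2)}{40\,W^5}\\ &+\frac{3c^2t\,h^{(4)}u_{xx}^2\,(4+10th'''u_x+5t^2(h''')^2u_x^2)}{40\,W^5}+\frac{t\,h'''s\,u_x^4(2+th'''u_x)}{2\,W^2}\\ &+\frac{(3cc'+5\lambda c^3)\,t\,h'''u_{xx}^2(2+th'''u_x)(2+2th'''u_x+t^2(h''')^2u_x^2)}{20\,W^4}\\ &-t\,u_x^4\Big(\frac{c'}{20}+\frac{\lambda c^2}{12}\Big)\Big(\frac{2ch^{(5)}+6c'h^{(4)}}{W^3}-\frac{3tc(h^{(4)})^2u_x}{W^4}\Big)\\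 &+\frac{u_x^2}{240\,t}\Bigg[\frac{12c^2(h^{(4)})^3}{(h''')^4W^5}+\frac{3ch^{(4)}\big(3c'h'''h^{(4)}+3ch'''h^{(5)}-16c(h^{(4)})^2\big)}{(h''')^4W^4}\\ &-\frac{3h^{(4)}\big(8cc''(h''')^2-4c^2(h^{(4)})^2+9cc'h'''h^{(4)}+9c^2h'''h^{(5)}-16(c')^2(h''')^2\big)}{(h''')^4W^3}\\ &-\frac{96(c')^2(h''')^2h^{(4)}-48cc''(h''')^2h^{(4)}+63cc'h'''(h^{(4)})^2+5cc'''(h''')^3}{(h''')^4W^2}\\ &+\frac{252c^2(h^{(4)})^3-63c^2h'''h^{(4)}h^{(5)}}{(h''')^4W^2}+\frac{-30c^2(h''')^2h^{(6)}+441c^2h'''h^{(4)}h^{(5)}}{(h''')^4W}\\ &-\frac{90cc'(h''')^2h^{(5)}-441cc'h'''(h^{(4)})^2+768c^2(h^{(4)})^3+114cc''(h''')^2h^{(4)}}{(h''')^4W}\\ &+\frac{48(c')^2(h''')^2h^{(4)}+35cc'''(h''')^3}{(h''')^4W}+\frac{180ch^{(4)}}{(h''')^3}(ch^{(4)})'-\frac{90c}{(h''')^2}(c'h^{(4)})'\\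 &-\frac{30c^2h^{(6)}}{(h''')^2}-\frac{180c^2(h^{(4)})^3}{(h''')^4}+\frac{35cc'''}{h'''}-\frac{5cc'''}{h'''}W\Bigg] \end{aligned}$$ ($h,c,s$ and their derivatives taken at $u$). Let $K_3=\int\kappa_3\,dx$ and $K=\varepsilon K_1+\varepsilon^3K_3$. Then the following holds for every $T>0$ and every smooth solution $v^0:\mathbb R\times[0,T)\to U$ of $v^0_t=h''(v^0)v^0_x$, $v^0|_{t=0}=\varphi$. (a) $1+t\,h'''(v^0)v^0_x>0$ on $\mathbb R\times[0,T)$. (b) There are smooth functions $v^1,v^2$ on $\mathbb R\times[0,T)$ such that, at every $(x,t)$ and as $\varepsilon\to0$, $$v^0+\varepsilon\{v^0,K\}+\tfrac{\varepsilon^2}{2}\{\{v^0,K\},K\}=v^0+\varepsilon^2v^1+\varepsilon^4v^2+O(\varepsilon^6).$$ (c) These $v^1,v^2$ satisfy $v^1|_{t=0}=v^2|_{t=0}=0$ and the transport equations (coefficients taken at $v^0$) $$v^1_t=\partial_x\Big(h''v^1+c_hv^0_{xx}+\tfrac12c_h'(v^0_x)^2\Big),$$ $$\begin{aligned}v^2_t=\partial_x\Big(&h''v^2+\tfrac12h'''(v^1)^2+\partial_x(c_hv^1_x)+c_h'v^0_{xx}v^1+\tfrac12c_h''(v^0_x)^2v^1+2p_hv^0_{xxxx}+4p_h'v^0_xv^0_{xxx}\\&+2p_h''(v^0_x)^2v^0_{xx}+3p_h'(v^0_{xx})^2-12s_h(v^0_x)^2v^0_{xx}-3s_h'(v^0_x)^4\Big),\end{aligned}$$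 and they are the only smooth functions on $\mathbb R\times[0,T)$ that do. Moreover $u=v^0+\varepsilon^2v^1+\varepsilon^4v^2$ satisfies $u_t-\partial_x\frac{\delta H_h}{\delta u}=O(\varepsilon^6)$ at every $(x,t)$, as $\varepsilon\to0$; that is, up to order $\varepsilon^4$ the map from $v^0$ to the formal solution $u$ of the perturbed equation with the same initial data is the canonical transformation generated by $K$. (d) For KdV, $u_t=uu_x+\varepsilon^2u_{xxx}$ (that is $h=u^3/6$, $c=1$, $p=s=0$, $\lambda=0$), $$v^1=\tfrac12\partial_x^2\Big(\log(1+tv^0_x)-\frac1{1+tv^0_x}\Big),$$ $$v^2=\frac{t^2}{8}\partial_x^2\Bigg[-\frac{t^2}{10}\frac{(5+tv^0_x)(v^0_{xx})^3}{(1+tv^0_x)^5}+t\,\partial_x\Big(\frac3{10}\frac{(20+15tv^0_x+3t^2(v^0_x)^2)(v^0_{xx})^2}{(1+tv^0_x)^5}\Big)+\partial_x^2\Big(\frac{(2+tv^0_x)^2}{(1+tv^0_x)^4}v^0_{xx}\Big)\Bigg].$$ -/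

import Mathlib

open Set Filter Topology Asymptotics
open scoped ContDiff

/-! ### The formal variational calculus

A local functional `∫ L(u, u_x, u_xx) dx` is given by its density `L`. -/

/-- The variational derivative (Euler-Lagrange operator) of the functional with density
`L(u, u_x, u_xx)`, evaluated on the function `v`:
`∂L/∂u - d/dx (∂L/∂u_x) + d²/dx² (∂L/∂u_xx)`. -/
noncomputable def varDeriv (L : ℝ → ℝ → ℝ → ℝ) (v : ℝ → ℝ) (x : ℝ) : ℝ :=
  deriv (fun r => L r (deriv v x) (iteratedDeriv 2 v x)) (v x)
    - deriv (fun y => deriv (fun r => L (v y) r (iteratedDeriv 2 v y)) (deriv v y)) x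
    + iteratedDeriv 2 (fun y => deriv (fun r => L (v y) (deriv v y) r) (iteratedDeriv 2 v y)) x

/-- The Hamiltonian vector field `∂_x (δL/δu)` evaluated on `v`. -/
noncomputable def hamField (L : ℝ → ℝ → ℝ → ℝ) (v : ℝ → ℝ) (x : ℝ) : ℝ :=
  deriv (varDeriv L v) x

/-- The bracket `{F(x), L} = ∫ δF(x)/δv(y) ∂_y (δL/δv(y)) dy` of a field-valued functional
`v ↦ F[v](x)` with the functional of density `L`, that is the derivative of `F` at `v` in the
direction `∂_x (δL/δv)`. -/
noncomputable def bracket (F : (ℝ → ℝ) → ℝ → ℝ) (L : ℝ → ℝ → ℝ → ℝ) (v : ℝ → ℝ) (x : ℝ) : ℝ :=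
  deriv (fun r : ℝ => F (fun y => v y + r * hamField L v y) x) 0

/-- `v + ε {v, K} + (ε²/2) {{v, K}, K}`; the next terms of the canonical transformation are of order
`ε⁶` when `K = O(ε)`. -/
noncomputable def canonicalMap (ε : ℝ) (K : ℝ → ℝ → ℝ → ℝ) (v : ℝ → ℝ) (x : ℝ) : ℝ :=
  v x + ε * bracket (fun w => w) K v x
    + ε ^ 2 / 2 * bracket (bracket (fun w => w) K) K v x

/-! ### The Hamiltonian perturbation -/

/-- `c_h = c h'''`. -/
noncomputable def cH (h c : ℝ → ℝ) (u : ℝ) : ℝ := c u * iteratedDeriv 3 h u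

/-- `p_h = p h''' + (3/10) c² h⁗`. -/
noncomputable def pH (h c p : ℝ → ℝ) (u : ℝ) : ℝ :=
  p u * iteratedDeriv 3 h u + 3 / 10 * c u ^ 2 * iteratedDeriv 4 h u

/-- The coefficient `s_h`. -/
noncomputable def sH (h c p s : ℝ → ℝ) (u : ℝ) : ℝ :=
  s u * iteratedDeriv 3 h u - c u * iteratedDeriv 2 c u / 8 * iteratedDeriv 4 h u
    - c u * deriv c u / 8 * iteratedDeriv 5 h u - c u ^ 2 / 24 * iteratedDeriv 6 h u
    - deriv p u / 6 * iteratedDeriv 4 h u - p u / 6 * iteratedDeriv 5 h u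

/-- The density `D_{(c,p,s)}(h)` of the perturbed Hamiltonian. -/
noncomputable def hamDensity (h c p s : ℝ → ℝ) (ε u u1 u2 : ℝ) : ℝ :=
  h u - ε ^ 2 / 2 * cH h c u * u1 ^ 2
    + ε ^ 4 * (pH h c p u * u2 ^ 2 + sH h c p s u * u1 ^ 4)

/-- A smooth function of `(x, t)` on the strip `ℝ × [0, T)`. -/
def SmoothOnStrip (T : ℝ) (v : ℝ → ℝ → ℝ) : Prop :=
  ContDiffOn ℝ ∞ (fun q : ℝ × ℝ => v q.1 q.2) (univ ×ˢ Ico 0 T)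

/-- `v` is a smooth solution on `ℝ × [0, T)`, with values in `U`, of the unperturbed Cauchy problem
`v_t = h''(v) v_x`, `v|_{t=0} = φ`. -/
structure IsUnperturbedSolution (U : Set ℝ) (h φ : ℝ → ℝ) (T : ℝ) (v : ℝ → ℝ → ℝ) : Prop where
  smooth : SmoothOnStrip T v
  mem : ∀ x, ∀ t ∈ Ico 0 T, v x t ∈ U
  eqn : ∀ x, ∀ t ∈ Ico 0 T, HasDerivWithinAt (fun τ => v x τ)
    (iteratedDeriv 2 h (v x t) * deriv (fun y => v y t) x) (Ico 0 T) t
  init : ∀ x, v x 0 = φ x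

/-- `v1` is a smooth solution on `ℝ × [0, T)` of the first transport equation, with zero initial
data. -/
structure SolvesTransport1 (h c : ℝ → ℝ) (T : ℝ) (v0 v1 : ℝ → ℝ → ℝ) : Prop where
  smooth : SmoothOnStrip T v1
  eqn : ∀ x, ∀ t ∈ Ico 0 T, HasDerivWithinAt (fun τ => v1 x τ)
    (deriv (fun y =>
      iteratedDeriv 2 h (v0 y t) * v1 y t
        + cH h c (v0 y t) * iteratedDeriv 2 (fun z => v0 z t) y
        + 1 / 2 * deriv (cH h c) (v0 y t) * deriv (fun z => v0 z t) y ^ 2) x) (Ico 0 T) t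
  init : ∀ x, v1 x 0 = 0

/-- `v2` is a smooth solution on `ℝ × [0, T)` of the second transport equation, with zero initial
data. -/
structure SolvesTransport2 (h c p s : ℝ → ℝ) (T : ℝ) (v0 v1 v2 : ℝ → ℝ → ℝ) : Prop where
  smooth : SmoothOnStrip T v2
  eqn : ∀ x, ∀ t ∈ Ico 0 T, HasDerivWithinAt (fun τ => v2 x τ)
    (deriv (fun y =>
      iteratedDeriv 2 h (v0 y t) * v2 y t
        + 1 / 2 * iteratedDeriv 3 h (v0 y t) * v1 y t ^ 2
        + deriv (fun z => cH h c (v0 z t) * deriv (fun w => v1 w t) z) y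
        + deriv (cH h c) (v0 y t) * iteratedDeriv 2 (fun z => v0 z t) y * v1 y t
        + 1 / 2 * iteratedDeriv 2 (cH h c) (v0 y t) * deriv (fun z => v0 z t) y ^ 2 * v1 y t
        + 2 * pH h c p (v0 y t) * iteratedDeriv 4 (fun z => v0 z t) y
        + 4 * deriv (pH h c p) (v0 y t) * deriv (fun z => v0 z t) y
            * iteratedDeriv 3 (fun z => v0 z t) y
        + 2 * iteratedDeriv 2 (pH h c p) (v0 y t) * deriv (fun z => v0 z t) y ^ 2
            * iteratedDeriv 2 (fun z => v0 z t) y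
        + 3 * deriv (pH h c p) (v0 y t) * iteratedDeriv 2 (fun z => v0 z t) y ^ 2
        - 12 * sH h c p s (v0 y t) * deriv (fun z => v0 z t) y ^ 2
            * iteratedDeriv 2 (fun z => v0 z t) y
        - 3 * deriv (sH h c p s) (v0 y t) * deriv (fun z => v0 z t) y ^ 4) x) (Ico 0 T) t
  init : ∀ x, v2 x 0 = 0

/-- `v0 + ε² v1 + ε⁴ v2` satisfies `u_t = ∂_x (δH_h/δu)` up to terms of order `ε⁶`. -/
def SolvesPerturbedMod6 (h c p s : ℝ → ℝ) (T : ℝ) (v0 v1 v2 : ℝ → ℝ → ℝ) : Prop :=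
  ∀ x, ∀ t ∈ Ico 0 T,
    (fun ε : ℝ =>
      derivWithin (fun τ => v0 x τ + ε ^ 2 * v1 x τ + ε ^ 4 * v2 x τ) (Ico 0 T) t
        - hamField (hamDensity h c p s ε) (fun y => v0 y t + ε ^ 2 * v1 y t + ε ^ 4 * v2 y t) x)
      =O[𝓝 0] fun ε => ε ^ 6

/-! ### The generating functional -/

/-- The density of `K₁ = -(1/2) ∫ c u_x log (1 + t h''' u_x) dx`. -/
noncomputable def k1Density (h c : ℝ → ℝ) (t u u1 : ℝ) : ℝ :=
  -(1 / 2) * c u * u1 * Real.log (1 + t * iteratedDeriv 3 h u * u1)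

/-- The points `(t, u, u_x, u_xx)` with `u ∈ U` and `1 + t h'''(u) u_x > 0`. -/
def jetDomain (U : Set ℝ) (h : ℝ → ℝ) : Set (ℝ × ℝ × ℝ × ℝ) :=
  {q | q.2.1 ∈ U ∧ 0 < 1 + q.1 * iteratedDeriv 3 h q.2.1 * q.2.2.1}

/-- The explicit density of `K₃`, meaningful where `t ≠ 0`, `h'''(u) ≠ 0` and
`1 + t h'''(u) u_x > 0`. -/
noncomputable def k3Formula (h c s : ℝ → ℝ) (lam t u u1 u2 : ℝ) : ℝ :=
  let h3 := iteratedDeriv 3 h u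
  let h4 := iteratedDeriv 4 h u
  let h5 := iteratedDeriv 5 h u
  let h6 := iteratedDeriv 6 h u
  let c0 := c u
  let c1 := deriv c u
  let c2 := iteratedDeriv 2 c u
  let c3 := iteratedDeriv 3 c u
  let s0 := s u
  let ch3 := iteratedDeriv 3 (fun r => c r / iteratedDeriv 3 h r ^ 2) u
  let ch4 := deriv (fun r => c r * iteratedDeriv 4 h r) u
  let c1h4 := deriv (fun r => deriv c r * iteratedDeriv 4 h r) u
  let W := 1 + t * h3 * u1;
  -(ch3 + c3 / h3 ^ 2) * (c0 * u1 * Real.log W / (8 * t ^ 2))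
  - 1 / 40 * (c0 ^ 2 * h3 ^ 3 * t ^ 3 * u2 ^ 3 * (5 + 5 * t * h3 * u1 + t ^ 2 * h3 ^ 2 * u1 ^ 2)
      / W ^ 5)
  + 3 / 40 * (c0 ^ 2 * t * h4 * u2 ^ 2 * (4 + 10 * t * h3 * u1 + 5 * t ^ 2 * h3 ^ 2 * u1 ^ 2)
      / W ^ 5)
  + 1 / 2 * (t * h3 * s0 * u1 ^ 4 * (2 + t * h3 * u1) / W ^ 2)
  + 1 / 20 * ((3 * c0 * c1 + 5 * lam * c0 ^ 3) * t * h3 * u2 ^ 2 * (2 + t * h3 * u1)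
      * (2 + 2 * t * h3 * u1 + t ^ 2 * h3 ^ 2 * u1 ^ 2) / W ^ 4)
  - t * u1 ^ 4 * (c1 / 20 + lam / 12 * c0 ^ 2)
      * ((2 * c0 * h5 + 6 * c1 * h4) / W ^ 3 - 3 * t * c0 * h4 ^ 2 * u1 / W ^ 4)
  + u1 ^ 2 / (240 * t) *
    (12 * c0 ^ 2 * h4 ^ 3 / (h3 ^ 4 * W ^ 5)
      + 3 * c0 * h4 * (3 * h3 * h4 * c1 + 3 * h5 * h3 * c0 - 16 * c0 * h4 ^ 2) / (h3 ^ 4 * W ^ 4)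
      - 3 * h4 * (8 * c0 * c2 * h3 ^ 2 - 4 * c0 ^ 2 * h4 ^ 2 + 9 * c0 * c1 * h3 * h4
          + 9 * c0 ^ 2 * h3 * h5 - 16 * c1 ^ 2 * h3 ^ 2) / (h3 ^ 4 * W ^ 3)
      - (96 * c1 ^ 2 * h3 ^ 2 * h4 - 48 * c0 * c2 * h3 ^ 2 * h4 + 63 * c0 * c1 * h3 * h4 ^ 2
          + 5 * c0 * c3 * h3 ^ 3) / (h3 ^ 4 * W ^ 2)
      + (252 * c0 ^ 2 * h4 ^ 3 - 63 * c0 ^ 2 * h3 * h4 * h5) / (h3 ^ 4 * W ^ 2)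
      + (-30 * c0 ^ 2 * h3 ^ 2 * h6 + 441 * c0 ^ 2 * h3 * h4 * h5) / (h3 ^ 4 * W)
      - (90 * c0 * c1 * h3 ^ 2 * h5 - 441 * c0 * c1 * h3 * h4 ^ 2 + 768 * c0 ^ 2 * h4 ^ 3
          + 114 * c0 * c2 * h3 ^ 2 * h4) / (h3 ^ 4 * W)
      + (48 * c1 ^ 2 * h3 ^ 2 * h4 + 35 * c0 * c3 * h3 ^ 3) / (h3 ^ 4 * W)
      + 180 * c0 * h4 / h3 ^ 3 * ch4 - 90 * c0 / h3 ^ 2 * c1h4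
      - 30 * c0 ^ 2 * h6 / h3 ^ 2 - 180 * c0 ^ 2 * h4 ^ 3 / h3 ^ 4
      + 35 * c0 * c3 / h3 - 5 * c0 * c3 / h3 * W)

/-- The density of `K = ε K₁ + ε³ K₃` at time `t`, for a given density `κ₃` of `K₃`. -/
noncomputable def kDensity (h c : ℝ → ℝ) (κ₃ : ℝ → ℝ → ℝ → ℝ → ℝ) (ε t u u1 u2 : ℝ) : ℝ :=
  ε * k1Density h c t u u1 + ε ^ 3 * κ₃ t u u1 u2

/-! ### The explicit corrections for KdV, for a given profile `v = v⁰(·, t)` -/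

/-- The `ε²`-correction for KdV. -/
noncomputable def kdvV1 (t : ℝ) (v : ℝ → ℝ) (x : ℝ) : ℝ :=
  1 / 2 * iteratedDeriv 2 (fun y => Real.log (1 + t * deriv v y) - 1 / (1 + t * deriv v y)) x

/-- The `ε⁴`-correction for KdV. -/
noncomputable def kdvV2 (t : ℝ) (v : ℝ → ℝ) (x : ℝ) : ℝ :=
  t ^ 2 / 8 * iteratedDeriv 2 (fun y =>
    -(t ^ 2 / 10) * ((5 + t * deriv v y) * iteratedDeriv 2 v y ^ 3 / (1 + t * deriv v y) ^ 5)
    + t * deriv (fun z => 3 / 10 * ((20 + 15 * t * deriv v z + 3 * t ^ 2 * deriv v z ^ 2)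
        * iteratedDeriv 2 v z ^ 2 / (1 + t * deriv v z) ^ 5)) y
    + iteratedDeriv 2 (fun z => (2 + t * deriv v z) ^ 2 / (1 + t * deriv v z) ^ 4
        * iteratedDeriv 2 v z) y) x

set_option linter.unusedSimpArgs false
set_option linter.unusedSectionVars false

/-! ### Differential algebra of jets -/

/-! Write `D` for the x-derivative and `T` for the t-derivative along `v⁰`. Substituting the jets of
`v⁰` in a function `F` of `(t, u, u₁, u₂)` gives `T F = h'' D F + flow F`, where `flow = ∂_t +
h'''u₁² ∂₁ + (3h'''u₁u₂ + h⁗u₁³) ∂₂` is the time derivative along characteristics. Dually, the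
variational derivative `E κ` of a density satisfies `T (E κ) = h'' D (E κ) + E (flow κ - h'''u₁κ)`
(`IsFlow.apply_euler`). The transport equations thus become identities between densities.

Let `a = δK₁/δu`, let `b` be the variational derivative of `-½∫ c_h u_x²`, and let a lower star
denote the Fréchet derivative. Expanding the canonical map gives `v¹ = D a` and `v² = D (E κ₃ + ½
a_*(D a))`. The first equation amounts to `flow a = b` (`flow_alphaFn_add`). The second follows from
`flow κ₃ - h'''u₁κ₃ = H₄ + ½ {K₁, H₂} + null Lagrangian` (`flow_kappa3Fn`), with `H₂`, `H₄` the `ε²`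
and `ε⁴` parts of the Hamiltonian. Indeed `E {K₁, H₂} = b_*(D a) - a_*(D b)`, while `T` applied to
`½ a_*(D a)` yields `½ (b_*(D a) + a_*(D b) + h'''(D a)²)` besides the convective term. The `a_*(D
b)` terms cancel (`IsFlow.apply_secondCorrection`). The relation between `p`, `c` and `λ` makes the
identity for `κ₃` hold.

The formula for `κ₃` has apparent poles at `t = 0` and `h''' = 0`. They disappear when `log W` is
replaced by its Taylor polynomial at `W = 1` plus `(W - 1)⁵ r(W)`, because `W - 1 = t h'''u₁`; hence
a density smooth on the whole jet domain.

The function `A = h''(v⁰)` satisfies `A_t = A A_x`, and `W = 1 + t A_x` along `v⁰` solves `W_t = (A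
W)_x` with initial value 1. On a characteristic such a solution is its initial value times an
exponential, so `W > 0`; the same fact gives uniqueness for the transport equations. For the
perturbed equation the vector field along `v⁰ + ηv¹ + η²v²`, with `η = ε²`, is smooth in `η`, and
its three lowest coefficients are the right-hand sides of the equations for `v⁰`, `v¹`, `v²`. -/

theorem Derivation.map_ofNat_eq_zero {R : Type*} [CommRing R] [Algebra ℝ R] (D : Derivation ℝ R R)
    (n : ℕ) [n.AtLeastTwo] : D (ofNat(n) : R) = 0 := by
  exact_mod_cast D.map_natCast n

theorem Derivation.map_sq {R : Type*} [CommRing R] [Algebra ℝ R] (D : Derivation ℝ R R) (a : R) :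
    D (a ^ 2) = 2 * a * D a := by
  rw [pow_two, D.leibniz, smul_eq_mul]; ring

theorem Derivation.map_cube {R : Type*} [CommRing R] [Algebra ℝ R] (D : Derivation ℝ R R) (a : R) :
    D (a ^ 3) = 3 * a ^ 2 * D a := by
  rw [show a ^ 3 = a * a * a by ring, D.leibniz, D.leibniz, smul_eq_mul, smul_eq_mul, smul_eq_mul]
  ring

/-- A ring of functions of `(t, u, u₁, u₂)`, with its coordinate derivations. -/
structure JetRing (B : Type*) [CommRing B] [Algebra ℝ B] where
  dt : Derivation ℝ B B
  d0 : Derivation ℝ B B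
  d1 : Derivation ℝ B B
  d2 : Derivation ℝ B B
  d0_dt : ∀ F, d0 (dt F) = dt (d0 F)
  d1_dt : ∀ F, d1 (dt F) = dt (d1 F)
  d2_dt : ∀ F, d2 (dt F) = dt (d2 F)
  d1_d0 : ∀ F, d1 (d0 F) = d0 (d1 F)
  d2_d0 : ∀ F, d2 (d0 F) = d0 (d2 F)
  d2_d1 : ∀ F, d2 (d1 F) = d1 (d2 F)
  u1 : B
  u2 : B
  dt_u1 : dt u1 = 0
  d0_u1 : d0 u1 = 0
  d1_u1 : d1 u1 = 1
  d2_u1 : d2 u1 = 0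
  dt_u2 : dt u2 = 0
  d0_u2 : d0 u2 = 0
  d1_u2 : d1 u2 = 0
  d2_u2 : d2 u2 = 1

namespace JetRing

variable {B R : Type*} [CommRing B] [Algebra ℝ B] [CommRing R] [Algebra ℝ R]

/-- `J` is the substitution of the jets of `v` into functions of `(t, u, u₁, u₂)`, where `D` is the
spatial derivation. -/
structure IsSubst (Γ : JetRing B) (D : Derivation ℝ R R) (J : B →ₐ[ℝ] R) (v : R) : Prop where
  map_u1 : J Γ.u1 = D v
  map_u2 : J Γ.u2 = D (D v)
  apply : ∀ F, D (J F) = J (Γ.d0 F) * D v + J (Γ.d1 F) * D (D v) + J (Γ.d2 F) * D (D (D v))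

/-- The Euler operator. -/
def euler (Γ : JetRing B) (D : Derivation ℝ R R) (J : B →ₐ[ℝ] R) (κ : B) : R :=
  J (Γ.d0 κ) - D (J (Γ.d1 κ)) + D (D (J (Γ.d2 κ)))

/-- The Fréchet derivative of a function of jets in the direction `X`. -/
def frechet (Γ : JetRing B) (D : Derivation ℝ R R) (J : B →ₐ[ℝ] R) (F : B) (X : R) : R :=
  J (Γ.d0 F) * X + J (Γ.d1 F) * D X + J (Γ.d2 F) * D (D X)

/-- The Fréchet derivative of the Euler operator of a density. -/
def frechetEuler (Γ : JetRing B) (D : Derivation ℝ R R) (J : B →ₐ[ℝ] R) (κ : B) (X : R) : R :=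
  Γ.frechet D J (Γ.d0 κ) X - D (Γ.frechet D J (Γ.d1 κ) X) + D (D (Γ.frechet D J (Γ.d2 κ) X))

/-- A function of `u` alone. -/
structure IsBase (Γ : JetRing B) (f : B) : Prop where
  dt : Γ.dt f = 0
  d1 : Γ.d1 f = 0
  d2 : Γ.d2 f = 0

theorem IsBase.deriv {Γ : JetRing B} {f : B} (hf : Γ.IsBase f) : Γ.IsBase (Γ.d0 f) :=
  ⟨by rw [← Γ.d0_dt, hf.dt, map_zero], by rw [Γ.d1_d0, hf.d1, map_zero],
    by rw [Γ.d2_d0, hf.d2, map_zero]⟩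

/-- The derivation `∂_t + h''' u₁² ∂₁ + (3 h''' u₁ u₂ + h⁗ u₁³) ∂₂`, where `h3 = h'''`. -/
def flow (Γ : JetRing B) (h3 : B) : Derivation ℝ B B :=
  Γ.dt + (h3 * Γ.u1 ^ 2) • Γ.d1 + (3 * h3 * Γ.u1 * Γ.u2 + Γ.d0 h3 * Γ.u1 ^ 3) • Γ.d2

theorem flow_apply (Γ : JetRing B) (h3 F : B) : Γ.flow h3 F = Γ.dt F + h3 * Γ.u1 ^ 2 * Γ.d1 F
    + (3 * h3 * Γ.u1 * Γ.u2 + Γ.d0 h3 * Γ.u1 ^ 3) * Γ.d2 F := by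
  simp [flow]

/-- `T` is the time derivation along a solution `v` of `v_t = h'' v_x`, with `h2 = h''`. -/
structure IsFlow (Γ : JetRing B) (D T : Derivation ℝ R R) (J : B →ₐ[ℝ] R) (v : R) (h2 : B) :
    Prop extends Γ.IsSubst D J v where
  base : Γ.IsBase h2
  comm : ∀ a, T (D a) = D (T a)
  eqn : T v = J h2 * D v
  time : ∀ F, T (J F) = J (Γ.dt F) + J (Γ.d0 F) * T v + J (Γ.d1 F) * T (D v)
    + J (Γ.d2 F) * T (D (D v))

variable {Γ : JetRing B} {D T : Derivation ℝ R R} {J : B →ₐ[ℝ] R} {v : R} {h2 : B}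

/-- Differentiating `v_t = h'' v_x` gives `v_xt = h'' v_xx + h''' v_x²` and `v_xxt = h'' v_xxx +
3h''' v_x v_xx + h⁗ v_x³`. In the chain rule for `T` the terms with `h''` add up to `h'' D`; the
rest is `flow`. -/
theorem IsFlow.apply_map (H : Γ.IsFlow D T J v h2) (F : B) :
    T (J F) = J h2 * D (J F) + J (Γ.flow (Γ.d0 h2) F) := by
  simp only [flow_apply, H.time, H.comm, H.eqn, H.apply, map_add, map_mul, Derivation.leibniz,
    smul_eq_mul, H.base.d1, H.base.d2, H.base.deriv.d1, H.base.deriv.d2, H.map_u1, H.map_u2,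
    map_pow, map_ofNat, map_zero]
  ring

/-- Commutation of the Euler operator with the flow. -/
theorem IsFlow.apply_euler (H : Γ.IsFlow D T J v h2) (κ : B) :
    T (Γ.euler D J κ) = J h2 * D (Γ.euler D J κ)
      + Γ.euler D J (Γ.flow (Γ.d0 h2) κ - Γ.d0 h2 * Γ.u1 * κ) := by
  have b1 := H.base.deriv
  have b2 := b1.deriv
  simp only [euler, map_add, map_sub, H.comm, H.apply_map]
  simp only [flow_apply, H.apply, map_add, map_sub, map_mul, Derivation.leibniz, map_pow,
    Derivation.map_sq, Derivation.map_cube, Derivation.map_one_eq_zero, smul_eq_mul, H.base.d1, H.base.d2, b1.d1, b1.d2, b2.d1, b2.d2,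
    H.map_u1, H.map_u2, map_ofNat, map_zero, map_one, Γ.d0_dt, Γ.d1_dt, Γ.d2_dt, Γ.d1_d0, Γ.d2_d0,
    Γ.d2_d1, Γ.d0_u1, Γ.d0_u2, Γ.d1_u1, Γ.d1_u2, Γ.d2_u1, Γ.d2_u2,
    Derivation.map_ofNat_eq_zero, mul_zero, zero_mul, add_zero, zero_add, sub_zero]
  ring

/-- The order-two density equivalent to `-(a D b)` up to total derivatives, for `a = α + β u₂` and
`b = f u₂ + f' u₁² / 2`. -/
noncomputable def reducedBracket (Γ : JetRing B) (α β f : B) : B :=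
  (1 / 2 : ℝ) • (Γ.u2 ^ 2 * (Γ.d0 (β * f) * Γ.u1 + Γ.d1 (β * f) * Γ.u2))
    + Γ.u2 * (Γ.d0 (α * f) * Γ.u1 + Γ.d1 (α * f) * Γ.u2)
    - (α + β * Γ.u2) * (2 * Γ.d0 f * Γ.u1 * Γ.u2 + (1 / 2 : ℝ) • (Γ.d0 (Γ.d0 f) * Γ.u1 ^ 3))

/-- `f u₂ + f' u₁² / 2`. -/
noncomputable def quadEuler (Γ : JetRing B) (f : B) : B := f * Γ.u2 + (1 / 2 : ℝ) • (Γ.d0 f * Γ.u1 ^ 2)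

set_option maxHeartbeats 2000000 in
-- The hypothesis `hαβ` is the Helmholtz condition: it makes the Fréchet derivative of `a = α + β
-- u₂` self-adjoint, as that of `b` is. Varying `-∫ a D b` and integrating by parts then leaves
-- `b_*(D a) - a_*(D b)`.
theorem IsSubst.euler_reducedBracket (H : Γ.IsSubst D J v) {α β f : B} (hf : Γ.IsBase f)
    (hα2 : Γ.d2 α = 0) (hβ2 : Γ.d2 β = 0) (hαβ : Γ.d1 α = Γ.u1 * Γ.d0 β) :
    Γ.euler D J (Γ.reducedBracket α β f)
      = Γ.frechet D J (Γ.quadEuler f) (D (J (α + β * Γ.u2)))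
        - Γ.frechet D J (α + β * Γ.u2) (D (J (Γ.quadEuler f))) := by
  have b1 := hf.deriv
  have b2 := b1.deriv
  simp only [euler, frechet, quadEuler, reducedBracket]
  simp only [H.apply, map_add, map_sub, map_mul, Derivation.leibniz, map_pow,
    Derivation.map_sq, Derivation.map_cube, Derivation.map_one_eq_zero, smul_eq_mul, hf.d1, hf.d2, b1.d1, b1.d2, b2.d1, b2.d2, hα2, hβ2,
    hαβ, Derivation.map_smul, map_smul,
    H.map_u1, H.map_u2, map_ofNat, map_zero, map_one, Γ.d1_d0, Γ.d2_d0,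
    Γ.d2_d1, Γ.d0_u1, Γ.d0_u2, Γ.d1_u1, Γ.d1_u2, Γ.d2_u1, Γ.d2_u2,
    Derivation.map_ofNat_eq_zero, mul_zero, zero_mul, add_zero, zero_add, sub_zero, mul_one,
    smul_zero]
  algebra

/-- The linearization along the flow of an equation `∂_t a = h'' a_x + b` between functions of
jets. -/
theorem IsFlow.apply_frechet (H : Γ.IsFlow D T J v h2) {a b : B} (hab : Γ.flow (Γ.d0 h2) a = b) :
    T (Γ.frechet D J a (D (J a))) = J h2 * D (Γ.frechet D J a (D (J a)))
      + J (Γ.d0 h2) * D (J a) ^ 2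
      + Γ.frechet D J b (D (J a)) + Γ.frechet D J a (D (J b)) := by
  have b1 := H.base.deriv
  have b2 := b1.deriv
  subst hab
  have hX : T (D (J a)) = J h2 * D (D (J a)) + J (Γ.d0 h2) * D v * D (J a)
      + D (J (Γ.flow (Γ.d0 h2) a)) := by
    rw [H.comm, H.apply_map, map_add, D.leibniz, H.apply h2, H.base.d1, H.base.d2]
    simp only [smul_eq_mul, map_zero]
    ring
  have hX' := H.apply a
  set X := D (J a)
  set Y := D (J (Γ.flow (Γ.d0 h2) a)) with hY
  simp only [frechet, map_add, Derivation.leibniz, H.comm, H.apply_map, hX, smul_eq_mul]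
  simp only [flow_apply, H.apply, map_add, map_sub, map_mul, Derivation.leibniz, map_pow,
    Derivation.map_sq, Derivation.map_cube, Derivation.map_one_eq_zero, smul_eq_mul, H.base.d1,
    H.base.d2, b1.d1, b1.d2, b2.d1, b2.d2,
    H.map_u1, H.map_u2, map_ofNat, map_zero, map_one, Γ.d0_dt, Γ.d1_dt, Γ.d2_dt, Γ.d1_d0, Γ.d2_d0,
    Γ.d2_d1, Γ.d0_u1, Γ.d0_u2, Γ.d1_u1, Γ.d1_u2, Γ.d2_u1, Γ.d2_u2,
    Derivation.map_ofNat_eq_zero, mul_zero, zero_mul, add_zero, zero_add, sub_zero]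
  -- The commutators with `h''` leave `h''' X` times the chain-rule expansion of `D (J a)`, which is
  -- `X` again. This produces the term `h''' X²`.
  linear_combination (-(J (Γ.d0 h2) * X)) * hX'

/-- A density `R₀ + R₁ u₂` that is locally a total derivative has no Euler-Lagrange expression. -/
theorem IsSubst.euler_eq_zero (H : Γ.IsSubst D J v) {R0 R1 : B} (h0 : Γ.d2 R0 = 0)
    (h1 : Γ.d2 R1 = 0) (h : R0 = Γ.u1 * Γ.d1 R0 - Γ.u1 ^ 2 * Γ.d0 R1)
    (h' : Γ.d1 (Γ.d1 R0) = Γ.u1 * Γ.d0 (Γ.d1 R1) + 2 * Γ.d0 R1) :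
    Γ.euler D J (R0 + R1 * Γ.u2) = 0 := by
  have h'' : Γ.d0 R0 = Γ.u1 * Γ.d0 (Γ.d1 R0) - Γ.u1 ^ 2 * Γ.d0 (Γ.d0 R1) := by
    conv_lhs => rw [h]
    simp only [map_sub, Derivation.leibniz, Derivation.map_sq, smul_eq_mul, Γ.d0_u1]
    ring
  simp only [euler, h'', h0, h1, h', H.apply, map_add, map_sub, map_mul, Derivation.leibniz, map_pow,
    Derivation.map_sq, Derivation.map_one_eq_zero, smul_eq_mul,
    H.map_u1, H.map_u2, map_ofNat, map_zero, map_one, Γ.d1_d0, Γ.d2_d0,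
    Γ.d2_d1, Γ.d0_u1, Γ.d0_u2, Γ.d1_u1, Γ.d1_u2, Γ.d2_u1, Γ.d2_u2,
    Derivation.map_ofNat_eq_zero, mul_zero, zero_mul, add_zero, zero_add, sub_zero]
  ring

theorem euler_add (κ κ' : B) : Γ.euler D J (κ + κ') = Γ.euler D J κ + Γ.euler D J κ' := by
  simp only [euler, map_add]; ring

theorem euler_smul (r : ℝ) (κ : B) : Γ.euler D J (r • κ) = r • Γ.euler D J κ := by
  simp only [euler, Derivation.map_smul, map_smul, smul_add, smul_sub]

/-- The Euler-Lagrange expression of a first-order density. -/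
theorem IsSubst.euler_firstOrder (H : Γ.IsSubst D J v) {k : B} (hk : Γ.d2 k = 0) :
    Γ.euler D J k
      = J (Γ.d0 k - Γ.u1 * Γ.d0 (Γ.d1 k) + -Γ.d1 (Γ.d1 k) * Γ.u2) := by
  simp only [euler, H.apply, hk, Γ.d2_d1, map_add, map_sub, map_mul, map_neg, map_zero, H.map_u1,
    H.map_u2]
  ring

/-- The second bracket yields the linearization of `δK₁/δu` computed from the density, whereas the
flow equation concerns `δK₁/δu` as a function of jets of order two. This identifies the two
linearizations. -/
theorem IsSubst.frechetEuler_firstOrder (H : Γ.IsSubst D J v) {k : B} (hk : Γ.d2 k = 0) (X : R) :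
    Γ.frechetEuler D J k X = Γ.frechet D J
      (Γ.d0 k - Γ.u1 * Γ.d0 (Γ.d1 k) + -Γ.d1 (Γ.d1 k) * Γ.u2) X := by
  simp only [frechetEuler, frechet, H.apply, hk, Γ.d2_d1, Γ.d1_d0, Γ.d2_d0, map_add, map_sub,
    map_mul, map_neg, map_zero, H.map_u1, H.map_u2, Derivation.leibniz, smul_eq_mul, Γ.d0_u1,
    Γ.d0_u2, Γ.d1_u1, Γ.d1_u2, Γ.d2_u1, Γ.d2_u2, mul_zero, zero_mul, map_one]
  ring

/-- The second transport equation, in the form before the last `x`-derivative. -/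
theorem IsFlow.apply_secondCorrection (H : Γ.IsFlow D T J v h2) {α β f κ H4 R0 R1 : B}
    (hf : Γ.IsBase f) (hα2 : Γ.d2 α = 0) (hβ2 : Γ.d2 β = 0) (hαβ : Γ.d1 α = Γ.u1 * Γ.d0 β)
    (hab : Γ.flow (Γ.d0 h2) (α + β * Γ.u2) = Γ.quadEuler f)
    (hκ : Γ.flow (Γ.d0 h2) κ - Γ.d0 h2 * Γ.u1 * κ
      = H4 + (1 / 2 : ℝ) • Γ.reducedBracket α β f + (R0 + R1 * Γ.u2))
    (hR : Γ.euler D J (R0 + R1 * Γ.u2) = 0) {X M : R} (hX : X = D (J (α + β * Γ.u2)))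
    (hM : M = Γ.euler D J κ + (1 / 2 : ℝ) • Γ.frechet D J (α + β * Γ.u2) X) :
    T M = J h2 * D M + (1 / 2 : ℝ) • (J (Γ.d0 h2) * X ^ 2) + Γ.frechet D J (Γ.quadEuler f) X
      + Γ.euler D J H4 := by
  have hE := H.euler_reducedBracket hf hα2 hβ2 hαβ
  have hF := H.apply_frechet hab
  generalize α + β * Γ.u2 = a at *
  subst hX hM
  -- With `b = quadEuler f`, the bracket term contributes `½ (b_* X - a_*(D b))` and the linearized
  -- flow equation `½ (b_* X + a_*(D b))`; hence `b_* X` survives with coefficient 1.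
  simp only [map_add, Derivation.map_smul, hF, H.apply_euler, hκ, euler_add, euler_smul, hE, hR]
  algebra

end JetRing

/-! ### Algebras of smooth functions -/

section SmoothAlgebra

variable {E : Type*} [NormedAddCommGroup E] [NormedSpace ℝ E]
  {E' : Type*} [NormedAddCommGroup E'] [NormedSpace ℝ E']

/-- A domain on which smooth functions have well defined, commuting derivatives. -/
class SmoothDomain (S : Set E) : Prop where
  uniqueDiffOn : UniqueDiffOn ℝ S
  subset : S ⊆ closure (interior S)

theorem IsOpen.smoothDomain {S : Set E} (hS : IsOpen S) : SmoothDomain S :=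
  ⟨hS.uniqueDiffOn, by rw [hS.interior_eq]; exact subset_closure⟩

instance : SmoothDomain (univ : Set E) := isOpen_univ.smoothDomain

/-- The algebra of smooth real functions on `S`. -/
def smoothSubalgebra (S : Set E) : Subalgebra ℝ (S → ℝ) where
  carrier := {f | ∃ g : E → ℝ, ContDiffOn ℝ ∞ g S ∧ ∀ x : S, f x = g x}
  mul_mem' := by
    rintro a b ⟨f, hf, ha⟩ ⟨g, hg, hb⟩
    exact ⟨fun x => f x * g x, hf.mul hg, fun x => by simp [ha, hb]⟩
  add_mem' := by
    rintro a b ⟨f, hf, ha⟩ ⟨g, hg, hb⟩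
    exact ⟨fun x => f x + g x, hf.add hg, fun x => by simp [ha, hb]⟩
  algebraMap_mem' r := ⟨fun _ => r, contDiffOn_const, fun _ => rfl⟩

/-- The type of smooth real functions on `S`. -/
def SmoothFn (S : Set E) : Type _ := smoothSubalgebra S

namespace SmoothFn

instance (S : Set E) : CommRing (SmoothFn S) := inferInstanceAs (CommRing (smoothSubalgebra S))
instance (S : Set E) : Algebra ℝ (SmoothFn S) := inferInstanceAs (Algebra ℝ (smoothSubalgebra S))

variable {S : Set E} {S' : Set E'}

instance : CoeFun (SmoothFn S) fun _ => S → ℝ := ⟨fun f => f.1⟩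

@[ext] theorem ext {f g : SmoothFn S} (h : ∀ x, f x = g x) : f = g := Subtype.ext (funext h)

@[simp] protected theorem add_apply (f g : SmoothFn S) (x : S) : (f + g) x = f x + g x := rfl
@[simp] protected theorem sub_apply (f g : SmoothFn S) (x : S) : (f - g) x = f x - g x := rfl
@[simp] protected theorem neg_apply (f : SmoothFn S) (x : S) : (-f) x = -f x := rfl
@[simp] protected theorem mul_apply (f g : SmoothFn S) (x : S) : (f * g) x = f x * g x := rfl
@[simp] protected theorem pow_apply (f : SmoothFn S) (n : ℕ) (x : S) : (f ^ n) x = f x ^ n := rfl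
@[simp] protected theorem smul_apply (r : ℝ) (f : SmoothFn S) (x : S) : (r • f) x = r * f x := rfl
@[simp] protected theorem one_apply (x : S) : (1 : SmoothFn S) x = 1 := rfl
@[simp] protected theorem zero_apply (x : S) : (0 : SmoothFn S) x = 0 := rfl
@[simp] protected theorem ofNat_apply (n : ℕ) [n.AtLeastTwo] (x : S) :
    (ofNat(n) : SmoothFn S) x = ofNat(n) := rfl

/-- The restriction of a function that is smooth on `S`. -/
def of (g : E → ℝ) (hg : ContDiffOn ℝ ∞ g S) : SmoothFn S := ⟨fun x => g x, g, hg, fun _ => rfl⟩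

@[simp] theorem of_apply (g : E → ℝ) (hg : ContDiffOn ℝ ∞ g S) (x : S) : of g hg x = g x := rfl

/-- The extension by zero. -/
noncomputable def extend (f : SmoothFn S) : E → ℝ := Function.extend Subtype.val f.1 0

theorem extend_apply (f : SmoothFn S) {x : E} (hx : x ∈ S) : f.extend x = f ⟨x, hx⟩ :=
  Subtype.val_injective.extend_apply f.1 0 ⟨x, hx⟩

theorem contDiffOn_extend (f : SmoothFn S) : ContDiffOn ℝ ∞ f.extend S := by
  obtain ⟨g, hg, hf⟩ := f.2
  exact hg.congr fun x hx => by rw [f.extend_apply hx]; exact hf ⟨x, hx⟩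

theorem of_extend (f : SmoothFn S) : of f.extend f.contDiffOn_extend = f :=
  ext fun x => f.extend_apply x.2

theorem eqOn_extend_of (g : E → ℝ) (hg : ContDiffOn ℝ ∞ g S) : EqOn (of g hg).extend g S :=
  fun x hx => by rw [extend_apply _ hx]; rfl

theorem differentiableWithinAt_extend (f : SmoothFn S) {x : E} (hx : x ∈ S) :
    DifferentiableWithinAt ℝ f.extend S x :=
  (f.contDiffOn_extend.differentiableOn (by simp)) x hx

theorem contDiffOn_fderivWithin_apply [SmoothDomain S] {g : E → ℝ} (hg : ContDiffOn ℝ ∞ g S)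
    (e : E) : ContDiffOn ℝ ∞ (fun x => fderivWithin ℝ g S x e) S :=
  (hg.fderivWithin SmoothDomain.uniqueDiffOn (by simp)).clm_apply contDiffOn_const

/-- The directional derivative along `e`. -/
noncomputable def dir [SmoothDomain S] (e : E) : Derivation ℝ (SmoothFn S) (SmoothFn S) :=
  Derivation.mk'
    { toFun := fun f => of (fun x => fderivWithin ℝ f.extend S x e)
        (contDiffOn_fderivWithin_apply f.contDiffOn_extend e)
      map_add' := fun f g => ext fun x => by
        have hx := SmoothDomain.uniqueDiffOn (S := S) x x.2
        have h : EqOn (f + g).extend (f.extend + g.extend) S := fun y hy => by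
          simp [extend_apply _ hy]
        simp only [of_apply, SmoothFn.add_apply]
        rw [fderivWithin_congr h (h x.2), fderivWithin_add hx
          (f.differentiableWithinAt_extend x.2) (g.differentiableWithinAt_extend x.2)]
        rfl
      map_smul' := fun r f => ext fun x => by
        have hx := SmoothDomain.uniqueDiffOn (S := S) x x.2
        have h : EqOn (r • f).extend (r • f.extend) S := fun y hy => by
          simp [extend_apply _ hy]
        simp only [of_apply, SmoothFn.smul_apply, RingHom.id_apply]
        rw [fderivWithin_congr h (h x.2), fderivWithin_const_smul hx
          (f.differentiableWithinAt_extend x.2)]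
        rfl }
    fun f g => ext fun x => by
      have hx := SmoothDomain.uniqueDiffOn (S := S) x x.2
      have h : EqOn (f * g).extend (f.extend * g.extend) S := fun y hy => by
        simp [extend_apply _ hy]
      simp only [LinearMap.coe_mk, AddHom.coe_mk, of_apply, SmoothFn.add_apply, smul_eq_mul, SmoothFn.mul_apply]
      rw [fderivWithin_congr h (h x.2), fderivWithin_mul hx
          (f.differentiableWithinAt_extend x.2) (g.differentiableWithinAt_extend x.2)]
      simp [extend_apply _ x.2]

theorem dir_apply [SmoothDomain S] (e : E) (f : SmoothFn S) (x : S) :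
    dir e f x = fderivWithin ℝ f.extend S x e := rfl

theorem dir_of [SmoothDomain S] (e : E) (g : E → ℝ) (hg : ContDiffOn ℝ ∞ g S) :
    dir e (of g hg) = of (fun x => fderivWithin ℝ g S x e) (contDiffOn_fderivWithin_apply hg e) :=
  ext fun x => by
    rw [dir_apply, fderivWithin_congr (eqOn_extend_of g hg) (eqOn_extend_of g hg x.2)]; rfl

/-- Second derivatives within `S` are symmetric because `S` lies in the closure of its interior.
This is what `SmoothDomain` requires beyond unique differentiability; the strip, with its boundary
`t = 0`, is not open. -/
theorem dir_comm [SmoothDomain S] (e e' : E) (f : SmoothFn S) :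
    dir e (dir e' f) = dir e' (dir e f) := by
  have key : ∀ a b : E, ∀ x : S, dir a (dir b f) x
      = fderivWithin ℝ (fderivWithin ℝ f.extend S) S x a b := by
    intro a b x
    have hx := SmoothDomain.uniqueDiffOn (S := S) x x.2
    have hd : DifferentiableWithinAt ℝ (fderivWithin ℝ f.extend S) S x :=
      (f.contDiffOn_extend.fderivWithin SmoothDomain.uniqueDiffOn
        (m := ∞) (by simp)).differentiableOn (by simp) x x.2
    conv_lhs => rw [← of_extend f, dir_of, dir_of]
    rw [of_apply]
    rw [fderivWithin_clm_apply hx hd (differentiableWithinAt_const b)]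
    simp
  ext x
  rw [key, key]
  exact (f.contDiffOn_extend x x.2).isSymmSndFDerivWithinAt
    (by rw [minSmoothness_of_isRCLikeNormedField]; exact WithTop.coe_le_coe.2 (le_top : (2 : ℕ∞) ≤ ⊤))
    SmoothDomain.uniqueDiffOn (SmoothDomain.subset x.2) x.2 e e'

/-- Composition with a smooth map. -/
def pull (Φ : E' → E) (hΦ : ContDiffOn ℝ ∞ Φ S') (hm : MapsTo Φ S' S) :
    SmoothFn S →ₐ[ℝ] SmoothFn S' where
  toFun f := ⟨fun x => f ⟨Φ x, hm x.2⟩, fun y => f.extend (Φ y), f.contDiffOn_extend.comp hΦ hm,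
    fun x => (f.extend_apply (hm x.2)).symm⟩
  map_one' := rfl
  map_mul' _ _ := rfl
  map_zero' := rfl
  map_add' _ _ := rfl
  commutes' _ := rfl

@[simp] theorem pull_apply (Φ : E' → E) (hΦ : ContDiffOn ℝ ∞ Φ S') (hm : MapsTo Φ S' S)
    (f : SmoothFn S) (x : S') : pull Φ hΦ hm f x = f ⟨Φ x, hm x.2⟩ := rfl


theorem dir_pull [SmoothDomain S] [SmoothDomain S'] (Φ : E' → E) (hΦ : ContDiffOn ℝ ∞ Φ S')
    (hm : MapsTo Φ S' S) (f : SmoothFn S) (e : E') (x : S') :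
    dir e (pull Φ hΦ hm f) x = fderivWithin ℝ f.extend S (Φ x) (fderivWithin ℝ Φ S' x e) := by
  have h : pull Φ hΦ hm f = of (fun y => f.extend (Φ y)) (f.contDiffOn_extend.comp hΦ hm) :=
    ext fun y => (f.extend_apply (hm y.2)).symm
  rw [h, dir_of, of_apply]
  have := fderivWithin_comp (x : E') (f.differentiableWithinAt_extend (hm x.2))
    (hΦ.differentiableOn (by simp) x x.2) hm (SmoothDomain.uniqueDiffOn (S := S') x x.2)
  rw [show (fun y => f.extend (Φ y)) = f.extend ∘ Φ from rfl, this]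
  rfl

theorem dir_pull_one {U : Set ℝ} [SmoothDomain U] [SmoothDomain S'] (φ : E' → ℝ)
    (hφ : ContDiffOn ℝ ∞ φ S') (hm : MapsTo φ S' U) (f : SmoothFn U) (e : E') :
    dir e (pull φ hφ hm f) = pull φ hφ hm (dir 1 f) * dir e (of φ hφ) := by
  ext x
  rw [dir_pull, SmoothFn.mul_apply, pull_apply, dir_apply, dir_of, of_apply]
  simp only []
  conv_lhs => rw [← mul_one (fderivWithin ℝ φ S' x e), ← smul_eq_mul, map_smul, smul_eq_mul]
  ring

theorem dir_pull_four {Ω : Set (ℝ × ℝ × ℝ × ℝ)} [SmoothDomain Ω] [SmoothDomain S']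
    (Φ : E' → ℝ × ℝ × ℝ × ℝ) (hΦ : ContDiffOn ℝ ∞ Φ S') (hm : MapsTo Φ S' Ω)
    (F : SmoothFn Ω) (e : E') :
    dir e (pull Φ hΦ hm F) = pull Φ hΦ hm (dir (1, 0, 0, 0) F) * dir e (of (fun y => (Φ y).1) hΦ.fst)
      + pull Φ hΦ hm (dir (0, 1, 0, 0) F) * dir e (of (fun y => (Φ y).2.1) hΦ.snd.fst)
      + pull Φ hΦ hm (dir (0, 0, 1, 0) F) * dir e (of (fun y => (Φ y).2.2.1) hΦ.snd.snd.fst)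
      + pull Φ hΦ hm (dir (0, 0, 0, 1) F) * dir e (of (fun y => (Φ y).2.2.2) hΦ.snd.snd.snd) := by
  ext x
  have hx := SmoothDomain.uniqueDiffOn (S := S') x x.2
  have hd := hΦ.differentiableOn (by simp) x x.2
  rw [dir_pull]
  simp only [SmoothFn.add_apply, SmoothFn.mul_apply, pull_apply, dir_of, of_apply, dir_apply]
  have e1 := hd.hasFDerivWithinAt.fst.fderivWithin hx
  have e2 := hd.hasFDerivWithinAt.snd.fst.fderivWithin hx
  have e3 := hd.hasFDerivWithinAt.snd.snd.fst.fderivWithin hx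
  have e4 := hd.hasFDerivWithinAt.snd.snd.snd.fderivWithin hx
  rw [e1, e2, e3, e4]
  set L := fderivWithin ℝ F.extend Ω (Φ x)
  set w := fderivWithin ℝ Φ S' x
  have : w e = (w e).1 • ((1, 0, 0, 0) : ℝ × ℝ × ℝ × ℝ) + (w e).2.1 • ((0, 1, 0, 0) : ℝ × ℝ × ℝ × ℝ)
      + (w e).2.2.1 • ((0, 0, 1, 0) : ℝ × ℝ × ℝ × ℝ)
      + (w e).2.2.2 • ((0, 0, 0, 1) : ℝ × ℝ × ℝ × ℝ) := by
    ext <;> simp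
  rw [this, map_add, map_add, map_add, map_smul, map_smul, map_smul, map_smul]
  simp
  ring

end SmoothFn

end SmoothAlgebra

/-! ### The Taylor remainder of the logarithm -/

/-- The difference between `log` and the polynomial vanishes at 1 and has derivative `(w - 1)⁴ / w`,
so it vanishes there to order five and can be divided analytically by `(w - 1)⁵`. Order five is
needed because `(c / h'''²)'''` has the denominator `h'''⁵`. -/
theorem exists_smooth_log_remainder : ∃ r : ℝ → ℝ, ContDiffOn ℝ ∞ r (Ioi 0) ∧
    ∀ w, 0 < w → Real.log w = (w - 1) - (w - 1) ^ 2 / 2 + (w - 1) ^ 3 / 3 - (w - 1) ^ 4 / 4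
      + (w - 1) ^ 5 * r w := by
  set f : ℝ → ℝ := fun w => Real.log w
    - ((w - 1) - (w - 1) ^ 2 / 2 + (w - 1) ^ 3 / 3 - (w - 1) ^ 4 / 4) with hf
  have hd : ∀ w : ℝ, 0 < w → HasDerivAt f ((w - 1) ^ 4 * w⁻¹) w := by
    intro w hw
    have h1 : HasDerivAt (fun w : ℝ => w - 1) 1 w := (hasDerivAt_id w).sub_const 1
    have := (Real.hasDerivAt_log hw.ne').sub
      (((h1.sub ((h1.pow 2).div_const 2)).add ((h1.pow 3).div_const 3)).sub
        ((h1.pow 4).div_const 4))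
    refine (this.congr_deriv ?_)
    field_simp
    ring
  have han : AnalyticAt ℝ f 1 := by
    refine (analyticAt_log one_pos).sub ?_
    fun_prop
  have hord : (5 : ℕ) ≤ analyticOrderAt f 1 := by
    have h1 : f 1 = 0 := by simp [hf]
    have h2 : analyticOrderAt f 1 = analyticOrderAt (deriv f) 1 + 1 := by
      rw [han.analyticOrderAt_deriv_add_one]
      simp [h1]
    have h3 : (4 : ℕ) ≤ analyticOrderAt (deriv f) 1 := by
      rw [natCast_le_analyticOrderAt han.deriv]
      refine ⟨fun w => w⁻¹, analyticAt_inv one_ne_zero, ?_⟩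
      filter_upwards [lt_mem_nhds (zero_lt_one (α := ℝ))] with w hw
      rw [(hd w hw).deriv, smul_eq_mul]
    rw [h2]
    push_cast at h3 ⊢
    calc (5 : ℕ∞) = 4 + 1 := by norm_num
      _ ≤ _ := by gcongr
  obtain ⟨g, hg, hfg⟩ := (natCast_le_analyticOrderAt han).1 hord
  -- The quotient, with its removable singularity at 1 filled by the analytic factor.
  refine ⟨fun w => if w = 1 then g 1 else f w / (w - 1) ^ 5, ?_, ?_⟩
  · intro w hw
    have hw : 0 < w := hw
    refine ContDiffAt.contDiffWithinAt ?_
    by_cases h1 : w = 1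
    · subst h1
      refine hg.contDiffAt.congr_of_eventuallyEq ?_
      filter_upwards [hfg] with y hy
      split_ifs with h
      · rw [h]
      · rw [hy, smul_eq_mul, mul_div_cancel_left₀ _ (pow_ne_zero 5 (sub_ne_zero.2 h))]
    · have hs : ContDiffAt ℝ ∞ (fun w => f w / (w - 1) ^ 5) w := by
        refine ContDiffAt.div ?_ (by fun_prop) (pow_ne_zero 5 (sub_ne_zero.2 h1))
        refine (Real.contDiffAt_log.2 hw.ne').sub ?_
        fun_prop
      refine hs.congr_of_eventuallyEq ?_
      filter_upwards [isOpen_ne.mem_nhds h1] with y hy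
      rw [if_neg hy]
  · intro w hw
    by_cases h1 : w = 1
    · simp [h1]
    · have : (w - 1) ^ 5 ≠ 0 := pow_ne_zero 5 (sub_ne_zero.2 h1)
      simp only [if_neg h1]
      rw [mul_div_cancel₀ _ this]
      simp [hf]

/-- The function `r` with `log w = (w-1) - (w-1)²/2 + (w-1)³/3 - (w-1)⁴/4 + (w-1)⁵ r(w)`. -/
noncomputable def logRemainder : ℝ → ℝ := exists_smooth_log_remainder.choose

theorem contDiffOn_logRemainder : ContDiffOn ℝ ∞ logRemainder (Ioi 0) :=
  exists_smooth_log_remainder.choose_spec.1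

theorem log_eq_logRemainder {w : ℝ} (hw : 0 < w) : Real.log w = (w - 1) - (w - 1) ^ 2 / 2
    + (w - 1) ^ 3 / 3 - (w - 1) ^ 4 / 4 + (w - 1) ^ 5 * logRemainder w :=
  exists_smooth_log_remainder.choose_spec.2 w hw

/-- Differentiating the expansion of `log` and summing the geometric series gives this relation
multiplied by `(w - 1)⁴`. Cancelling that factor requires `w ≠ 1`; the point `w = 1` follows by
continuity. -/
theorem deriv_logRemainder {w : ℝ} (hw : 0 < w) :
    (w - 1) * deriv logRemainder w = w⁻¹ - 5 * logRemainder w := by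
  have hc : ∀ y ∈ Ioi (0 : ℝ), ContDiffAt ℝ ∞ logRemainder y := fun y hy =>
    contDiffOn_logRemainder.contDiffAt (isOpen_Ioi.mem_nhds hy)
  have hne : ∀ y : ℝ, 0 < y → y ≠ 1 →
      (y - 1) * deriv logRemainder y = y⁻¹ - 5 * logRemainder y := by
    intro y hy h1
    have hl := ((hc y hy).differentiableAt (by simp)).hasDerivAt
    have h1' : HasDerivAt (fun w : ℝ => w - 1) 1 y := (hasDerivAt_id y).sub_const 1
    have h2 := (((h1'.sub ((h1'.pow 2).div_const 2)).add ((h1'.pow 3).div_const 3)).sub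
        ((h1'.pow 4).div_const 4)).add ((h1'.pow 5).mul hl)
    have h3 := (Real.hasDerivAt_log hy.ne').congr_of_eventuallyEq (f₁ := _) (by
      filter_upwards [isOpen_Ioi.mem_nhds hy] with w hw
      exact (log_eq_logRemainder hw).symm)
    have h4 := h2.unique h3
    have h5 : (y - 1) ^ 4 ≠ 0 := pow_ne_zero 4 (sub_ne_zero.2 h1)
    apply mul_left_cancel₀ h5
    have hy' := hy.ne'
    have h6 : (y - 1) ^ 4 * y⁻¹ = y⁻¹ - (1 - (y - 1) + (y - 1) ^ 2 - (y - 1) ^ 3) := by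
      field_simp; ring
    simp only [Pi.pow_apply] at h4
    rw [mul_sub, h6, ← h4]
    norm_num
    ring
  by_cases h1 : w = 1
  · subst h1
    have hF : ContinuousAt (fun y : ℝ => (y - 1) * deriv logRemainder y
        - (y⁻¹ - 5 * logRemainder y)) 1 := by
      have h0 : ContDiffAt ℝ ∞ logRemainder 1 := hc 1 (mem_Ioi.2 one_pos)
      have hdc : ContinuousAt (deriv logRemainder) 1 :=
        ((contDiffOn_logRemainder.deriv_of_isOpen (m := ∞) isOpen_Ioi (by simp)).continuousOn
          ).continuousAt (isOpen_Ioi.mem_nhds (mem_Ioi.2 one_pos))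
      have h0' := h0.continuousAt
      have hi : ContinuousAt (fun y : ℝ => y⁻¹) 1 := continuousAt_inv₀ one_ne_zero
      exact ((continuousAt_id.sub continuousAt_const).mul hdc).sub
        (hi.sub (continuousAt_const.mul h0'))
    have ht := hF.tendsto.mono_left (nhdsWithin_le_nhds (s := {1}ᶜ))
    have hz : Tendsto (fun y : ℝ => (y - 1) * deriv logRemainder y
        - (y⁻¹ - 5 * logRemainder y)) (𝓝[≠] 1) (𝓝 0) := by
      refine tendsto_const_nhds.congr' ?_
      filter_upwards [nhdsWithin_le_nhds (lt_mem_nhds (zero_lt_one (α := ℝ))),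
        self_mem_nhdsWithin] with y hy hy1
      rw [hne y hy hy1, sub_self]
    exact sub_eq_zero.1 (tendsto_nhds_unique ht hz)
  · exact hne w hw h1

/-! ### The algebra of functions on the jet domain -/

open SmoothFn

theorem SmoothFn.dir_of_clm {E : Type*} [NormedAddCommGroup E] [NormedSpace ℝ E] {S : Set E}
    [SmoothDomain S] (l : E →L[ℝ] ℝ) (e : E) :
    dir e (of (S := S) l l.contDiff.contDiffOn) = algebraMap ℝ _ (l e) :=
  SmoothFn.ext fun x => by
    rw [dir_of, of_apply, l.fderivWithin (SmoothDomain.uniqueDiffOn _ x.2)]; rfl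

theorem contDiffOn_iteratedDeriv {U : Set ℝ} (hU : IsOpen U) {f : ℝ → ℝ} (hf : ContDiffOn ℝ ∞ f U)
    (n : ℕ) : ContDiffOn ℝ ∞ (iteratedDeriv n f) U := by
  induction n with
  | zero => simpa using hf
  | succ n ih =>
    rw [iteratedDeriv_succ]
    exact ih.deriv_of_isOpen hU (by simp)

theorem SmoothFn.dir_one_apply {U : Set ℝ} (hU : IsOpen U) [SmoothDomain U] (f : SmoothFn U)
    {g : ℝ → ℝ} (hg : ∀ u : U, f u = g u) (u : U) : dir 1 f u = deriv g u := by
  rw [dir_apply, fderivWithin_of_isOpen hU u.2, fderiv_apply_one_eq_deriv]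
  refine Filter.EventuallyEq.deriv_eq ?_
  filter_upwards [hU.mem_nhds u.2] with y hy
  rw [extend_apply _ hy, hg]

/-- The derivatives of a function on an open subset of the line. -/
theorem SmoothFn.iterate_dir_apply {U : Set ℝ} (hU : IsOpen U) [SmoothDomain U] (f : SmoothFn U)
    {g : ℝ → ℝ} (hg : ∀ u : U, f u = g u) (n : ℕ) (u : U) :
    ((dir (1 : ℝ))^[n] f) u = iteratedDeriv n g u := by
  induction n generalizing u with
  | zero => simpa using hg u
  | succ n ih =>
    rw [Function.iterate_succ_apply', iteratedDeriv_succ]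
    exact dir_one_apply hU _ ih u

/-- The Hamiltonian density is smooth on `U`. -/
class SmoothHam (U : Set ℝ) (h : ℝ → ℝ) : Prop where
  smooth : ContDiffOn ℝ ∞ h U

section JetAlgebra

variable {U : Set ℝ} {h : ℝ → ℝ} [hU : Fact (IsOpen U)] [hh : SmoothHam U h]

instance smoothDomain_of_isOpen : SmoothDomain U := hU.out.smoothDomain

instance smoothDomain_Ioi : SmoothDomain (Ioi (0 : ℝ)) := isOpen_Ioi.smoothDomain

/-- The derivatives of `h`. -/
noncomputable def hFn (U : Set ℝ) (h : ℝ → ℝ) [Fact (IsOpen U)] [SmoothHam U h] (n : ℕ) :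
    SmoothFn U := (dir (1 : ℝ))^[n] (of h SmoothHam.smooth)

theorem dir_hFn (n : ℕ) : dir 1 (hFn U h n) = hFn U h (n + 1) := by
  rw [hFn, hFn, Function.iterate_succ_apply']

theorem hFn_apply (n : ℕ) (u : U) : hFn U h n u = iteratedDeriv n h u :=
  iterate_dir_apply hU.out _ (fun _ => rfl) n u

theorem isOpen_jetDomain (U : Set ℝ) (h : ℝ → ℝ) [hU : Fact (IsOpen U)] [SmoothHam U h] :
    IsOpen (jetDomain U h) := by
  have ho : IsOpen {q : ℝ × ℝ × ℝ × ℝ | q.2.1 ∈ U} := hU.out.preimage (by fun_prop)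
  have hc : ContinuousOn (fun q : ℝ × ℝ × ℝ × ℝ => 1 + q.1 * iteratedDeriv 3 h q.2.1 * q.2.2.1)
      {q | q.2.1 ∈ U} := by
    have := (contDiffOn_iteratedDeriv hU.out (SmoothHam.smooth (h := h)) 3).continuousOn.comp
      (continuous_fst.comp continuous_snd : Continuous fun q : ℝ × ℝ × ℝ × ℝ => q.2.1).continuousOn
      (fun q (hq : q ∈ {q : ℝ × ℝ × ℝ × ℝ | q.2.1 ∈ U}) => hq)
    refine continuousOn_const.add ((ContinuousOn.mul ?_ this).mul ?_) <;> fun_prop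
  exact hc.isOpen_inter_preimage ho isOpen_Ioi

instance smoothDomain_jetDomain : SmoothDomain (jetDomain U h) :=
  (isOpen_jetDomain U h).smoothDomain

/-- The smooth functions of `(t, u, u₁, u₂)`. -/
abbrev JetFn (U : Set ℝ) (h : ℝ → ℝ) : Type := SmoothFn (jetDomain U h)

namespace JetFn

theorem mapsTo_u : MapsTo (fun q : ℝ × ℝ × ℝ × ℝ => q.2.1) (jetDomain U h) U := fun _ hq => hq.1

/-- Smooth functions of `u`. -/
noncomputable def base : SmoothFn U →ₐ[ℝ] JetFn U h :=
  pull (fun q => q.2.1) contDiff_snd.fst.contDiffOn mapsTo_u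

@[simp] theorem base_apply (f : SmoothFn U) (q : jetDomain U h) :
    base f q = f ⟨(q : ℝ × ℝ × ℝ × ℝ).2.1, q.2.1⟩ := rfl

/-- The coordinate `t`. -/
noncomputable def time : JetFn U h := of (fun q => q.1) contDiff_fst.contDiffOn

theorem dir_time (e : ℝ × ℝ × ℝ × ℝ) : dir e (time (U := U) (h := h)) = algebraMap ℝ _ e.1 :=
  dir_of_clm (ContinuousLinearMap.fst ℝ ℝ (ℝ × ℝ × ℝ)) e

theorem dir_u (e : ℝ × ℝ × ℝ × ℝ) :
    dir e (of (S := jetDomain U h) (fun q => q.2.1) contDiff_snd.fst.contDiffOn)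
      = algebraMap ℝ _ e.2.1 :=
  dir_of_clm ((ContinuousLinearMap.fst ℝ ℝ (ℝ × ℝ)).comp
    (ContinuousLinearMap.snd ℝ ℝ (ℝ × ℝ × ℝ))) e

theorem dir_u1 (e : ℝ × ℝ × ℝ × ℝ) :
    dir e (of (S := jetDomain U h) (fun q => q.2.2.1) contDiff_snd.snd.fst.contDiffOn)
      = algebraMap ℝ _ e.2.2.1 :=
  dir_of_clm ((ContinuousLinearMap.fst ℝ ℝ ℝ).comp ((ContinuousLinearMap.snd ℝ ℝ _).comp
    (ContinuousLinearMap.snd ℝ ℝ _))) e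

theorem dir_u2 (e : ℝ × ℝ × ℝ × ℝ) :
    dir e (of (S := jetDomain U h) (fun q => q.2.2.2) contDiff_snd.snd.snd.contDiffOn)
      = algebraMap ℝ _ e.2.2.2 :=
  dir_of_clm ((ContinuousLinearMap.snd ℝ ℝ ℝ).comp ((ContinuousLinearMap.snd ℝ ℝ _).comp
    (ContinuousLinearMap.snd ℝ ℝ _))) e

theorem dir_base (f : SmoothFn U) (e : ℝ × ℝ × ℝ × ℝ) :
    dir e (base f : JetFn U h) = base (dir 1 f) * algebraMap ℝ _ e.2.1 := by
  rw [base, dir_pull_one, dir_u]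

/-- The algebra of smooth functions of `(t, u, u₁, u₂)`. -/
noncomputable def ring (U : Set ℝ) (h : ℝ → ℝ) [hU : Fact (IsOpen U)] [SmoothHam U h] :
    JetRing (JetFn U h) where
  dt := dir (1, 0, 0, 0)
  d0 := dir (0, 1, 0, 0)
  d1 := dir (0, 0, 1, 0)
  d2 := dir (0, 0, 0, 1)
  d0_dt := dir_comm _ _
  d1_dt := dir_comm _ _
  d2_dt := dir_comm _ _
  d1_d0 := dir_comm _ _
  d2_d0 := dir_comm _ _
  d2_d1 := dir_comm _ _
  u1 := of (fun q => q.2.2.1) contDiff_snd.snd.fst.contDiffOn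
  u2 := of (fun q => q.2.2.2) contDiff_snd.snd.snd.contDiffOn
  dt_u1 := (dir_u1 _).trans (by simp)
  d0_u1 := (dir_u1 _).trans (by simp)
  d1_u1 := (dir_u1 _).trans (by simp)
  d2_u1 := (dir_u1 _).trans (by simp)
  dt_u2 := (dir_u2 _).trans (by simp)
  d0_u2 := (dir_u2 _).trans (by simp)
  d1_u2 := (dir_u2 _).trans (by simp)
  d2_u2 := (dir_u2 _).trans (by simp)

theorem u1_apply (q : jetDomain U h) : (ring U h).u1 q = (q : ℝ × ℝ × ℝ × ℝ).2.2.1 := rfl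
theorem u2_apply (q : jetDomain U h) : (ring U h).u2 q = (q : ℝ × ℝ × ℝ × ℝ).2.2.2 := rfl
theorem time_apply (q : jetDomain U h) : time q = (q : ℝ × ℝ × ℝ × ℝ).1 := rfl

theorem dt_base (f : SmoothFn U) : (ring U h).dt (base f) = 0 := (dir_base f _).trans (by simp)
theorem d0_base (f : SmoothFn U) : (ring U h).d0 (base f) = base (dir 1 f) :=
  (dir_base f _).trans (by simp)
theorem d1_base (f : SmoothFn U) : (ring U h).d1 (base f) = 0 := (dir_base f _).trans (by simp)
theorem d2_base (f : SmoothFn U) : (ring U h).d2 (base f) = 0 := (dir_base f _).trans (by simp)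
theorem isBase (f : SmoothFn U) : (ring U h).IsBase (base f) := ⟨dt_base f, d1_base f, d2_base f⟩

theorem dt_time : (ring U h).dt time = 1 := (dir_time _).trans (by simp)
theorem d0_time : (ring U h).d0 time = 0 := (dir_time _).trans (by simp)
theorem d1_time : (ring U h).d1 time = 0 := (dir_time _).trans (by simp)
theorem d2_time : (ring U h).d2 time = 0 := (dir_time _).trans (by simp)

/-- `W = 1 + t h''' u₁`. -/
noncomputable def wr : JetFn U h := 1 + time * base (hFn U h 3) * (ring U h).u1

theorem wr_pos (q : jetDomain U h) : 0 < wr q := by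
  have := q.2.2
  simpa [wr, time, u1_apply, hFn_apply] using this

theorem extend_wr_mapsTo : MapsTo (wr (U := U) (h := h)).extend (jetDomain U h) (Ioi 0) :=
  fun q hq => by rw [extend_apply _ hq]; exact wr_pos ⟨q, hq⟩

/-- Composition of a function of a positive variable with `W`. -/
noncomputable def ofWr : SmoothFn (Ioi (0 : ℝ)) →ₐ[ℝ] JetFn U h :=
  pull wr.extend wr.contDiffOn_extend extend_wr_mapsTo

theorem ofWr_apply (f : SmoothFn (Ioi (0 : ℝ))) (q : jetDomain U h) :
    ofWr f q = f ⟨wr q, wr_pos q⟩ := by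
  rw [ofWr, pull_apply]
  exact congrArg f.1 (Subtype.ext (extend_apply _ q.2))

theorem dir_ofWr (f : SmoothFn (Ioi (0 : ℝ))) (e : ℝ × ℝ × ℝ × ℝ) :
    dir e (ofWr f : JetFn U h) = ofWr (dir 1 f) * dir e wr := by
  rw [ofWr, dir_pull_one, of_extend]

/-- `1 / W`. -/
noncomputable def winv : JetFn U h := ofWr (of (fun w => w⁻¹)
  fun _ hw => (contDiffAt_inv ℝ (ne_of_gt hw)).contDiffWithinAt)

/-- `log W`. -/
noncomputable def logW : JetFn U h := ofWr (of Real.log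
  fun _ hw => (Real.contDiffAt_log.2 (ne_of_gt hw)).contDiffWithinAt)

/-- The remainder `r(W)` of the logarithm. -/
noncomputable def rem : JetFn U h := ofWr (of logRemainder contDiffOn_logRemainder)

/-- The derivative `r'(W)`. -/
noncomputable def rem' : JetFn U h := ofWr (dir 1 (of logRemainder contDiffOn_logRemainder))

theorem winv_apply (q : jetDomain U h) : winv q = (wr q)⁻¹ := ofWr_apply _ q
theorem logW_apply (q : jetDomain U h) : logW q = Real.log (wr q) := ofWr_apply _ q
theorem rem_apply (q : jetDomain U h) : rem q = logRemainder (wr q) := ofWr_apply _ q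

/-- This is the only property of the remainder that the identities for `κ₃` use: it eliminates `r'`,
after which `r` behaves as an indeterminate. -/
theorem rem'_relation : (wr - 1) * rem' = winv - 5 * (rem : JetFn U h) := by
  ext q
  simp only [SmoothFn.mul_apply, SmoothFn.sub_apply, SmoothFn.one_apply, SmoothFn.ofNat_apply, winv_apply, rem_apply, rem',
    ofWr_apply]
  rw [dir_one_apply isOpen_Ioi _ (g := logRemainder) (fun _ => rfl)]
  exact deriv_logRemainder (wr_pos q)

theorem dir_winv (e : ℝ × ℝ × ℝ × ℝ) : dir e (winv : JetFn U h) = -winv ^ 2 * dir e wr := by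
  rw [winv, dir_ofWr]
  congr 1
  ext q
  rw [ofWr_apply, dir_one_apply isOpen_Ioi _ (g := fun w => w⁻¹) (fun _ => rfl),
    SmoothFn.neg_apply, SmoothFn.pow_apply, ofWr_apply]
  simp only [deriv_inv', neg_inj]
  exact (inv_pow _ _).symm

theorem dir_logW (e : ℝ × ℝ × ℝ × ℝ) : dir e (logW : JetFn U h) = winv * dir e wr := by
  rw [logW, dir_ofWr]
  congr 1
  ext q
  rw [ofWr_apply, dir_one_apply isOpen_Ioi _ (g := Real.log) (fun _ => rfl), winv_apply]
  simp

theorem dir_rem (e : ℝ × ℝ × ℝ × ℝ) : dir e (rem : JetFn U h) = rem' * dir e wr := dir_ofWr _ e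

theorem dt_wr : (ring U h).dt wr = base (hFn U h 3) * (ring U h).u1 := by
  simp [wr, dt_time, dt_base, (ring U h).dt_u1, mul_comm]
theorem d0_wr : (ring U h).d0 wr = time * base (hFn U h 4) * (ring U h).u1 := by
  simp [wr, d0_time, d0_base, (ring U h).d0_u1, dir_hFn]
  ring
theorem d1_wr : (ring U h).d1 wr = time * base (hFn U h 3) := by
  simp [wr, d1_time, d1_base, (ring U h).d1_u1]
theorem d2_wr : (ring U h).d2 wr = 0 := by
  simp [wr, d2_time, d2_base, (ring U h).d2_u1]

theorem dt_winv : (ring U h).dt winv = -winv ^ 2 * (base (hFn U h 3) * (ring U h).u1) := by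
  rw [← dt_wr]; exact dir_winv _
theorem d0_winv : (ring U h).d0 winv = -winv ^ 2 * (time * base (hFn U h 4) * (ring U h).u1) := by
  rw [← d0_wr]; exact dir_winv _
theorem d1_winv : (ring U h).d1 winv = -winv ^ 2 * (time * base (hFn U h 3)) := by
  rw [← d1_wr]; exact dir_winv _
theorem d2_winv : (ring U h).d2 winv = 0 := (dir_winv _).trans (by
  rw [show dir _ wr = (ring U h).d2 wr from rfl, d2_wr, mul_zero])
theorem d0_logW : (ring U h).d0 logW = winv * (time * base (hFn U h 4) * (ring U h).u1) := by
  rw [← d0_wr]; exact dir_logW _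
theorem d1_logW : (ring U h).d1 logW = winv * (time * base (hFn U h 3)) := by
  rw [← d1_wr]; exact dir_logW _
theorem d2_logW : (ring U h).d2 logW = 0 := (dir_logW _).trans (by
  rw [show dir _ wr = (ring U h).d2 wr from rfl, d2_wr, mul_zero])
theorem dt_rem : (ring U h).dt rem = rem' * (base (hFn U h 3) * (ring U h).u1) := by
  rw [← dt_wr]; exact dir_rem _
theorem d1_rem : (ring U h).d1 rem = rem' * (time * base (hFn U h 3)) := by
  rw [← d1_wr]; exact dir_rem _
theorem d2_rem : (ring U h).d2 rem = 0 := (dir_rem _).trans (by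
  rw [show dir _ wr = (ring U h).d2 wr from rfl, d2_wr, mul_zero])

end JetFn

end JetAlgebra

open SmoothFn JetFn

/-! ### The generating functional -/

section Generator

variable {U : Set ℝ} {h : ℝ → ℝ} [hU : Fact (IsOpen U)] [hh : SmoothHam U h]

/-- The derivatives of a function of `u`. -/
noncomputable def derivFn (f : SmoothFn U) (n : ℕ) : SmoothFn U := (dir (1 : ℝ))^[n] f

theorem dir_derivFn (f : SmoothFn U) (n : ℕ) : dir 1 (derivFn f n) = derivFn f (n + 1) := by
  rw [derivFn, derivFn, Function.iterate_succ_apply']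

/-- `c h'''`. -/
noncomputable def cHFn (h : ℝ → ℝ) [SmoothHam U h] (c : SmoothFn U) : SmoothFn U :=
  derivFn c 0 * hFn U h 3

/-- `p h''' + (3/10) c² h⁗`. -/
noncomputable def pHFn (h : ℝ → ℝ) [SmoothHam U h] (c p : SmoothFn U) : SmoothFn U :=
  derivFn p 0 * hFn U h 3 + (3 / 10 : ℝ) • (derivFn c 0 ^ 2 * hFn U h 4)

/-- The coefficient `s_h`. -/
noncomputable def sHFn (h : ℝ → ℝ) [SmoothHam U h] (c p s : SmoothFn U) : SmoothFn U :=
  derivFn s 0 * hFn U h 3 - (1 / 8 : ℝ) • (derivFn c 0 * derivFn c 2 * hFn U h 4)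
    - (1 / 8 : ℝ) • (derivFn c 0 * derivFn c 1 * hFn U h 5)
    - (1 / 24 : ℝ) • (derivFn c 0 ^ 2 * hFn U h 6)
    - (1 / 6 : ℝ) • (derivFn p 1 * hFn U h 4) - (1 / 6 : ℝ) • (derivFn p 0 * hFn U h 5)

/-- The density of `K₁`. -/
noncomputable def k1Fn (h : ℝ → ℝ) [SmoothHam U h] (c : SmoothFn U) : JetFn U h :=
  (-(1 / 2) : ℝ) • (base (derivFn c 0) * (ring U h).u1 * logW)

/-- The part of `δK₁/δu` that does not involve `u₂`. -/
noncomputable def alphaFn (h : ℝ → ℝ) [SmoothHam U h] (c : SmoothFn U) : JetFn U h :=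
  (1 / 2 : ℝ) • (base (derivFn c 1) * (ring U h).u1 * (1 - winv))
    + (1 / 2 : ℝ) • (base (derivFn c 0) * time * base (hFn U h 4) * (ring U h).u1 ^ 2 * winv ^ 2)

/-- The coefficient of `u₂` in `δK₁/δu`. -/
noncomputable def betaFn (h : ℝ → ℝ) [SmoothHam U h] (c : SmoothFn U) : JetFn U h :=
  (1 / 2 : ℝ) • (base (derivFn c 0) * time * base (hFn U h 3) * (winv + winv ^ 2))

/-- The coefficient of the logarithmic remainder in `κ₃`. -/
noncomputable def remCoeff (h : ℝ → ℝ) [SmoothHam U h] (c : SmoothFn U) : JetFn U h :=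
  let h3 := base (hFn U h 3)
  let h4 := base (hFn U h 4)
  let h5 := base (hFn U h 5)
  let h6 := base (hFn U h 6)
  let c0 := base (derivFn c 0)
  let c1 := base (derivFn c 1)
  let c2 := base (derivFn c 2)
  let c3 := base (derivFn c 3)
  (-9 / 4 : ℝ) • (c0 * c1 * h4 ^ 2 * h3) + (3 / 4 : ℝ) • (c0 * c1 * h5 * h3 ^ 2)
    + (3 / 4 : ℝ) • (c0 * c2 * h4 * h3 ^ 2) + (-1 / 4 : ℝ) • (c0 * c3 * h3 ^ 3)
    + (-9 / 4 : ℝ) • (c0 ^ 2 * h4 * h5 * h3) + (3 : ℝ) • (c0 ^ 2 * h4 ^ 3)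
    + (1 / 4 : ℝ) • (c0 ^ 2 * h6 * h3 ^ 2)

/-- The density `κ₃`, in a form that is smooth on the whole jet domain. -/
noncomputable def kappa3Fn (h : ℝ → ℝ) [SmoothHam U h] (c s : SmoothFn U) (lam : ℝ) : JetFn U h :=
  let t : JetFn U h := time
  let u1 := (ring U h).u1
  let u2 := (ring U h).u2
  let w := winv
  let W := wr
  let h3 := base (hFn U h 3)
  let h4 := base (hFn U h 4)
  let h5 := base (hFn U h 5)
  let h6 := base (hFn U h 6)
  let c0 := base (derivFn c 0)
  let c1 := base (derivFn c 1)
  let c2 := base (derivFn c 2)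
  let c3 := base (derivFn c 3)
  let s0 := base (derivFn s 0)
  t ^ 3 * u1 ^ 6 * rem * remCoeff h c
    + c0 * c1 * h4 ^ 2 * t ^ 2 * u1 ^ 5 * ((9 / 80 : ℝ) • w ^ 4 + (3 / 8 : ℝ) • w ^ 2
      + (-3 / 4 : ℝ) • w + (9 / 16 : ℝ) • 1)
    + (c0 * c1 * h5 + c0 * c2 * h4) * t * u1 ^ 4 * ((-1 / 10 : ℝ) • w ^ 3 + (-3 / 8 : ℝ) • w
      + (7 / 16 : ℝ) • 1 + (-3 / 16 : ℝ) • W)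
    + c0 * c3 * t ^ 3 * h3 ^ 3 * u1 ^ 6 * ((-1 / 48 : ℝ) • w ^ 2 + (1 / 16 : ℝ) • w)
    + lam • (c0 ^ 2 * c1 * h4 * t * u1 ^ 4 * ((-1 / 2 : ℝ) • w ^ 3))
    + c0 ^ 2 * h4 * h5 * t ^ 2 * u1 ^ 5 * ((-3 / 80 : ℝ) • w ^ 4 + (3 / 8 : ℝ) • w ^ 2
      + (-3 / 4 : ℝ) • w + (9 / 16 : ℝ) • 1)
    + c0 ^ 2 * h4 ^ 3 * t ^ 3 * u1 ^ 6 * ((1 / 20 : ℝ) • w ^ 5 + (-1 / 4 : ℝ) • w ^ 3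
      + (1 / 4 : ℝ) • w ^ 2 + (-3 / 4 : ℝ) • w)
    + c0 ^ 2 * h6 * t * u1 ^ 4 * ((-1 / 8 : ℝ) • w + (7 / 48 : ℝ) • 1 + (-1 / 16 : ℝ) • W)
    + lam • (c0 ^ 3 * h4 ^ 2 * t ^ 2 * u1 ^ 5 * ((1 / 4 : ℝ) • w ^ 4))
    + lam • (c0 ^ 3 * h5 * t * u1 ^ 4 * ((-1 / 6 : ℝ) • w ^ 3))
    + c1 ^ 2 * h4 * t * u1 ^ 4 * ((-1 / 10 : ℝ) • w ^ 3)
    + s0 * t * h3 * u1 ^ 4 * ((1 / 2 : ℝ) • w ^ 2 + (1 / 2 : ℝ) • w)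
    + u2 ^ 2 * (((3 / 20 : ℝ) • (c0 * c1) + (lam / 4 : ℝ) • c0 ^ 3) * t * h3
      * (w ^ 4 + w ^ 3 + w ^ 2 + w)
      + c0 ^ 2 * h4 * t * ((-3 / 40 : ℝ) • w ^ 5 + (3 / 8 : ℝ) • w ^ 3))
    + u2 ^ 3 * (c0 ^ 2 * t ^ 3 * h3 ^ 3 * ((-1 / 40 : ℝ) • w ^ 5 + (-3 / 40 : ℝ) • w ^ 4
      + (-1 / 40 : ℝ) • w ^ 3))

/-- The coefficient of `u₂` in the null Lagrangian that relates `κ₃` to the Hamiltonian. -/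
noncomputable def nullCoeff1 (h : ℝ → ℝ) [SmoothHam U h] (c : SmoothFn U) (lam : ℝ) : JetFn U h :=
  let t : JetFn U h := time
  let u1 := (ring U h).u1
  let w := winv
  let h3 := base (hFn U h 3)
  let h4 := base (hFn U h 4)
  let h5 := base (hFn U h 5)
  let c0 := base (derivFn c 0)
  let c1 := base (derivFn c 1)
  let c2 := base (derivFn c 2)
  c0 * c1 * h4 * t * h3 * u1 ^ 3 * ((3 / 10 : ℝ) • w ^ 4 + (3 / 10 : ℝ) • w ^ 3
      + (3 / 10 : ℝ) • w ^ 2 + (4 / 5 : ℝ) • w)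
    + c0 * c2 * t ^ 2 * h3 ^ 3 * u1 ^ 4 * ((-1 / 8 : ℝ) • w ^ 2)
    + c0 ^ 2 * h4 ^ 2 * t * u1 ^ 3 * ((-3 / 20 : ℝ) • w ^ 5 + (1 / 4 : ℝ) • w ^ 3
      + (3 / 4 : ℝ) • w ^ 2)
    + c0 ^ 2 * h5 * t ^ 2 * h3 ^ 2 * u1 ^ 4 * ((1 / 8 : ℝ) • w ^ 2)
    + lam • (c0 ^ 3 * h4 * t * h3 * u1 ^ 3 * ((1 / 2 : ℝ) • (w ^ 4 + w ^ 3 + w ^ 2 + w)))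
    + c1 ^ 2 * t * h3 ^ 2 * u1 ^ 3 * ((1 / 4 : ℝ) • w)

/-- The coefficient of `u₁²` in the null Lagrangian that relates `κ₃` to the Hamiltonian. -/
noncomputable def nullCoeff0 (h : ℝ → ℝ) [SmoothHam U h] (c : SmoothFn U) (lam : ℝ) : JetFn U h :=
  let t : JetFn U h := time
  let u1 := (ring U h).u1
  let w := winv
  let h3 := base (hFn U h 3)
  let h4 := base (hFn U h 4)
  let h5 := base (hFn U h 5)
  let h6 := base (hFn U h 6)
  let c0 := base (derivFn c 0)
  let c1 := base (derivFn c 1)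
  let c2 := base (derivFn c 2)
  let c3 := base (derivFn c 3)
  (-2 : ℝ) • (t ^ 2 * u1 ^ 4 * rem * remCoeff h c)
    + c0 * c1 * h4 ^ 2 * t * u1 ^ 3 * ((9 / 40 : ℝ) • w ^ 4 + (1 / 4 : ℝ) • w ^ 2
      + (3 / 2 : ℝ) • w + (-9 / 8 : ℝ) • 1)
    + c0 * c1 * h5 * t * h3 * u1 ^ 3 * ((1 / 10 : ℝ) • w ^ 3 + (1 / 10 : ℝ) • w ^ 2
      + (-3 / 20 : ℝ) • w + (3 / 8 : ℝ) • 1)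
    + c0 * c2 * h4 * t * h3 * u1 ^ 3 * ((1 / 10 : ℝ) • w ^ 3 + (9 / 40 : ℝ) • w ^ 2
      + (-11 / 40 : ℝ) • w + (3 / 8 : ℝ) • 1)
    + c0 * c3 * t ^ 2 * h3 ^ 3 * u1 ^ 4 * ((-1 / 8 : ℝ) • w)
    + lam • (c0 ^ 2 * c1 * h4 * t * h3 * u1 ^ 3 * ((1 / 2 : ℝ) • (w ^ 3 + w ^ 2 + w)))
    + c0 ^ 2 * h4 * h5 * t * u1 ^ 3 * ((-3 / 40 : ℝ) • w ^ 4 + (1 / 8 : ℝ) • w ^ 2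
      + (3 / 2 : ℝ) • w + (-9 / 8 : ℝ) • 1)
    + c0 ^ 2 * h4 ^ 3 * t ^ 2 * u1 ^ 4 * ((3 / 20 : ℝ) • w ^ 5 + (-1 / 4 : ℝ) • w ^ 3
      + (-1 / 2 : ℝ) • w ^ 2 + (3 / 2 : ℝ) • w)
    + c0 ^ 2 * h6 * t ^ 2 * h3 ^ 2 * u1 ^ 4 * ((1 / 8 : ℝ) • w)
    + lam • (c0 ^ 3 * h4 ^ 2 * t * u1 ^ 3 * ((1 / 2 : ℝ) • w ^ 4))
    + lam • (c0 ^ 3 * h5 * t * h3 * u1 ^ 3 * ((1 / 6 : ℝ) • (w ^ 3 + w ^ 2 + w)))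
    + c1 * c2 * t * h3 ^ 2 * u1 ^ 3 * ((1 / 8 : ℝ) • w)
    + c1 ^ 2 * h4 * t * h3 * u1 ^ 3 * ((1 / 10 : ℝ) • w ^ 3 + (1 / 10 : ℝ) • w ^ 2
      + (7 / 20 : ℝ) • w)

/-! ### Flow identities for the densities of `K₁` and `K₃` -/

variable (c p s : SmoothFn U) (lam : ℝ)

theorem d2_k1Fn : (ring U h).d2 (k1Fn h c) = 0 := by
  simp only [k1Fn, Derivation.map_smul, Derivation.leibniz, d2_base, d2_logW, (ring U h).d2_u1,
    smul_zero, add_zero]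

theorem d2_alphaFn : (ring U h).d2 (alphaFn h c) = 0 := by
  simp only [alphaFn, map_add, map_sub, Derivation.map_smul, Derivation.leibniz, Derivation.map_sq,
    Derivation.map_one_eq_zero, d2_base, d2_winv, d2_time, (ring U h).d2_u1, smul_zero, add_zero,
    mul_zero, sub_zero]

theorem d2_betaFn : (ring U h).d2 (betaFn h c) = 0 := by
  simp only [betaFn, map_add, Derivation.map_smul, Derivation.leibniz, Derivation.map_sq, d2_base,
    d2_winv, d2_time, smul_zero, add_zero, mul_zero]

/-- The Helmholtz condition for `δK₁/δu`: for a first-order density `k` one has `α = ∂₀k - u₁∂₀∂₁k`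
and `β = -∂₁∂₁k`, so that both sides equal `-u₁∂₀∂₁∂₁k`. -/
theorem d1_alphaFn : (ring U h).d1 (alphaFn h c) = (ring U h).u1 * (ring U h).d0 (betaFn h c) := by
  simp only [alphaFn, betaFn, map_add, map_sub, Derivation.map_smul, Derivation.leibniz,
    Derivation.map_sq, Derivation.map_one_eq_zero, d1_base, d1_winv, d1_time, (ring U h).d1_u1,
    d0_base, d0_time, d0_winv, dir_hFn, dir_derivFn, smul_zero, add_zero, mul_zero, sub_zero,
    zero_sub, zero_add, smul_eq_mul]
  ext q
  simp only [SmoothFn.add_apply, SmoothFn.sub_apply, SmoothFn.neg_apply, SmoothFn.mul_apply,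
    SmoothFn.pow_apply, SmoothFn.smul_apply, SmoothFn.one_apply, SmoothFn.ofNat_apply, winv_apply]
  have hW := (wr_pos q).ne'
  have hwr : wr q = 1 + time q * base (hFn U h 3) q * (ring U h).u1 q := rfl
  generalize wr q = W at *
  field_simp
  rw [hwr]
  ring

theorem euler_k1Fn : (ring U h).d0 (k1Fn h c) - (ring U h).u1 * (ring U h).d0 ((ring U h).d1 (k1Fn h c))
    + -(ring U h).d1 ((ring U h).d1 (k1Fn h c)) * (ring U h).u2
      = alphaFn h c + betaFn h c * (ring U h).u2 := by
  simp only [alphaFn, betaFn, k1Fn, map_add, map_sub, Derivation.map_smul, Derivation.leibniz,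
    Derivation.map_sq, Derivation.map_one_eq_zero, d1_base, d1_winv, d1_time, (ring U h).d1_u1,
    (ring U h).d0_u1, d1_logW, d0_logW,
    d0_base, d0_time, d0_winv, dir_hFn, dir_derivFn, smul_zero, add_zero, mul_zero, sub_zero,
    zero_sub, zero_add, smul_eq_mul]
  ext q
  simp only [SmoothFn.add_apply, SmoothFn.sub_apply, SmoothFn.neg_apply, SmoothFn.mul_apply,
    SmoothFn.pow_apply, SmoothFn.smul_apply, SmoothFn.one_apply, SmoothFn.ofNat_apply, winv_apply]
  have hW := (wr_pos q).ne'
  have hwr : wr q = 1 + time q * base (hFn U h 3) q * (ring U h).u1 q := rfl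
  generalize wr q = W at *
  field_simp
  rw [hwr]
  ring

/-- The reason for the logarithm in `K₁`: since `flow u₁ = h'''u₁²` and `flow W = h'''u₁W`, the
operator `flow - h'''u₁` takes `-½ c u₁ log W` to `-½ c h''' u₁²`, the `ε²` part of the Hamiltonian.
The present identity is the counterpart for variational derivatives, checked directly. -/
theorem flow_alphaFn_add : (ring U h).flow (base (hFn U h 3)) (alphaFn h c + betaFn h c * (ring U h).u2)
    = (ring U h).quadEuler (base (cHFn h c)) := by
  simp only [JetRing.flow_apply, JetRing.quadEuler, cHFn, alphaFn, betaFn, map_mul, map_add,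
    map_sub, Derivation.map_smul, Derivation.leibniz,
    Derivation.map_sq, Derivation.map_one_eq_zero, d1_base, d1_winv, d1_time, (ring U h).d1_u1,
    (ring U h).d1_u2, d2_base, d2_winv, d2_time, (ring U h).d2_u1, (ring U h).d2_u2,
    dt_base, dt_winv, dt_time, (ring U h).dt_u1, (ring U h).dt_u2,
    d0_base, d0_time, d0_winv, dir_hFn, dir_derivFn, smul_zero, add_zero, mul_zero, sub_zero,
    zero_sub, zero_add, smul_eq_mul]
  ext q
  simp only [SmoothFn.add_apply, SmoothFn.sub_apply, SmoothFn.neg_apply, SmoothFn.mul_apply,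
    SmoothFn.pow_apply, SmoothFn.smul_apply, SmoothFn.one_apply, SmoothFn.ofNat_apply, winv_apply,
    SmoothFn.zero_apply]
  have hW := (wr_pos q).ne'
  have hwr : wr q = 1 + time q * base (hFn U h 3) q * (ring U h).u1 q := rfl
  generalize wr q = W at *
  -- The only denominators are powers of `W`; they are cleared while `W` is a symbol, and `W` is
  -- expanded afterwards.
  field_simp
  rw [hwr]
  ring

theorem Derivation.map_pow_four {R : Type*} [CommRing R] [Algebra ℝ R] (D : Derivation ℝ R R)
    (a : R) : D (a ^ 4) = 4 * a ^ 3 * D a := by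
  rw [show a ^ 4 = a ^ 2 * a ^ 2 by ring, D.leibniz, D.map_sq, smul_eq_mul]; ring

theorem Derivation.map_pow_five {R : Type*} [CommRing R] [Algebra ℝ R] (D : Derivation ℝ R R)
    (a : R) : D (a ^ 5) = 5 * a ^ 4 * D a := by
  rw [show a ^ 5 = a ^ 3 * a ^ 2 by ring, D.leibniz, D.map_sq, D.map_cube, smul_eq_mul]
  simp only [smul_eq_mul]; ring

theorem Derivation.map_pow_six {R : Type*} [CommRing R] [Algebra ℝ R] (D : Derivation ℝ R R)
    (a : R) : D (a ^ 6) = 6 * a ^ 5 * D a := by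
  rw [show a ^ 6 = a ^ 3 * a ^ 3 by ring, D.leibniz, D.map_cube, smul_eq_mul]; ring

theorem dt_remCoeff : (ring U h).dt (remCoeff h c) = 0 := by
  simp only [remCoeff, ← map_mul, ← map_pow, ← map_smul, ← map_add, dt_base]

theorem d1_remCoeff : (ring U h).d1 (remCoeff h c) = 0 := by
  simp only [remCoeff, ← map_mul, ← map_pow, ← map_smul, ← map_add, d1_base]

theorem d2_remCoeff : (ring U h).d2 (remCoeff h c) = 0 := by
  simp only [remCoeff, ← map_mul, ← map_pow, ← map_smul, ← map_add, d2_base]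

set_option maxHeartbeats 2000000 in
-- Closedness. If `u₁² N₀ + N₁ u₂` is the total derivative of `G(u, u₁)`, then `∂₁G = N₁` and `∂₀G =
-- u₁N₀`, and equality of mixed derivatives reads `∂₀N₁ = ∂₁(u₁N₀)`. Writing the first coefficient
-- as `u₁² N₀` avoids a division by `u₁`.
theorem d0_nullCoeff1 : (ring U h).d0 (nullCoeff1 h c lam)
    = nullCoeff0 h c lam + (ring U h).u1 * (ring U h).d1 (nullCoeff0 h c lam) := by
  have hrel := rem'_relation (U := U) (h := h)
  simp only [nullCoeff0, nullCoeff1, map_mul, map_add,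
    map_sub, Derivation.map_smul, Derivation.leibniz,
    Derivation.map_sq, Derivation.map_cube, Derivation.map_pow_four, Derivation.map_pow_five,
    Derivation.map_pow_six,
    Derivation.map_one_eq_zero, d1_base, d1_winv, d1_time, d1_rem, d1_remCoeff, (ring U h).d1_u1,
    (ring U h).d0_u1,
    d0_base, d0_time, d0_winv, dir_hFn, dir_derivFn, smul_zero, add_zero, mul_zero, sub_zero,
    zero_sub, zero_add, smul_eq_mul, Nat.reduceAdd]
  ext q
  have hq := congrArg (fun F : JetFn U h => F q) hrel
  have hW := (wr_pos q).ne'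
  have hwr : wr q = 1 + time q * base (hFn U h 3) q * (ring U h).u1 q := rfl
  simp only [SmoothFn.add_apply, SmoothFn.sub_apply, SmoothFn.neg_apply, SmoothFn.mul_apply,
    SmoothFn.pow_apply, SmoothFn.smul_apply, SmoothFn.one_apply, SmoothFn.ofNat_apply, winv_apply,
    SmoothFn.zero_apply, remCoeff] at hq ⊢
  generalize wr q = W at *
  generalize time q = t at *
  generalize rem q = r at *
  generalize rem' q = r' at *
  generalize (ring U h).u1 q = u1 at *
  generalize base (hFn U h 3) q = h3 at *
  generalize base (hFn U h 4) q = h4 at *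
  generalize base (hFn U h 5) q = h5 at *
  generalize base (hFn U h 6) q = h6 at *
  generalize base (derivFn c 0) q = c0 at *
  generalize base (derivFn c 1) q = c1 at *
  generalize base (derivFn c 2) q = c2 at *
  generalize base (derivFn c 3) q = c3 at *
  have hr : t * h3 * u1 * r' = W⁻¹ - 5 * r := by rw [← hq, hwr]; ring
  -- The factor in parentheses is the value of `remCoeff`. The `u₁`-derivative of the remainder term
  -- of `nullCoeff0` brings in `-2t²u₁⁴ (t h'''u₁ r')` times it. After substitution the terms in `r`
  -- cancel, since `u₁⁵` has derivative `5u₁⁴`.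
  linear_combination (norm := skip) 2 * t ^ 2 * u1 ^ 4 * (-9 / 4 * (c0 * c1 * h4 ^ 2 * h3)
    + 3 / 4 * (c0 * c1 * h5 * h3 ^ 2) + 3 / 4 * (c0 * c2 * h4 * h3 ^ 2) - 1 / 4 * (c0 * c3 * h3 ^ 3)
    - 9 / 4 * (c0 ^ 2 * h4 * h5 * h3) + 3 * (c0 ^ 2 * h4 ^ 3) + 1 / 4 * (c0 ^ 2 * h6 * h3 ^ 2)) * hr
  field_simp
  rw [hwr]
  ring

set_option maxHeartbeats 4000000 in
/-- The equation for `κ₃`. -/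
theorem flow_kappa3Fn (hp : p = (3 / 5 : ℝ) • (derivFn c 0 * derivFn c 1)
      + lam • derivFn c 0 ^ 3) :
    (ring U h).flow (base (hFn U h 3)) (kappa3Fn h c s lam)
        - base (hFn U h 3) * (ring U h).u1 * kappa3Fn h c s lam
      = (base (pHFn h c p) * (ring U h).u2 ^ 2 + base (sHFn h c p s) * (ring U h).u1 ^ 4)
        + (1 / 2 : ℝ) • (ring U h).reducedBracket (alphaFn h c) (betaFn h c) (base (cHFn h c))
        + ((ring U h).u1 ^ 2 * nullCoeff0 h c lam + nullCoeff1 h c lam * (ring U h).u2) := by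
  have hrel := rem'_relation (U := U) (h := h)
  -- Since `derivFn p 0` is `p` by definition, `hp` applies as it stands. The relation between `p`,
  -- `c` and `λ` serves only to establish this flow identity.
  have hp0 : derivFn p 0 = (3 / 5 : ℝ) • (derivFn c 0 * derivFn c 1) + lam • derivFn c 0 ^ 3 := hp
  have hp1 : derivFn p 1 = (3 / 5 : ℝ) • (derivFn c 0 * derivFn c 2 + derivFn c 1 ^ 2)
      + lam • (3 * derivFn c 0 ^ 2 * derivFn c 1) := by
    rw [← dir_derivFn, hp0]
    simp only [map_add, Derivation.map_smul, Derivation.leibniz, Derivation.map_cube, dir_derivFn,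
      smul_eq_mul]
    ring
  simp only [kappa3Fn, nullCoeff0, nullCoeff1, JetRing.flow_apply, JetRing.reducedBracket, cHFn,
    pHFn, sHFn, hp0, hp1, alphaFn, betaFn, map_mul, map_add, map_pow, map_smul, map_ofNat,
    map_sub, Derivation.map_smul, Derivation.leibniz, d1_wr, d2_wr, dt_wr, d0_wr,
    Derivation.map_sq, Derivation.map_cube, Derivation.map_pow_four, Derivation.map_pow_five,
    Derivation.map_pow_six,
    Derivation.map_one_eq_zero, d1_base, d1_winv, d1_time, d1_rem, d1_remCoeff, (ring U h).d1_u1,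
    (ring U h).d1_u2, d2_base, d2_winv, d2_time, (ring U h).d2_u1, (ring U h).d2_u2, d2_rem,
    d2_remCoeff,
    dt_base, dt_winv, dt_time, (ring U h).dt_u1, (ring U h).dt_u2, dt_rem, dt_remCoeff,
    (ring U h).d0_u1, (ring U h).d0_u2,
    d0_base, d0_time, d0_winv, dir_hFn, dir_derivFn, smul_zero, add_zero, mul_zero, sub_zero,
    zero_sub, zero_add, smul_eq_mul, Nat.reduceAdd]
  ext q
  have hq := congrArg (fun F : JetFn U h => F q) hrel
  have hW := (wr_pos q).ne'
  have hwr : wr q = 1 + time q * base (hFn U h 3) q * (ring U h).u1 q := rfl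
  simp only [SmoothFn.add_apply, SmoothFn.sub_apply, SmoothFn.neg_apply, SmoothFn.mul_apply,
    SmoothFn.pow_apply, SmoothFn.smul_apply, SmoothFn.one_apply, SmoothFn.ofNat_apply, winv_apply,
    SmoothFn.zero_apply, remCoeff] at hq ⊢
  generalize wr q = W at *
  generalize time q = t at *
  generalize rem q = r at *
  generalize rem' q = r' at *
  generalize (ring U h).u1 q = u1 at *
  generalize (ring U h).u2 q = u2 at *
  generalize base (hFn U h 3) q = h3 at *
  generalize base (hFn U h 4) q = h4 at *
  generalize base (hFn U h 5) q = h5 at *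
  generalize base (hFn U h 6) q = h6 at *
  generalize base (derivFn c 0) q = c0 at *
  generalize base (derivFn c 1) q = c1 at *
  generalize base (derivFn c 2) q = c2 at *
  generalize base (derivFn c 3) q = c3 at *
  generalize base (derivFn s 0) q = s0 at *
  have hr : t * h3 * u1 * r' = W⁻¹ - 5 * r := by rw [← hq, hwr]; ring
  -- The remainder term of `κ₃` is `t³u₁⁶ r` times `remCoeff`, and `flow r = r' h'''u₁W`, whence
  -- this factor. The terms in `r` then add up to `-2t²u₁⁶ r` times `remCoeff`, which is the
  -- remainder term of `u₁²` times `nullCoeff0`.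
  linear_combination (norm := skip) t ^ 2 * u1 ^ 6 * W * (-9 / 4 * (c0 * c1 * h4 ^ 2 * h3)
    + 3 / 4 * (c0 * c1 * h5 * h3 ^ 2) + 3 / 4 * (c0 * c2 * h4 * h3 ^ 2) - 1 / 4 * (c0 * c3 * h3 ^ 3)
    - 9 / 4 * (c0 ^ 2 * h4 * h5 * h3) + 3 * (c0 ^ 2 * h4 ^ 3) + 1 / 4 * (c0 ^ 2 * h6 * h3 ^ 2)) * hr
  field_simp
  rw [hwr]
  ring

end Generator

/-! ### Agreement of the smooth density with the explicit formula, and its vanishing -/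

open SmoothFn JetFn

section Formula

variable {U : Set ℝ} {h : ℝ → ℝ} [hU : Fact (IsOpen U)] [hh : SmoothHam U h]

theorem derivFn_of_apply {c : ℝ → ℝ} (hc : ContDiffOn ℝ ∞ c U) (n : ℕ) (u : U) :
    derivFn (of c hc) n u = iteratedDeriv n c u :=
  iterate_dir_apply hU.out _ (fun _ => rfl) n u

theorem k1Fn_apply {c : ℝ → ℝ} (hc : ContDiffOn ℝ ∞ c U) (q : jetDomain U h) :
    k1Fn h (of c hc) q = k1Density h c q.1.1 q.1.2.1 q.1.2.2.1 := by
  simp only [k1Fn, SmoothFn.smul_apply, SmoothFn.mul_apply, logW_apply, base_apply,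
    derivFn_of_apply, k1Density, wr, SmoothFn.add_apply, SmoothFn.one_apply, hFn_apply, time_apply,
    u1_apply, iteratedDeriv_zero]
  ring

theorem contDiffAt_of_isOpen (hU : IsOpen U) {f : ℝ → ℝ} (hf : ContDiffOn ℝ ∞ f U) {u : ℝ} (hu : u ∈ U) :
    ContDiffAt ℝ ∞ f u := hf.contDiffAt (hU.mem_nhds hu)

theorem hasDerivAt_iteratedDeriv (hU : IsOpen U) {f : ℝ → ℝ} (hf : ContDiffOn ℝ ∞ f U) (n : ℕ)
    {u : ℝ} (hu : u ∈ U) : HasDerivAt (iteratedDeriv n f) (iteratedDeriv (n + 1) f u) u := by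
  rw [iteratedDeriv_succ]
  exact ((contDiffAt_of_isOpen hU (contDiffOn_iteratedDeriv hU hf n) hu).differentiableAt
    (by simp)).hasDerivAt

/-- The third derivative of a quotient `c / g²`. -/
theorem iteratedDeriv_three_div_sq (hU : IsOpen U) {c g : ℝ → ℝ} (hc : ContDiffOn ℝ ∞ c U)
    (hg : ContDiffOn ℝ ∞ g U) {u : ℝ} (hu : u ∈ U) (h0 : g u ≠ 0) :
    iteratedDeriv 3 (fun r => c r / g r ^ 2) u
      = iteratedDeriv 3 c u / g u ^ 2 - 6 * iteratedDeriv 2 c u * iteratedDeriv 1 g u / g u ^ 3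
        + iteratedDeriv 1 c u * (18 * iteratedDeriv 1 g u ^ 2 / g u ^ 4
          - 6 * iteratedDeriv 2 g u / g u ^ 3)
        + c u * (-24 * iteratedDeriv 1 g u ^ 3 / g u ^ 5
          + 18 * iteratedDeriv 1 g u * iteratedDeriv 2 g u / g u ^ 4
          - 2 * iteratedDeriv 3 g u / g u ^ 3) := by
  -- A formula for one derivative can be differentiated again only if it holds on an open set, here
  -- the part of `U` where `g` does not vanish.
  have hV : IsOpen (U ∩ g ⁻¹' {0}ᶜ) := hg.continuousOn.isOpen_inter_preimage hU isOpen_compl_singleton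
  set V := U ∩ g ⁻¹' {0}ᶜ
  have huV : u ∈ V := ⟨hu, h0⟩
  have dc := fun n {r : ℝ} (hr : r ∈ V) => hasDerivAt_iteratedDeriv hU hc n hr.1
  have dg := fun n {r : ℝ} (hr : r ∈ V) => hasDerivAt_iteratedDeriv hU hg n hr.1
  have key : ∀ (f F : ℝ → ℝ), (∀ r ∈ V, f r = F r) → ∀ r ∈ V, deriv f r = deriv F r :=
    fun f F hf r hr => Filter.EventuallyEq.deriv_eq (by filter_upwards [hV.mem_nhds hr] using hf)
  have e1 : ∀ r ∈ V, deriv (fun r => c r / g r ^ 2) r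
      = iteratedDeriv 1 c r / g r ^ 2 - 2 * c r * iteratedDeriv 1 g r / g r ^ 3 := by
    intro r hr
    have hgr : g r ≠ 0 := hr.2
    have h1 := (dc 0 hr)
    have h2 := (dg 0 hr)
    simp only [iteratedDeriv_zero] at h1 h2
    rw [(h1.fun_div (h2.fun_pow 2) (pow_ne_zero 2 hgr)).deriv]
    field_simp
    simp
    ring
  have e2 : ∀ r ∈ V, deriv (deriv (fun r => c r / g r ^ 2)) r
      = iteratedDeriv 2 c r / g r ^ 2 - 4 * iteratedDeriv 1 c r * iteratedDeriv 1 g r / g r ^ 3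
        + c r * (6 * iteratedDeriv 1 g r ^ 2 / g r ^ 4 - 2 * iteratedDeriv 2 g r / g r ^ 3) := by
    intro r hr
    have hgr : g r ≠ 0 := hr.2
    have h1 := (dc 0 hr)
    have h2 := (dg 0 hr)
    simp only [iteratedDeriv_zero] at h1 h2
    rw [key _ _ e1 r hr, (((dc 1 hr).fun_div (h2.fun_pow 2) (pow_ne_zero 2 hgr)).fun_sub
      (((h1.const_mul 2).fun_mul (dg 1 hr)).fun_div (h2.fun_pow 3) (pow_ne_zero 3 hgr))).deriv]
    field_simp
    simp
    ring
  rw [iteratedDeriv_succ, iteratedDeriv_succ, iteratedDeriv_one]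
  have hgr : g u ≠ 0 := h0
  have h1 := (dc 0 huV)
  have h2 := (dg 0 huV)
  simp only [iteratedDeriv_zero] at h1 h2
  rw [key _ _ e2 u huV, ((((dc 2 huV).fun_div (h2.fun_pow 2) (pow_ne_zero 2 hgr)).fun_sub
      ((((dc 1 huV).const_mul 4).fun_mul (dg 1 huV)).fun_div (h2.fun_pow 3) (pow_ne_zero 3 hgr))).fun_add
      (h1.fun_mul (((((dg 1 huV).fun_pow 2).const_mul 6).fun_div (h2.fun_pow 4) (pow_ne_zero 4 hgr)).fun_sub
        (((dg 2 huV).const_mul 2).fun_div (h2.fun_pow 3) (pow_ne_zero 3 hgr))))).deriv]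
  field_simp
  simp
  ring

set_option maxHeartbeats 2000000 in
-- In the logarithmic term the remainder carries `(t h'''u₁)⁵`, which absorbs `t²` and the
-- denominator `h'''⁵` and leaves `t³u₁⁶ r` times `remCoeff`. The Taylor polynomial of the logarithm
-- combines with the rational terms and cancels their poles.
theorem kappa3Fn_eq_k3Formula {c s : ℝ → ℝ} (hc : ContDiffOn ℝ ∞ c U) (hs : ContDiffOn ℝ ∞ s U)
    (lam : ℝ) (q : jetDomain U h) (ht : q.1.1 ≠ 0) (h3 : iteratedDeriv 3 h q.1.2.1 ≠ 0) :
    kappa3Fn h (of c hc) (of s hs) lam q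
      = k3Formula h c s lam q.1.1 q.1.2.1 q.1.2.2.1 q.1.2.2.2 := by
  have hu : q.1.2.1 ∈ U := q.2.1
  have hH := SmoothHam.smooth (U := U) (h := h)
  have e4 : deriv (fun r => c r * iteratedDeriv 4 h r) q.1.2.1
      = deriv c q.1.2.1 * iteratedDeriv 4 h q.1.2.1 + c q.1.2.1 * iteratedDeriv 5 h q.1.2.1 := by
    have := (hasDerivAt_iteratedDeriv hU.out hc 0 hu).fun_mul (hasDerivAt_iteratedDeriv hU.out hH 4 hu)
    simpa using this.deriv
  have e14 : deriv (fun r => deriv c r * iteratedDeriv 4 h r) q.1.2.1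
      = iteratedDeriv 2 c q.1.2.1 * iteratedDeriv 4 h q.1.2.1
        + deriv c q.1.2.1 * iteratedDeriv 5 h q.1.2.1 := by
    have := (hasDerivAt_iteratedDeriv hU.out hc 1 hu).fun_mul (hasDerivAt_iteratedDeriv hU.out hH 4 hu)
    simpa using this.deriv
  have e3 := iteratedDeriv_three_div_sq hU.out hc (contDiffOn_iteratedDeriv hU.out hH 3) hu h3
  have i1 : iteratedDeriv 1 (iteratedDeriv 3 h) = iteratedDeriv 4 h := by
    rw [iteratedDeriv_one, ← iteratedDeriv_succ]
  have i2 : iteratedDeriv 2 (iteratedDeriv 3 h) = iteratedDeriv 5 h := by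
    rw [iteratedDeriv_succ, i1, ← iteratedDeriv_succ]
  have i3 : iteratedDeriv 3 (iteratedDeriv 3 h) = iteratedDeriv 6 h := by
    rw [iteratedDeriv_succ, i2, ← iteratedDeriv_succ]
  rw [i1, i2, i3, iteratedDeriv_one] at e3
  have hlog := log_eq_logRemainder (wr_pos q)
  have hW := (wr_pos q).ne'
  have hwr : wr q = 1 + q.1.1 * iteratedDeriv 3 h q.1.2.1 * q.1.2.2.1 := by
    rw [← hFn_apply 3 ⟨_, hu⟩]; rfl
  simp only [k3Formula]
  rw [e4, e14, e3, ← hwr, hlog]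
  simp only [kappa3Fn, remCoeff, SmoothFn.add_apply, SmoothFn.sub_apply, SmoothFn.neg_apply, SmoothFn.mul_apply,
    SmoothFn.pow_apply, SmoothFn.smul_apply, SmoothFn.one_apply, SmoothFn.ofNat_apply, winv_apply,
    rem_apply, base_apply, hFn_apply, derivFn_of_apply, time_apply, u1_apply, u2_apply,
    iteratedDeriv_zero, iteratedDeriv_one]
  generalize logRemainder (wr q) = r at *
  generalize wr q = W at *
  -- Eliminating `u₁` in favour of `W` turns the claim into a rational identity in independent
  -- symbols, with denominators `t`, `h'''` and `W`.
  have hu1 : q.1.2.2.1 = (W - 1) / (q.1.1 * iteratedDeriv 3 h q.1.2.1) := by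
    rw [hwr]; field_simp; ring
  generalize q.1.1 = t at *
  generalize q.1.2.2.1 = u1 at *
  generalize q.1.2.2.2 = u2 at *
  generalize iteratedDeriv 3 h q.1.2.1 = h3 at *
  generalize iteratedDeriv 4 h q.1.2.1 = h4 at *
  generalize iteratedDeriv 5 h q.1.2.1 = h5 at *
  generalize iteratedDeriv 6 h q.1.2.1 = h6 at *
  generalize c q.1.2.1 = c0 at *
  generalize deriv c q.1.2.1 = c1 at *
  generalize iteratedDeriv 2 c q.1.2.1 = c2 at *
  generalize iteratedDeriv 3 c q.1.2.1 = c3 at *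
  generalize s q.1.2.1 = s0 at *
  clear hwr hlog e3 e4 e14
  subst hu1
  field_simp
  ring

/-- Every term contains a factor `t` and also a derivative of `h` of order 3 to 6. Vanishing of
`h'''` near the point, rather than at it, is what kills the derivatives of orders 4 to 6. -/
theorem kappa3Fn_eq_zero {c s : SmoothFn U} (lam : ℝ) (q : jetDomain U h)
    (hq : q.1.1 = 0 ∨ ∀ᶠ r in 𝓝 q.1.2.1, iteratedDeriv 3 h r = 0) :
    kappa3Fn h c s lam q = 0 := by
  rcases hq with ht | hz
  · simp only [kappa3Fn, SmoothFn.add_apply, SmoothFn.mul_apply,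
      SmoothFn.pow_apply, SmoothFn.smul_apply, time_apply, ht]
    ring
  · have h4 : ∀ᶠ r in 𝓝 q.1.2.1, iteratedDeriv 4 h r = 0 := by
      filter_upwards [hz.eventually_nhds] with r hr
      rw [iteratedDeriv_succ, Filter.EventuallyEq.deriv_eq hr, deriv_const]
    have h5 : ∀ᶠ r in 𝓝 q.1.2.1, iteratedDeriv 5 h r = 0 := by
      filter_upwards [h4.eventually_nhds] with r hr
      rw [iteratedDeriv_succ, Filter.EventuallyEq.deriv_eq hr, deriv_const]
    have h6 : ∀ᶠ r in 𝓝 q.1.2.1, iteratedDeriv 6 h r = 0 := by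
      filter_upwards [h5.eventually_nhds] with r hr
      rw [iteratedDeriv_succ, Filter.EventuallyEq.deriv_eq hr, deriv_const]
    simp only [kappa3Fn, remCoeff, SmoothFn.add_apply, SmoothFn.mul_apply,
      SmoothFn.pow_apply, SmoothFn.smul_apply, base_apply, hFn_apply, hz.self_of_nhds,
      h4.self_of_nhds, h5.self_of_nhds, h6.self_of_nhds]
    ring

end Formula

open SmoothFn JetFn

/-! ### Functions on the strip and characteristics -/

theorem SmoothFn.hasDerivWithinAt_comp {E : Type*} [NormedAddCommGroup E] [NormedSpace ℝ E]
    {S : Set E} [SmoothDomain S] (f : SmoothFn S) {γ : ℝ → E} {γ' : E} {I : Set ℝ} {r : ℝ}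
    (hγ : HasDerivWithinAt γ γ' I r) (hm : MapsTo γ I S) (hr : γ r ∈ S) :
    HasDerivWithinAt (fun y => f.extend (γ y)) (dir γ' f ⟨γ r, hr⟩) I r :=
  (f.differentiableWithinAt_extend hr).hasFDerivWithinAt.comp_hasDerivWithinAt r hγ hm

theorem SmoothFn.dir_add_smul {E : Type*} [NormedAddCommGroup E] [NormedSpace ℝ E]
    {S : Set E} [SmoothDomain S] (f : SmoothFn S) (a b : ℝ) (e e' : E) (x : S) :
    dir (a • e + b • e') f x = a * dir e f x + b * dir e' f x := by
  simp only [dir_apply, map_add, map_smul, smul_eq_mul]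

/-- The strip `ℝ × [0, T)`. -/
abbrev strip (T : ℝ) : Set (ℝ × ℝ) := univ ×ˢ Ico 0 T

instance smoothDomain_strip (T : ℝ) : SmoothDomain (strip T) where
  uniqueDiffOn := uniqueDiffOn_univ.prod (uniqueDiffOn_Ico 0 T)
  subset := by
    rintro ⟨x, t⟩ ⟨-, ht⟩
    have hT : (0 : ℝ) ≠ T := (ht.1.trans_lt ht.2).ne
    rw [interior_prod_eq, interior_univ, interior_Ico, closure_prod_eq, closure_univ,
      closure_Ioo hT]
    exact ⟨mem_univ _, Ico_subset_Icc_self ht⟩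

/-- The derivative in `x`. -/
noncomputable abbrev dx (T : ℝ) : Derivation ℝ (SmoothFn (strip T)) (SmoothFn (strip T)) :=
  dir (1, 0)

/-- The derivative in `t`. -/
noncomputable abbrev dtime (T : ℝ) : Derivation ℝ (SmoothFn (strip T)) (SmoothFn (strip T)) :=
  dir (0, 1)

section Strip

variable {T : ℝ}

theorem mem_strip {x t : ℝ} (ht : t ∈ Ico 0 T) : (x, t) ∈ strip T := ⟨mem_univ _, ht⟩

theorem hasDerivAt_extend_fst (f : SmoothFn (strip T)) (x : ℝ) {t : ℝ} (ht : t ∈ Ico 0 T) :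
    HasDerivAt (fun y => f.extend (y, t)) (dx T f ⟨(x, t), mem_strip ht⟩) x := by
  rw [← hasDerivWithinAt_univ]
  exact f.hasDerivWithinAt_comp (γ := fun y => (y, t))
    ((hasDerivWithinAt_id x univ).prodMk (hasDerivWithinAt_const x univ t))
    (fun y _ => mem_strip ht) (mem_strip ht)

theorem hasDerivWithinAt_extend_snd (f : SmoothFn (strip T)) (x : ℝ) {t : ℝ} (ht : t ∈ Ico 0 T) :
    HasDerivWithinAt (fun τ => f.extend (x, τ)) (dtime T f ⟨(x, t), mem_strip ht⟩) (Ico 0 T) t :=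
  f.hasDerivWithinAt_comp (γ := fun τ => (x, τ))
    ((hasDerivWithinAt_const t _ x).prodMk (hasDerivWithinAt_id t _))
    (fun _ hτ => mem_strip hτ) (mem_strip ht)

theorem deriv_eq_dx (f : SmoothFn (strip T)) {t : ℝ} (ht : t ∈ Ico 0 T) {g : ℝ → ℝ}
    (hg : ∀ y, g y = f ⟨(y, t), mem_strip ht⟩) (x : ℝ) :
    deriv g x = dx T f ⟨(x, t), mem_strip ht⟩ := by
  rw [← (hasDerivAt_extend_fst f x ht).deriv]
  congr 1
  ext y
  rw [hg, extend_apply]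

theorem iteratedDeriv_eq_dx (f : SmoothFn (strip T)) {t : ℝ} (ht : t ∈ Ico 0 T) {g : ℝ → ℝ}
    (hg : ∀ y, g y = f ⟨(y, t), mem_strip ht⟩) (n : ℕ) (x : ℝ) :
    iteratedDeriv n g x = ((dx T)^[n] f) ⟨(x, t), mem_strip ht⟩ := by
  induction n generalizing x with
  | zero => simpa using hg x
  | succ n ih =>
    rw [Function.iterate_succ_apply', iteratedDeriv_succ]
    exact deriv_eq_dx _ ht ih x

theorem dtime_eq_of_hasDerivWithinAt (f : SmoothFn (strip T)) {x t : ℝ} (ht : t ∈ Ico 0 T)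
    {g : ℝ → ℝ} (hg : ∀ τ (hτ : τ ∈ Ico 0 T), g τ = f ⟨(x, τ), mem_strip hτ⟩) {g' : ℝ}
    (h : HasDerivWithinAt g g' (Ico 0 T) t) : dtime T f ⟨(x, t), mem_strip ht⟩ = g' := by
  have h1 := (hasDerivWithinAt_extend_snd f x ht).congr
    (fun τ hτ => (hg τ hτ).trans (extend_apply f (mem_strip hτ)).symm)
    ((hg t ht).trans (extend_apply f (mem_strip ht)).symm)
  exact (uniqueDiffOn_Ico 0 T t ht).eq_deriv _ h1 h

/-- A solution of a linear differential equation is a multiple of an exponential. -/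
theorem exists_exp_of_linear {g b : ℝ → ℝ} {t₁ : ℝ} (h0 : 0 ≤ t₁) (hb : ContinuousOn b (Icc 0 t₁))
    (hg : ∀ τ ∈ Icc 0 t₁, HasDerivWithinAt g (b τ * g τ) (Icc 0 t₁) τ) :
    ∃ r : ℝ → ℝ, ∀ τ ∈ Icc 0 t₁, g τ = g 0 * Real.exp (r τ) := by
  -- Extending `b` by constants outside `[0, t₁]` gives a continuous function on the line, whose
  -- primitive is differentiable at the endpoints too.
  set B : ℝ → ℝ := IccExtend h0 ((Icc 0 t₁).domRestrict b) with hB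
  have hBc : Continuous B := (continuousOn_iff_continuous_domRestrict.1 hb).Icc_extend'
  have hBb : ∀ τ ∈ Icc 0 t₁, B τ = b τ := fun τ hτ => by
    rw [hB, IccExtend_of_mem h0 _ hτ]; rfl
  set I : ℝ → ℝ := fun τ => ∫ s in (0 : ℝ)..τ, B s with hI
  have hId : ∀ τ, HasDerivAt I (B τ) τ := fun τ =>
    intervalIntegral.integral_hasDerivAt_right (hBc.intervalIntegrable _ _)
      (hBc.stronglyMeasurableAtFilter _ _) hBc.continuousAt
  have hφ : ∀ τ ∈ Icc 0 t₁, HasDerivWithinAt (fun τ => g τ * Real.exp (-I τ)) 0 (Icc 0 t₁) τ := by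
    intro τ hτ
    have := (hg τ hτ).fun_mul ((hId τ).fun_neg.exp.hasDerivWithinAt (s := Icc 0 t₁))
    refine this.congr_deriv ?_
    rw [hBb τ hτ]
    ring
  have hc := constant_of_has_deriv_right_zero (fun τ hτ => (hφ τ hτ).continuousWithinAt)
    (fun τ hτ => (hφ τ (Ico_subset_Icc_self hτ)).mono_of_mem_nhdsWithin
      (Icc_mem_nhdsGE_of_mem hτ))
  refine ⟨I, fun τ hτ => ?_⟩
  have h1 := hc τ hτ
  have h2 : I 0 = 0 := by simp [hI]
  rw [h2, neg_zero, Real.exp_zero, mul_one] at h1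
  rw [← h1, mul_assoc, ← Real.exp_add, neg_add_cancel, Real.exp_zero, mul_one]

/-- Along the characteristics of `A_t = A A_x`, solutions of `F_t = (A F)_x` are multiples of their
initial values. -/
theorem exists_exp_of_transport {A F : SmoothFn (strip T)} (hA : dtime T A = A * dx T A)
    (hF : dtime T F = A * dx T F + dx T A * F) {x₁ t₁ : ℝ} (ht₁ : t₁ ∈ Ico 0 T) :
    ∃ y r : ℝ, F ⟨(x₁, t₁), mem_strip ht₁⟩
      = F ⟨(y, 0), mem_strip ⟨le_rfl, ht₁.1.trans_lt ht₁.2⟩⟩ * Real.exp r := by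
  set a := A ⟨(x₁, t₁), mem_strip ht₁⟩ with ha
  have h00 : (0 : ℝ) ∈ Ico 0 T := ⟨le_rfl, ht₁.1.trans_lt ht₁.2⟩
  -- The straight line through `(x₁, t₁)` with the slope prescribed by the value of `A` at that
  -- point; `hconst` shows that it is a characteristic.
  set γ : ℝ → ℝ × ℝ := fun τ => (x₁ + a * (t₁ - τ), τ) with hγ
  have hsub : Icc 0 t₁ ⊆ Ico 0 T := fun τ hτ => ⟨hτ.1, hτ.2.trans_lt ht₁.2⟩
  have hm : MapsTo γ (Icc 0 t₁) (strip T) := fun τ hτ => mem_strip (hsub hτ)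
  have hγd : ∀ τ, HasDerivWithinAt γ ((-a) • ((1, 0) : ℝ × ℝ) + (1 : ℝ) • ((0, 1) : ℝ × ℝ))
      (Icc 0 t₁) τ := by
    intro τ
    have h1 : HasDerivAt (fun τ => x₁ + a * (t₁ - τ)) (a * -1) τ :=
      (((hasDerivAt_id τ).const_sub t₁).const_mul a).const_add x₁
    refine ((h1.prodMk (hasDerivAt_id τ)).hasDerivWithinAt).congr_deriv ?_
    ext <;> simp
  have hd : ∀ (f : SmoothFn (strip T)) (τ) (hτ : τ ∈ Icc 0 t₁),
      HasDerivWithinAt (fun τ => f.extend (γ τ))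
        (-a * dx T f ⟨γ τ, hm hτ⟩ + 1 * dtime T f ⟨γ τ, hm hτ⟩) (Icc 0 t₁) τ := by
    intro f τ hτ
    rw [← dir_add_smul]
    exact f.hasDerivWithinAt_comp (hγd τ) hm (hm hτ)
  have hb : ContinuousOn (fun τ => (dx T A).extend (γ τ)) (Icc 0 t₁) := fun τ hτ =>
    (hd (dx T A) τ hτ).continuousWithinAt
  have h1mem : t₁ ∈ Icc 0 t₁ := ⟨ht₁.1, le_rfl⟩
  have hγ1 : γ t₁ = (x₁, t₁) := by simp [hγ]
  -- Along the line `g = A - a` solves `g' = A_x g`, since `A_t - a A_x = (A - a) A_x`. It vanishes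
  -- at the final time `t₁`, so its initial value is zero, and then so is `g`.
  have hconst : ∀ τ ∈ Icc 0 t₁, A.extend (γ τ) - a = 0 := by
    obtain ⟨r, hr⟩ := exists_exp_of_linear (g := fun τ => A.extend (γ τ) - a) ht₁.1 hb (by
      intro τ hτ
      refine ((hd A τ hτ).sub_const a).congr_deriv ?_
      rw [hA, SmoothFn.mul_apply, extend_apply _ (hm hτ), extend_apply _ (hm hτ)]
      ring)
    have h1 := hr t₁ h1mem
    have h2 : A.extend (γ t₁) - a = 0 := by
      rw [hγ1, extend_apply _ (mem_strip ht₁), ← ha, sub_self]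
    rw [h2] at h1
    have h3 := (mul_eq_zero.1 h1.symm).resolve_right (Real.exp_pos _).ne'
    intro τ hτ
    rw [hr τ hτ, h3, zero_mul]
  obtain ⟨r, hr⟩ := exists_exp_of_linear (g := fun τ => F.extend (γ τ)) ht₁.1 hb (by
      intro τ hτ
      refine (hd F τ hτ).congr_deriv ?_
      have hc := hconst τ hτ
      rw [extend_apply _ (hm hτ)] at hc
      rw [hF, SmoothFn.add_apply, SmoothFn.mul_apply, SmoothFn.mul_apply, extend_apply _ (hm hτ),
        extend_apply _ (hm hτ)]
      linear_combination (dx T F ⟨γ τ, hm hτ⟩) * hc)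
  refine ⟨x₁ + a * (t₁ - 0), r t₁, ?_⟩
  have := hr t₁ h1mem
  simp only [hγ1] at this
  rw [extend_apply _ (mem_strip ht₁), extend_apply _ (mem_strip h00)] at this
  exact this

/-- The time coordinate on the strip. -/
noncomputable def stripTime (T : ℝ) : SmoothFn (strip T) := of (fun q => q.2) contDiff_snd.contDiffOn

theorem dx_stripTime : dx T (stripTime T) = 0 :=
  (dir_of_clm (ContinuousLinearMap.snd ℝ ℝ ℝ) (1, 0)).trans (by simp)

theorem dtime_stripTime : dtime T (stripTime T) = 1 :=
  (dir_of_clm (ContinuousLinearMap.snd ℝ ℝ ℝ) (0, 1)).trans (by simp)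

/-- No gradient catastrophe: `1 + t A_x > 0` for a smooth solution of `A_t = A A_x`. -/
theorem one_add_time_mul_pos {A : SmoothFn (strip T)} (hA : dtime T A = A * dx T A)
    (q : strip T) : 0 < 1 + (stripTime T) q * dx T A q := by
  obtain ⟨⟨x, t⟩, -, ht⟩ := q
  -- The function `1 + t A_x` solves the conservation law `F_t = (A F)_x` and equals 1 at time 0.
  obtain ⟨y, r, hr⟩ := exists_exp_of_transport (F := 1 + stripTime T * dx T A) hA (by
    have hc : dtime T (dx T A) = A * dx T (dx T A) + dx T A * dx T A := by
      rw [dir_comm, hA, (dx T).leibniz, smul_eq_mul, smul_eq_mul]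
    simp only [map_add, Derivation.leibniz, Derivation.map_one_eq_zero, hc, dx_stripTime,
      dtime_stripTime, smul_eq_mul]
    ring) (x₁ := x) ht
  have h1 : (1 + stripTime T * dx T A) ⟨(x, t), mem_strip ht⟩
      = 1 + (stripTime T) ⟨(x, t), mem_strip ht⟩ * dx T A ⟨(x, t), mem_strip ht⟩ := rfl
  rw [h1, SmoothFn.add_apply, SmoothFn.mul_apply] at hr
  rw [hr]
  have : (stripTime T) ⟨(y, 0), mem_strip ⟨le_rfl, ht.1.trans_lt ht.2⟩⟩ = 0 := rfl
  rw [this, zero_mul, SmoothFn.one_apply, add_zero, one_mul]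
  exact Real.exp_pos r

/-- Uniqueness for the linear transport equation. -/
theorem eq_zero_of_transport {A F : SmoothFn (strip T)} (hA : dtime T A = A * dx T A)
    (hF : dtime T F = dx T (A * F))
    (h0 : ∀ y (h0 : (0 : ℝ) ∈ Ico 0 T), F ⟨(y, 0), mem_strip h0⟩ = 0) : F = 0 := by
  ext ⟨⟨x, t⟩, -, ht⟩
  obtain ⟨y, r, hr⟩ := exists_exp_of_transport (F := F) hA (by
    rw [hF, (dx T).leibniz, smul_eq_mul, smul_eq_mul]; ring) (x₁ := x) ht
  rw [h0 y ⟨le_rfl, ht.1.trans_lt ht.2⟩, zero_mul] at hr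
  exact hr

end Strip

/-! ### Substitution of jets -/

section Subst

variable {U : Set ℝ} {h : ℝ → ℝ} [hU : Fact (IsOpen U)] [hh : SmoothHam U h]
  {E : Type*} [NormedAddCommGroup E] [NormedSpace ℝ E] {S : Set E} [SmoothDomain S]

theorem mapsTo_extend {v : SmoothFn S} (hv : ∀ x, v x ∈ U) : MapsTo v.extend S U := fun x hx => by
  rw [extend_apply _ hx]; exact hv _

/-- Composition of a function of `u` with a function that takes values in `U`. -/
noncomputable def along (v : SmoothFn S) (hv : ∀ x, v x ∈ U) : SmoothFn U →ₐ[ℝ] SmoothFn S :=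
  pull v.extend v.contDiffOn_extend (mapsTo_extend hv)

theorem along_apply (v : SmoothFn S) (hv : ∀ x, v x ∈ U) (f : SmoothFn U) (x : S) :
    along v hv f x = f ⟨v x, hv x⟩ := by
  rw [along, pull_apply]
  exact congrArg f.1 (Subtype.ext (extend_apply _ x.2))

theorem dir_along (v : SmoothFn S) (hv : ∀ x, v x ∈ U) (f : SmoothFn U) (e : E) :
    dir e (along v hv f) = along v hv (dir 1 f) * dir e v := by
  rw [along, dir_pull_one, of_extend]

/-- The values of the jets of `v` in the direction `e` at time `τ` lie in the jet domain. -/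
def JetsMem (U : Set ℝ) (h : ℝ → ℝ) (e : E) (τ v : SmoothFn S) : Prop :=
  ∀ x, (τ x, v x, dir e v x, dir e (dir e v) x) ∈ jetDomain U h

theorem JetsMem.mapsTo {e : E} {τ v : SmoothFn S} (hm : JetsMem U h e τ v) :
    MapsTo (fun x => (τ.extend x, v.extend x, (dir e v).extend x, (dir e (dir e v)).extend x)) S
      (jetDomain U h) := fun x hx => by
  simp only [extend_apply _ hx]
  exact hm ⟨x, hx⟩

/-- Substitution of the jets of `v` in the direction `e` at time `τ`. -/
noncomputable def jetMap (e : E) (τ v : SmoothFn S) (hm : JetsMem U h e τ v) :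
    JetFn U h →ₐ[ℝ] SmoothFn S :=
  pull (fun x => (τ.extend x, v.extend x, (dir e v).extend x, (dir e (dir e v)).extend x))
    (τ.contDiffOn_extend.prodMk (v.contDiffOn_extend.prodMk ((dir e v).contDiffOn_extend.prodMk
      (dir e (dir e v)).contDiffOn_extend)))
    hm.mapsTo

theorem jetMap_apply (e : E) (τ v : SmoothFn S) (hm : JetsMem U h e τ v) (F : JetFn U h) (x : S) :
    jetMap e τ v hm F x = F ⟨(τ x, v x, dir e v x, dir e (dir e v) x), hm x⟩ := by
  rw [jetMap, pull_apply]
  refine congrArg F.1 (Subtype.ext ?_)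
  simp only [extend_apply _ x.2]

theorem dir_jetMap (e : E) (τ v : SmoothFn S) (hm : JetsMem U h e τ v) (F : JetFn U h) (e' : E) :
    dir e' (jetMap e τ v hm F) = jetMap e τ v hm ((JetFn.ring U h).dt F) * dir e' τ
      + jetMap e τ v hm ((JetFn.ring U h).d0 F) * dir e' v
      + jetMap e τ v hm ((JetFn.ring U h).d1 F) * dir e' (dir e v)
      + jetMap e τ v hm ((JetFn.ring U h).d2 F) * dir e' (dir e (dir e v)) := by
  rw [jetMap, dir_pull_four]
  simp only [of_extend]
  rfl

theorem isSubst_jetMap (e : E) (τ v : SmoothFn S) (hm : JetsMem U h e τ v) (hτ : dir e τ = 0) :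
    (JetFn.ring U h).IsSubst (dir e) (jetMap e τ v hm) v where
  map_u1 := SmoothFn.ext fun x => jetMap_apply e τ v hm _ x
  map_u2 := SmoothFn.ext fun x => jetMap_apply e τ v hm _ x
  apply F := by rw [dir_jetMap, hτ, mul_zero, zero_add]

theorem jetMap_base (e : E) (τ v : SmoothFn S) (hm : JetsMem U h e τ v) (f : SmoothFn U) :
    jetMap e τ v hm (base f) = along v (fun x => (hm x).1) f :=
  SmoothFn.ext fun x => by rw [jetMap_apply, along_apply]; rfl

theorem isFlow_jetMap (e e' : E) (τ v : SmoothFn S) (hm : JetsMem U h e τ v) (hτ : dir e τ = 0)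
    (hτ' : dir e' τ = 1) (hv : dir e' v = along v (fun x => (hm x).1) (hFn U h 2) * dir e v) :
    (JetFn.ring U h).IsFlow (dir e) (dir e') (jetMap e τ v hm) v (base (hFn U h 2)) where
  toIsSubst := isSubst_jetMap e τ v hm hτ
  base := isBase _
  comm := dir_comm e' e
  eqn := by rw [jetMap_base, hv]
  time F := by rw [dir_jetMap, hτ', mul_one]

/-- Naturality of the Euler operator under composition. -/
theorem jetRing_euler_comp {R R' : Type*} [CommRing R] [Algebra ℝ R] [CommRing R'] [Algebra ℝ R']
    {B : Type*} [CommRing B] [Algebra ℝ B] (Γ : JetRing B) {D : Derivation ℝ R R}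
    {D' : Derivation ℝ R' R'} {J : B →ₐ[ℝ] R} {J' : B →ₐ[ℝ] R'} (ψ : R →ₐ[ℝ] R')
    (hD : ∀ a, ψ (D a) = D' (ψ a)) (hJ : ∀ F, ψ (J F) = J' F) (κ : B) :
    ψ (Γ.euler D J κ) = Γ.euler D' J' κ := by
  simp only [JetRing.euler, map_add, map_sub, hD, hJ]

theorem jetRing_frechetEuler_comp {R R' : Type*} [CommRing R] [Algebra ℝ R] [CommRing R']
    [Algebra ℝ R'] {B : Type*} [CommRing B] [Algebra ℝ B] (Γ : JetRing B) {D : Derivation ℝ R R}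
    {D' : Derivation ℝ R' R'} {J : B →ₐ[ℝ] R} {J' : B →ₐ[ℝ] R'} (ψ : R →ₐ[ℝ] R')
    (hD : ∀ a, ψ (D a) = D' (ψ a)) (hJ : ∀ F, ψ (J F) = J' F) (κ : B) (X : R) :
    ψ (Γ.frechetEuler D J κ X) = Γ.frechetEuler D' J' κ (ψ X) := by
  simp only [JetRing.frechetEuler, JetRing.frechet, map_add, map_sub, map_mul, hD, hJ]

end Subst

/-! ### Slices -/

section Slice

variable {E : Type*} [NormedAddCommGroup E] [NormedSpace ℝ E] {S : Set E} [SmoothDomain S]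

theorem SmoothFn.deriv_curve (f : SmoothFn S) {γ : ℝ → E} {N : Set ℝ} (hN : IsOpen N)
    (hm : MapsTo γ N S) {e : E} (hγ : ∀ y ∈ N, HasDerivAt γ e y) {g : ℝ → ℝ}
    (hg : ∀ y (hy : y ∈ N), g y = f ⟨γ y, hm hy⟩) {y : ℝ} (hy : y ∈ N) :
    deriv g y = dir e f ⟨γ y, hm hy⟩ := by
  have h1 := (f.hasDerivWithinAt_comp (hγ y hy).hasDerivWithinAt hm (hm hy)).hasDerivAt
    (hN.mem_nhds hy)
  refine (h1.congr_of_eventuallyEq ?_).deriv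
  filter_upwards [hN.mem_nhds hy] with z hz
  rw [hg z hz, extend_apply f (hm hz)]

theorem SmoothFn.iteratedDeriv_curve (f : SmoothFn S) {γ : ℝ → E} {N : Set ℝ} (hN : IsOpen N)
    (hm : MapsTo γ N S) {e : E} (hγ : ∀ y ∈ N, HasDerivAt γ e y) {g : ℝ → ℝ}
    (hg : ∀ y (hy : y ∈ N), g y = f ⟨γ y, hm hy⟩) (n : ℕ) {y : ℝ} (hy : y ∈ N) :
    iteratedDeriv n g y = ((dir e)^[n] f) ⟨γ y, hm hy⟩ := by
  induction n generalizing y with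
  | zero => simpa using hg y hy
  | succ n ih =>
    rw [Function.iterate_succ_apply', iteratedDeriv_succ]
    exact SmoothFn.deriv_curve _ hN hm hγ (fun z hz => ih hz) hy

theorem SmoothFn.dir_pull_of_fderivWithin {E' : Type*} [NormedAddCommGroup E'] [NormedSpace ℝ E']
    {S' : Set E'} [SmoothDomain S'] (Φ : E' → E) (hΦ : ContDiffOn ℝ ∞ Φ S') (hm : MapsTo Φ S' S)
    {e' : E'} {e : E} (h : ∀ x ∈ S', fderivWithin ℝ Φ S' x e' = e) (f : SmoothFn S) :
    dir e' (pull Φ hΦ hm f) = pull Φ hΦ hm (dir e f) :=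
  SmoothFn.ext fun x => by rw [dir_pull, h x x.2, pull_apply, dir_apply]

end Slice

/-! ### Variational derivatives -/

section Variational

variable {U : Set ℝ} {h : ℝ → ℝ} [hU : Fact (IsOpen U)] [hh : SmoothHam U h]

theorem JetFn.deriv_d0 {L : ℝ → ℝ → ℝ → ℝ} {F : JetFn U h} {t : ℝ}
    (hL : ∀ u u1 u2 (hm : (t, u, u1, u2) ∈ jetDomain U h), L u u1 u2 = F ⟨_, hm⟩) {u u1 u2 : ℝ}
    (hm : (t, u, u1, u2) ∈ jetDomain U h) :
    deriv (fun r => L r u1 u2) u = (JetFn.ring U h).d0 F ⟨_, hm⟩ :=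
  SmoothFn.deriv_curve F (γ := fun r => (t, r, u1, u2))
    (N := (fun r => (t, r, u1, u2)) ⁻¹' jetDomain U h)
    ((isOpen_jetDomain U h).preimage (by fun_prop)) (fun _ hr => hr)
    (fun r _ => (hasDerivAt_const r t).prodMk ((hasDerivAt_id r).prodMk (hasDerivAt_const r _)))
    (fun r hr => hL r u1 u2 hr) (y := u) hm

theorem JetFn.deriv_d1 {L : ℝ → ℝ → ℝ → ℝ} {F : JetFn U h} {t : ℝ}
    (hL : ∀ u u1 u2 (hm : (t, u, u1, u2) ∈ jetDomain U h), L u u1 u2 = F ⟨_, hm⟩) {u u1 u2 : ℝ}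
    (hm : (t, u, u1, u2) ∈ jetDomain U h) :
    deriv (fun r => L u r u2) u1 = (JetFn.ring U h).d1 F ⟨_, hm⟩ :=
  SmoothFn.deriv_curve F (γ := fun r => (t, u, r, u2))
    (N := (fun r => (t, u, r, u2)) ⁻¹' jetDomain U h)
    ((isOpen_jetDomain U h).preimage (by fun_prop)) (fun _ hr => hr)
    (fun r _ => (hasDerivAt_const r t).prodMk
      ((hasDerivAt_const r u).prodMk ((hasDerivAt_id r).prodMk (hasDerivAt_const r u2))))
    (fun r hr => hL u r u2 hr) (y := u1) hm

theorem JetFn.deriv_d2 {L : ℝ → ℝ → ℝ → ℝ} {F : JetFn U h} {t : ℝ}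
    (hL : ∀ u u1 u2 (hm : (t, u, u1, u2) ∈ jetDomain U h), L u u1 u2 = F ⟨_, hm⟩) {u u1 u2 : ℝ}
    (hm : (t, u, u1, u2) ∈ jetDomain U h) :
    deriv (fun r => L u u1 r) u2 = (JetFn.ring U h).d2 F ⟨_, hm⟩ :=
  SmoothFn.deriv_curve F (γ := fun r => (t, u, u1, r))
    (N := (fun r => (t, u, u1, r)) ⁻¹' jetDomain U h)
    ((isOpen_jetDomain U h).preimage (by fun_prop)) (fun _ hr => hr)
    (fun r _ => (hasDerivAt_const r t).prodMk
      ((hasDerivAt_const r u).prodMk ((hasDerivAt_const r u1).prodMk (hasDerivAt_id r))))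
    (fun r hr => hL u u1 r hr) (y := u2) hm

variable {E : Type*} [NormedAddCommGroup E] [NormedSpace ℝ E] {S : Set E} [SmoothDomain S]

/-- Carries the pointwise variational derivative into the algebra of smooth functions, along any
curve with constant tangent `e`. It serves both for the line and for the slices `r = const` of a
deformation. Agreement of `L` with `F` on the jet domain suffices because that domain is open and
differentiation is local. -/
theorem varDeriv_curve {e : E} {τ v : SmoothFn S} (hm : JetsMem U h e τ v) {γ : ℝ → E} {N : Set ℝ}
    (hN : IsOpen N) (hγm : MapsTo γ N S) (hγ : ∀ y ∈ N, HasDerivAt γ e y) {g : ℝ → ℝ}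
    (hg : ∀ y (hy : y ∈ N), g y = v ⟨γ y, hγm hy⟩) {t : ℝ}
    (ht : ∀ y (hy : y ∈ N), τ ⟨γ y, hγm hy⟩ = t) {L : ℝ → ℝ → ℝ → ℝ} {F : JetFn U h}
    (hL : ∀ u u1 u2 (hm : (t, u, u1, u2) ∈ jetDomain U h), L u u1 u2 = F ⟨_, hm⟩) {y : ℝ}
    (hy : y ∈ N) :
    varDeriv L g y = (JetFn.ring U h).euler (dir e) (jetMap e τ v hm) F ⟨γ y, hγm hy⟩ := by
  have hg1 : ∀ z (hz : z ∈ N), deriv g z = dir e v ⟨γ z, hγm hz⟩ := fun z hz =>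
    SmoothFn.deriv_curve v hN hγm hγ hg hz
  have hg2 : ∀ z (hz : z ∈ N), iteratedDeriv 2 g z = dir e (dir e v) ⟨γ z, hγm hz⟩ := fun z hz =>
    SmoothFn.iteratedDeriv_curve v hN hγm hγ hg 2 hz
  have hjm : ∀ z (hz : z ∈ N), (t, g z, deriv g z, iteratedDeriv 2 g z) ∈ jetDomain U h := by
    intro z hz
    rw [hg z hz, hg1 z hz, hg2 z hz, ← ht z hz]
    exact hm _
  have hJ : ∀ (G : JetFn U h) z (hz : z ∈ N),
      G ⟨_, hjm z hz⟩ = jetMap e τ v hm G ⟨γ z, hγm hz⟩ := by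
    intro G z hz
    rw [jetMap_apply]
    refine congrArg G.1 (Subtype.ext ?_)
    simp only [hg z hz, hg1 z hz, hg2 z hz, ht z hz]
  simp only [varDeriv, JetRing.euler, SmoothFn.add_apply, SmoothFn.sub_apply]
  congr 1
  · congr 1
    · rw [JetFn.deriv_d0 hL (hjm y hy), hJ _ y hy]
    · refine SmoothFn.deriv_curve _ hN hγm hγ (fun z hz => ?_) hy
      rw [JetFn.deriv_d1 hL (hjm z hz), hJ _ z hz]
  · refine SmoothFn.iteratedDeriv_curve _ hN hγm hγ (fun z hz => ?_) 2 hy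
    rw [JetFn.deriv_d2 hL (hjm z hz), hJ _ z hz]

theorem hamField_curve {e : E} {τ v : SmoothFn S} (hm : JetsMem U h e τ v) {γ : ℝ → E} {N : Set ℝ}
    (hN : IsOpen N) (hγm : MapsTo γ N S) (hγ : ∀ y ∈ N, HasDerivAt γ e y) {g : ℝ → ℝ}
    (hg : ∀ y (hy : y ∈ N), g y = v ⟨γ y, hγm hy⟩) {t : ℝ}
    (ht : ∀ y (hy : y ∈ N), τ ⟨γ y, hγm hy⟩ = t) {L : ℝ → ℝ → ℝ → ℝ} {F : JetFn U h}
    (hL : ∀ u u1 u2 (hm : (t, u, u1, u2) ∈ jetDomain U h), L u u1 u2 = F ⟨_, hm⟩) {y : ℝ}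
    (hy : y ∈ N) :
    hamField L g y
      = dir e ((JetFn.ring U h).euler (dir e) (jetMap e τ v hm) F) ⟨γ y, hγm hy⟩ :=
  SmoothFn.deriv_curve _ hN hγm hγ (fun _ hz => varDeriv_curve hm hN hγm hγ hg ht hL hz) hy

/-- The first variation of the variational derivative: mixed derivatives commute, so differentiating
in a parameter at fixed time replaces every jet of `v` by the corresponding jet of the variation. -/
theorem dir_euler_jetMap {e e' : E} {τ v : SmoothFn S} (hm : JetsMem U h e τ v)
    (hτ : dir e' τ = 0) (F : JetFn U h) :
    dir e' ((JetFn.ring U h).euler (dir e) (jetMap e τ v hm) F)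
      = (JetFn.ring U h).frechetEuler (dir e) (jetMap e τ v hm) F (dir e' v) := by
  have h1 : ∀ G : JetFn U h, dir e' (jetMap e τ v hm G)
      = (JetFn.ring U h).frechet (dir e) (jetMap e τ v hm) G (dir e' v) := fun G => by
    rw [dir_jetMap, hτ, dir_comm e' e, dir_comm e' e, dir_comm e' e]
    simp only [JetRing.frechet, mul_zero, zero_add]
  rw [JetRing.euler, JetRing.frechetEuler, map_add, map_sub, dir_comm e' e, dir_comm e' e,
    dir_comm e' e, h1, h1, h1]

end Variational

/-! ### The second bracket on the line -/

section Line

variable {U : Set ℝ} {h : ℝ → ℝ} [hU : Fact (IsOpen U)] [hh : SmoothHam U h]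

theorem bracket_id (L : ℝ → ℝ → ℝ → ℝ) : bracket (fun w => w) L = hamField L := by
  funext v x
  simp only [bracket]
  have : HasDerivAt (fun r : ℝ => v x + r * hamField L v x) (1 * hamField L v x) 0 :=
    ((hasDerivAt_id (0 : ℝ)).mul_const _).const_add _
  rw [this.deriv, one_mul]

/-- Smooth functions on the line. -/
abbrev LineFn : Type := SmoothFn (univ : Set ℝ)

theorem hamField_line {t : ℝ} {v : LineFn} (hm : JetsMem U h 1 (algebraMap ℝ _ t) v)
    {L : ℝ → ℝ → ℝ → ℝ} {F : JetFn U h}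
    (hL : ∀ u u1 u2 (hm : (t, u, u1, u2) ∈ jetDomain U h), L u u1 u2 = F ⟨_, hm⟩) (x : ℝ) :
    hamField L v.extend x = dir 1 ((JetFn.ring U h).euler (dir 1) (jetMap 1 _ v hm) F)
      ⟨x, mem_univ x⟩ :=
  hamField_curve hm isOpen_univ (γ := fun y => y) (fun _ _ => mem_univ _)
    (fun y _ => hasDerivAt_id y) (fun _ hy => extend_apply v hy) (fun _ _ => rfl) hL (mem_univ x)

/-- Restriction to the line `r = 0`. -/
noncomputable def initial {O : Set (ℝ × ℝ)} (hO : ∀ y, ((0 : ℝ), y) ∈ O) : SmoothFn O →ₐ[ℝ] LineFn :=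
  pull (S := O) (fun y : ℝ => ((0 : ℝ), y)) (contDiff_const.prodMk contDiff_id).contDiffOn
    fun y _ => hO y

theorem initial_apply {O : Set (ℝ × ℝ)} (hO : ∀ y, ((0 : ℝ), y) ∈ O) (f : SmoothFn O) (y : ℝ) :
    initial hO f ⟨y, mem_univ y⟩ = f ⟨(0, y), hO y⟩ := rfl

theorem hasDerivAt_mk_left (r z : ℝ) : HasDerivAt (fun z : ℝ => (r, z)) ((0, 1) : ℝ × ℝ) z :=
  (hasDerivAt_const z r).prodMk (hasDerivAt_id z)

theorem hasDerivAt_mk_right (r z : ℝ) : HasDerivAt (fun r : ℝ => (r, z)) ((1, 0) : ℝ × ℝ) r :=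
  (hasDerivAt_id r).prodMk (hasDerivAt_const r z)

theorem initial_dir {O : Set (ℝ × ℝ)} [SmoothDomain O] (hO : ∀ y, ((0 : ℝ), y) ∈ O)
    (f : SmoothFn O) : initial hO (dir (0, 1) f) = dir 1 (initial hO f) := by
  refine (SmoothFn.dir_pull_of_fderivWithin _ _ _ (fun y _ => ?_) f).symm
  rw [fderivWithin_univ]
  exact (hasDerivAt_mk_left 0 y).hasFDerivAt.fderiv ▸ by simp

theorem hasDerivAt_extend_line (f : LineFn) (y : ℝ) :
    HasDerivAt f.extend (dir 1 f ⟨y, mem_univ y⟩) y := by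
  rw [← hasDerivWithinAt_univ]
  exact f.hasDerivWithinAt_comp (γ := fun y => y) (hasDerivWithinAt_id y univ)
    (fun _ _ => mem_univ _) (mem_univ y)

/-- The deformation `f0 + r f1 + r² f2` of `f0`, on a neighbourhood of `r = 0`. -/
theorem exists_deformation {t : ℝ} {f0 : LineFn} (hm : JetsMem U h 1 (algebraMap ℝ _ t) f0)
    (f1 f2 : LineFn) :
    ∃ (O : Set (ℝ × ℝ)) (_ : SmoothDomain O) (w : SmoothFn O)
      (hw : JetsMem U h (0, 1) (algebraMap ℝ _ t) w) (hO : ∀ y, ((0 : ℝ), y) ∈ O), IsOpen O ∧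
      (∀ r y (hq : (r, y) ∈ O),
        w ⟨(r, y), hq⟩ = f0.extend y + r * f1.extend y + r ^ 2 * f2.extend y) ∧
      initial hO w = f0 ∧ initial hO (dir (1, 0) w) = f1 ∧
      initial hO (dir (1, 0) (dir (1, 0) w)) = 2 * f2 ∧
      ∀ F, initial hO (jetMap (0, 1) _ w hw F) = jetMap 1 _ f0 hm F := by
  have ext_snd : ∀ f : LineFn, ContDiff ℝ ∞ (fun q : ℝ × ℝ => f.extend q.2) := fun f =>
    (contDiffOn_univ.1 f.contDiffOn_extend).comp contDiff_snd
  have smooth : ∀ f g k : LineFn, ContDiff ℝ ∞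
      (fun q : ℝ × ℝ => f.extend q.2 + q.1 * g.extend q.2 + q.1 ^ 2 * k.extend q.2) := fun f g k =>
    ((ext_snd f).add (contDiff_fst.mul (ext_snd g))).add
      ((contDiff_fst.pow 2).mul (ext_snd k))
  set w0 : ℝ × ℝ → ℝ := fun q => f0.extend q.2 + q.1 * f1.extend q.2 + q.1 ^ 2 * f2.extend q.2
    with hw0
  have hw0s : ContDiff ℝ ∞ w0 := smooth f0 f1 f2
  set w1 : ℝ × ℝ → ℝ := fun q => (dir 1 f0).extend q.2 + q.1 * (dir 1 f1).extend q.2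
    + q.1 ^ 2 * (dir 1 f2).extend q.2 with hw1
  have hw1s : ContDiff ℝ ∞ w1 := smooth (dir 1 f0) (dir 1 f1) (dir 1 f2)
  -- The condition defining the jet domain does not involve `u₂`, hence the dummy value 0. The size
  -- of the admissible `r` may depend on `y`, so `O` need not contain a uniform strip around `r =
  -- 0`.
  set O : Set (ℝ × ℝ) := (fun q => (t, w0 q, w1 q, 0)) ⁻¹' jetDomain U h with hOdef
  have hOo : IsOpen O := (isOpen_jetDomain U h).preimage
    (continuous_const.prodMk (hw0s.continuous.prodMk (hw1s.continuous.prodMk continuous_const)))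
  have : SmoothDomain O := hOo.smoothDomain
  have hO : ∀ y, ((0 : ℝ), y) ∈ O := by
    intro y
    have := hm ⟨y, mem_univ y⟩
    simp only [hOdef, mem_preimage, hw0, hw1, zero_mul, add_zero, extend_apply _ (mem_univ y),
      zero_pow two_ne_zero]
    exact this
  set w : SmoothFn O := of w0 hw0s.contDiffOn with hw
  have hdw : dir (0, 1) w = of w1 hw1s.contDiffOn := by
    refine SmoothFn.ext fun q => ?_
    obtain ⟨⟨r, y⟩, hq⟩ := q
    rw [← SmoothFn.deriv_curve w (γ := fun z => (r, z)) (N := (fun z => (r, z)) ⁻¹' O)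
      (hOo.preimage (by fun_prop)) (fun _ hz => hz) (fun z _ => hasDerivAt_mk_left r z)
      (g := fun z => w0 (r, z)) (fun z hz => rfl) hq, of_apply]
    have : HasDerivAt (fun z => w0 (r, z)) (dir 1 f0 ⟨y, mem_univ y⟩
        + r * dir 1 f1 ⟨y, mem_univ y⟩ + r ^ 2 * dir 1 f2 ⟨y, mem_univ y⟩) y :=
      ((hasDerivAt_extend_line f0 y).add ((hasDerivAt_extend_line f1 y).const_mul r)).add
        ((hasDerivAt_extend_line f2 y).const_mul (r ^ 2))
    rw [this.deriv, hw1]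
    simp only [extend_apply _ (mem_univ y)]
  have hmO : JetsMem U h (0, 1) (algebraMap ℝ (SmoothFn O) t) w := by
    intro q
    rw [hdw]
    exact q.2
  have hd : ∀ r y, HasDerivAt (fun r => w0 (r, y)) (f1.extend y + 2 * r * f2.extend y) r := by
    intro r y
    refine (((hasDerivAt_id' r).mul_const (f1.extend y)).const_add (f0.extend y)).add
      (((hasDerivAt_id' r).fun_pow 2).mul_const (f2.extend y)) |>.congr_deriv ?_
    simp
  have hiter : ∀ n y, iteratedDeriv n (fun r => w0 (r, y)) 0
      = ((dir (1, 0))^[n] w) ⟨(0, y), hO y⟩ := fun n y =>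
    SmoothFn.iteratedDeriv_curve w (γ := fun r => (r, y)) (N := (fun r => (r, y)) ⁻¹' O)
      (hOo.preimage (by fun_prop)) (fun _ hz => hz) (fun r _ => hasDerivAt_mk_right r y)
      (fun r hr => rfl) n (hO y)
  have hψw : initial hO w = f0 := SmoothFn.ext fun ⟨y, _⟩ => by
    rw [initial_apply, hw, of_apply, hw0]
    simp only [zero_mul, add_zero, extend_apply _ (mem_univ y), zero_pow two_ne_zero]
  refine ⟨O, this, w, hmO, hO, hOo, fun _ _ _ => rfl, hψw, SmoothFn.ext fun ⟨y, _⟩ => ?_,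
    SmoothFn.ext fun ⟨y, _⟩ => ?_, fun F => SmoothFn.ext fun ⟨y, _⟩ => ?_⟩
  · rw [initial_apply]
    refine (hiter 1 y).symm.trans ?_
    rw [iteratedDeriv_one, (hd 0 y).deriv, extend_apply _ (mem_univ y)]
    ring
  · rw [initial_apply]
    refine (hiter 2 y).symm.trans ?_
    rw [iteratedDeriv_succ, iteratedDeriv_one, funext fun r => (hd r y).deriv, SmoothFn.mul_apply,
      SmoothFn.ofNat_apply]
    have : HasDerivAt (fun r => f1.extend y + 2 * r * f2.extend y) (2 * 1 * f2.extend y) 0 :=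
      (((hasDerivAt_id' (0 : ℝ)).const_mul 2).mul_const (f2.extend y)).const_add (f1.extend y)
    rw [this.deriv, extend_apply _ (mem_univ y), mul_one]
  · rw [initial_apply, jetMap_apply, jetMap_apply]
    refine congrArg F.1 (Subtype.ext ?_)
    have e1 := initial_dir hO w
    have e2 := initial_dir hO (dir (0, 1) w)
    rw [e1] at e2
    rw [hψw] at e1 e2
    exact Prod.ext rfl (Prod.ext (congrArg (fun f : LineFn => f ⟨y, mem_univ y⟩) hψw)
      (Prod.ext (congrArg (fun f : LineFn => f ⟨y, mem_univ y⟩) e1)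
        (congrArg (fun f : LineFn => f ⟨y, mem_univ y⟩) e2)))

theorem hamField_deformation {O : Set (ℝ × ℝ)} [SmoothDomain O] (hOo : IsOpen O) {t : ℝ}
    {w : SmoothFn O} (hw : JetsMem U h (0, 1) (algebraMap ℝ _ t) w) {L : ℝ → ℝ → ℝ → ℝ}
    {F : JetFn U h}
    (hL : ∀ u u1 u2 (hm : (t, u, u1, u2) ∈ jetDomain U h), L u u1 u2 = F ⟨_, hm⟩) {r : ℝ}
    {g : ℝ → ℝ} (hg : ∀ y (hq : (r, y) ∈ O), g y = w ⟨(r, y), hq⟩) {x : ℝ} (hx : (r, x) ∈ O) :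
    hamField L g x
      = dir (0, 1) ((ring U h).euler (dir (0, 1)) (jetMap (0, 1) _ w hw) F) ⟨(r, x), hx⟩ :=
  hamField_curve hw (N := (fun z => (r, z)) ⁻¹' O) (hOo.preimage (by fun_prop))
    (γ := fun z => (r, z)) (fun _ hz => hz) (fun z _ => hasDerivAt_mk_left r z) hg
    (fun _ _ => rfl) hL hx

/-- The linear deformation `v + rX` is a smooth function of `(r, y)` near `r = 0`, so `∂_r` may be
interchanged with `∂_y` and evaluated on the Euler expression at `r = 0`. -/
theorem deriv_hamField_line {t : ℝ} {v X : LineFn} (hm : JetsMem U h 1 (algebraMap ℝ _ t) v)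
    {L : ℝ → ℝ → ℝ → ℝ} {F : JetFn U h}
    (hL : ∀ u u1 u2 (hm : (t, u, u1, u2) ∈ jetDomain U h), L u u1 u2 = F ⟨_, hm⟩) (x : ℝ) :
    deriv (fun r : ℝ => hamField L (fun y => v.extend y + r * X.extend y) x) 0
      = dir 1 ((JetFn.ring U h).frechetEuler (dir 1) (jetMap 1 _ v hm) F X) ⟨x, mem_univ x⟩ := by
  obtain ⟨O, _, w, hw, hO, hOo, hwO, -, hw1, -, hJ⟩ := exists_deformation hm X 0
  rw [SmoothFn.deriv_curve (dir (0, 1) ((ring U h).euler (dir (0, 1)) (jetMap (0, 1) _ w hw) F))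
    (γ := fun r => (r, x)) (N := (fun r => (r, x)) ⁻¹' O) (hOo.preimage (by fun_prop))
    (fun _ hz => hz) (fun r _ => hasDerivAt_mk_right r x) (fun r hr => hamField_deformation hOo hw hL
      (fun y hq => by
        rw [hwO r y hq, extend_apply (0 : LineFn) (mem_univ y), SmoothFn.zero_apply, mul_zero,
          add_zero]) hr) (y := 0) (hO x),
    dir_comm (1, 0) (0, 1), dir_euler_jetMap hw (Derivation.map_algebraMap _ t),
    ← initial_apply hO, initial_dir,
    jetRing_frechetEuler_comp (ring U h) (initial hO) (initial_dir hO) hJ, hw1]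

theorem bracket_bracket_line {t : ℝ} {v : LineFn} (hm : JetsMem U h 1 (algebraMap ℝ _ t) v)
    {L : ℝ → ℝ → ℝ → ℝ} {F : JetFn U h}
    (hL : ∀ u u1 u2 (hm : (t, u, u1, u2) ∈ jetDomain U h), L u u1 u2 = F ⟨_, hm⟩) (x : ℝ) :
    bracket (bracket (fun w => w) L) L v.extend x
      = dir 1 ((JetFn.ring U h).frechetEuler (dir 1) (jetMap 1 _ v hm) F
          (dir 1 ((JetFn.ring U h).euler (dir 1) (jetMap 1 _ v hm) F))) ⟨x, mem_univ x⟩ := by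
  rw [← deriv_hamField_line hm hL, bracket_id, bracket]
  congr 1
  funext r
  congr 1
  funext y
  rw [hamField_line hm hL, extend_apply (dir 1 _) (mem_univ y)]

end Line

/-! ### The canonical transformation on the strip -/

theorem JetRing.frechetEuler_bilinear {R B : Type*} [CommRing R] [Algebra ℝ R] [CommRing B]
    [Algebra ℝ B] (Γ : JetRing B) (D : Derivation ℝ R R) (J : B →ₐ[ℝ] R) (F G : B) (X Y : R)
    (a b : ℝ) : Γ.frechetEuler D J (a • F + b • G) (a • X + b • Y) =
      a ^ 2 • Γ.frechetEuler D J F X + (a * b) • (Γ.frechetEuler D J F Y + Γ.frechetEuler D J G X)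
        + b ^ 2 • Γ.frechetEuler D J G Y := by
  have h1 : ∀ F G : B, Γ.frechet D J (a • F + b • G) (a • X + b • Y)
      = a ^ 2 • Γ.frechet D J F X + (a * b) • (Γ.frechet D J F Y + Γ.frechet D J G X)
        + b ^ 2 • Γ.frechet D J G Y := fun F G => by
    simp only [JetRing.frechet, map_add, map_smul, Derivation.map_smul]
    simp only [Algebra.smul_def, map_pow, map_mul]
    ring
  simp only [JetRing.frechetEuler, map_add, map_smul, Derivation.map_smul, h1]
  simp only [Algebra.smul_def, map_pow, map_mul]
  ring

section StripSlice

variable {T t : ℝ}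

/-- Restriction to a time slice. -/
noncomputable def slice (ht : t ∈ Ico 0 T) : SmoothFn (strip T) →ₐ[ℝ] LineFn :=
  pull (S := strip T) (fun y : ℝ => (y, t)) (contDiff_id.prodMk contDiff_const).contDiffOn
    fun _ _ => mem_strip ht

theorem slice_apply (ht : t ∈ Ico 0 T) (f : SmoothFn (strip T)) (y : ℝ) :
    slice ht f ⟨y, mem_univ y⟩ = f ⟨(y, t), mem_strip ht⟩ := rfl

theorem slice_extend (ht : t ∈ Ico 0 T) (f : SmoothFn (strip T)) (y : ℝ) :
    (slice ht f).extend y = f ⟨(y, t), mem_strip ht⟩ := extend_apply _ (mem_univ y)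

theorem slice_dx (ht : t ∈ Ico 0 T) (f : SmoothFn (strip T)) :
    slice ht (dx T f) = dir 1 (slice ht f) := by
  refine (SmoothFn.dir_pull_of_fderivWithin _ _ _ (fun y _ => ?_) f).symm
  rw [fderivWithin_univ]
  have : HasDerivAt (fun y : ℝ => (y, t)) ((1, 0) : ℝ × ℝ) y :=
    (hasDerivAt_id y).prodMk (hasDerivAt_const y t)
  exact this.hasFDerivAt.fderiv ▸ by simp

variable {U : Set ℝ} {h : ℝ → ℝ} [hU : Fact (IsOpen U)] [hh : SmoothHam U h]

theorem JetsMem.slice {V : SmoothFn (strip T)} (hm : JetsMem U h (1, 0) (stripTime T) V)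
    (ht : t ∈ Ico 0 T) : JetsMem U h 1 (algebraMap ℝ LineFn t) (slice ht V) := by
  intro y
  rw [← slice_dx, ← slice_dx]
  exact hm ⟨(y, t), mem_strip ht⟩

theorem slice_jetMap {V : SmoothFn (strip T)} (hm : JetsMem U h (1, 0) (stripTime T) V)
    (ht : t ∈ Ico 0 T) (F : JetFn U h) :
    slice ht (jetMap (1, 0) (stripTime T) V hm F) = jetMap 1 _ (slice ht V) (hm.slice ht) F := by
  refine SmoothFn.ext fun y => ?_
  refine (slice_apply ht _ y).trans ?_
  rw [jetMap_apply, jetMap_apply]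
  refine congrArg F.1 (Subtype.ext ?_)
  simp only [← slice_dx]
  rfl

/-- The time `t` is a mere parameter of the brackets. The first bracket is linear in `K` and the
second quadratic, so the map is a polynomial in `ε` whose coefficients of `ε²` and `ε⁴` are `X` and
`D M`. -/
theorem canonicalMap_strip {V : SmoothFn (strip T)} (hm : JetsMem U h (1, 0) (stripTime T) V)
    (ht : t ∈ Ico 0 T) {L₁ L₃ : ℝ → ℝ → ℝ → ℝ} {k κ : JetFn U h}
    (h₁ : ∀ u u1 u2 (hm : (t, u, u1, u2) ∈ jetDomain U h), L₁ u u1 u2 = k ⟨_, hm⟩)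
    (h₃ : ∀ u u1 u2 (hm : (t, u, u1, u2) ∈ jetDomain U h), L₃ u u1 u2 = κ ⟨_, hm⟩)
    {v : ℝ → ℝ} (hv : ∀ y, v y = V ⟨(y, t), mem_strip ht⟩) (x : ℝ) {X M : SmoothFn (strip T)}
    (hX : X = dx T ((JetFn.ring U h).euler (dx T) (jetMap _ _ V hm) k))
    (hM : M = (JetFn.ring U h).euler (dx T) (jetMap _ _ V hm) κ
      + (1 / 2 : ℝ) • (JetFn.ring U h).frechetEuler (dx T) (jetMap _ _ V hm) k X) :
    (fun ε : ℝ => canonicalMap ε (fun u u1 u2 => ε * L₁ u u1 u2 + ε ^ 3 * L₃ u u1 u2) v x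
      - (v x + ε ^ 2 * X ⟨(x, t), mem_strip ht⟩ + ε ^ 4 * dx T M ⟨(x, t), mem_strip ht⟩))
      =O[𝓝 0] fun ε => ε ^ 6 := by
  set Γ := JetFn.ring U h
  set J := jetMap _ _ V hm
  set J' := jetMap 1 _ (slice ht V) (hm.slice ht) with hJ'
  obtain rfl : v = (slice ht V).extend := funext fun y => by rw [hv, slice_extend]
  set Y := dx T (Γ.euler (dx T) J κ) with hY
  have hE : ∀ F, dir 1 (Γ.euler (dir 1) J' F) = slice ht (dx T (Γ.euler (dx T) J F)) := fun F => by
    rw [slice_dx, jetRing_euler_comp Γ (slice ht) (slice_dx ht) (slice_jetMap hm ht)]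
  have hFE : ∀ F Z, dir 1 (Γ.frechetEuler (dir 1) J' F (slice ht Z))
      = slice ht (dx T (Γ.frechetEuler (dx T) J F Z)) := fun F Z => by
    rw [slice_dx, jetRing_frechetEuler_comp Γ (slice ht) (slice_dx ht) (slice_jetMap hm ht)]
  set A := dx T (Γ.frechetEuler (dx T) J k Y + Γ.frechetEuler (dx T) J κ X) with hA
  set B := dx T (Γ.frechetEuler (dx T) J κ Y) with hB
  set q : strip T := ⟨(x, t), mem_strip ht⟩ with hq
  -- The error is exact: the cross terms of `K₁` and `K₃` give `ε⁶`, and the square of `K₃` gives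
  -- `ε⁸`.
  have key : ∀ ε : ℝ, canonicalMap ε (fun u u1 u2 => ε * L₁ u u1 u2 + ε ^ 3 * L₃ u u1 u2)
      (slice ht V).extend x - ((slice ht V).extend x + ε ^ 2 * X q + ε ^ 4 * dx T M q)
      = ε ^ 6 * (1 / 2 * A q + ε ^ 2 * (1 / 2 * B q)) := by
    intro ε
    have hL : ∀ u u1 u2 (hm : (t, u, u1, u2) ∈ jetDomain U h),
        ε * L₁ u u1 u2 + ε ^ 3 * L₃ u u1 u2 = (ε • k + ε ^ 3 • κ) ⟨_, hm⟩ := fun u u1 u2 hm => by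
      rw [h₁ _ _ _ hm, h₃ _ _ _ hm]
      rfl
    have hXY : dir 1 (Γ.euler (dir 1) J' (ε • k + ε ^ 3 • κ))
        = ε • slice ht X + ε ^ 3 • slice ht Y := by
      rw [JetRing.euler_add, JetRing.euler_smul, JetRing.euler_smul, map_add, Derivation.map_smul, Derivation.map_smul,
        hE, hE, ← hX]
    rw [canonicalMap, bracket_bracket_line (hm.slice ht) hL, bracket_id,
      hamField_line (hm.slice ht) hL, ← hJ', show JetFn.ring U h = Γ from rfl, hXY,
      JetRing.frechetEuler_bilinear]
    simp only [map_add, map_smul, Derivation.map_smul, hFE]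
    simp only [SmoothFn.add_apply, SmoothFn.smul_apply, slice_apply]
    rw [hM, hA, hB, hY]
    simp only [map_add, map_smul, Derivation.map_smul, SmoothFn.add_apply, SmoothFn.smul_apply, hq]
    ring
  simp only [key]
  refine IsBigO.of_bound (|1 / 2 * A q| + |1 / 2 * B q|) ?_
  filter_upwards [Metric.ball_mem_nhds (0 : ℝ) one_pos] with ε hε
  rw [norm_mul, mul_comm]
  gcongr
  refine (norm_add_le _ _).trans ?_
  rw [norm_mul (ε ^ 2), norm_pow, Real.norm_eq_abs, Real.norm_eq_abs]
  gcongr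
  refine mul_le_of_le_one_left (abs_nonneg _) (pow_le_one₀ (abs_nonneg _) ?_)
  rw [mem_ball_zero_iff] at hε
  exact hε.le

end StripSlice

/-! ### The corrections and their transport equations -/

theorem JetRing.IsSubst.euler_quadratic {R B : Type*} [CommRing R] [Algebra ℝ R] [CommRing B]
    [Algebra ℝ B] {Γ : JetRing B} {D : Derivation ℝ R R} {J : B →ₐ[ℝ] R} {v : R}
    (H : Γ.IsSubst D J v) {p s : B} (hp : Γ.IsBase p) (hs : Γ.IsBase s) :
    Γ.euler D J (p * Γ.u2 ^ 2 + s * Γ.u1 ^ 4)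
      = 2 * J p * D (D (D (D v))) + 4 * J (Γ.d0 p) * D v * D (D (D v))
        + 2 * J (Γ.d0 (Γ.d0 p)) * D v ^ 2 * D (D v) + 3 * J (Γ.d0 p) * D (D v) ^ 2
        - 12 * J s * D v ^ 2 * D (D v) - 3 * J (Γ.d0 s) * D v ^ 4 := by
  simp only [JetRing.euler, map_add, Derivation.leibniz, Derivation.map_sq,
    Derivation.map_pow_four, hp.d1, hp.d2, hs.d1, hs.d2, Γ.d0_u1, Γ.d0_u2, Γ.d1_u1, Γ.d1_u2,
    Γ.d2_u1, Γ.d2_u2, smul_eq_mul, mul_zero, add_zero, zero_add, mul_one, map_mul, map_pow,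
    map_ofNat, map_zero, H.map_u1, H.map_u2, Derivation.map_cube, Derivation.map_ofNat_eq_zero,
    H.apply, hp.deriv.d1, hp.deriv.d2, zero_mul]
  ring

section Corrections

variable {U : Set ℝ} {h : ℝ → ℝ} [hU : Fact (IsOpen U)] [hh : SmoothHam U h] {c p s : SmoothFn U}
  {lam : ℝ}

theorem d2_nullCoeff0 : (ring U h).d2 (nullCoeff0 h c lam) = 0 := by
  simp only [nullCoeff0, map_mul, map_add,
    map_sub, map_neg, Derivation.map_smul, Derivation.leibniz,
    Derivation.map_sq, Derivation.map_cube, Derivation.map_pow_four, Derivation.map_pow_five,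
    Derivation.map_pow_six, Derivation.map_one_eq_zero, d2_base, d2_winv, d2_time, d2_rem,
    d2_remCoeff, (ring U h).d2_u1, smul_zero, add_zero, mul_zero, sub_zero, smul_eq_mul, zero_add]

theorem d2_nullCoeff1 : (ring U h).d2 (nullCoeff1 h c lam) = 0 := by
  simp only [nullCoeff1, map_mul, map_add,
    map_sub, map_neg, Derivation.map_smul, Derivation.leibniz,
    Derivation.map_sq, Derivation.map_cube, Derivation.map_pow_four, Derivation.map_pow_five,
    Derivation.map_pow_six, Derivation.map_one_eq_zero, d2_base, d2_winv, d2_time, d2_rem,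
    d2_remCoeff, (ring U h).d2_u1, smul_zero, add_zero, mul_zero, sub_zero, smul_eq_mul, zero_add]

/-- Closedness alone makes the Euler expression vanish, so no primitive has to be found and the
topology of the jet domain plays no role. -/
theorem euler_nullCoeff {R : Type*} [CommRing R] [Algebra ℝ R] {D : Derivation ℝ R R}
    {J : JetFn U h →ₐ[ℝ] R} {v : R} (H : (ring U h).IsSubst D J v) :
    (ring U h).euler D J
      ((ring U h).u1 ^ 2 * nullCoeff0 h c lam + nullCoeff1 h c lam * (ring U h).u2) = 0 := by
  have h1 := d0_nullCoeff1 (U := U) (h := h) (c := c) (lam := lam)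
  have h0 := d2_nullCoeff0 (U := U) (h := h) (c := c) (lam := lam)
  have h2 := d2_nullCoeff1 (U := U) (h := h) (c := c) (lam := lam)
  generalize nullCoeff0 h c lam = N0 at *
  generalize nullCoeff1 h c lam = N1 at *
  refine H.euler_eq_zero ?_ h2 ?_ ?_
  · rw [Derivation.leibniz, Derivation.map_sq, h0, (ring U h).d2_u1, smul_zero, mul_zero, smul_zero,
      add_zero]
  · rw [h1, Derivation.leibniz, Derivation.map_sq, (ring U h).d1_u1, smul_eq_mul, smul_eq_mul]
    ring
  · rw [← (ring U h).d1_d0, h1]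
    simp only [map_add, Derivation.leibniz, Derivation.map_sq, (ring U h).d1_u1, smul_eq_mul,
      Derivation.map_ofNat_eq_zero, Derivation.map_one_eq_zero, mul_zero, zero_mul, add_zero,
      zero_add, mul_one]
    ring

variable {T : ℝ} {V : SmoothFn (strip T)}

/-- `∂ₓ δK₁/δu`. -/
noncomputable def firstCorrection (c : SmoothFn U) (hm : JetsMem U h (1, 0) (stripTime T) V) :
    SmoothFn (strip T) :=
  dx T (jetMap _ _ V hm (alphaFn h c + betaFn h c * (ring U h).u2))

/-- The potential of the second correction. -/
noncomputable def secondPotential (c s : SmoothFn U) (lam : ℝ)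
    (hm : JetsMem U h (1, 0) (stripTime T) V) : SmoothFn (strip T) :=
  (ring U h).euler (dx T) (jetMap _ _ V hm) (kappa3Fn h c s lam)
    + (1 / 2 : ℝ) • (ring U h).frechet (dx T) (jetMap _ _ V hm)
      (alphaFn h c + betaFn h c * (ring U h).u2) (firstCorrection c hm)

/-- The second correction. -/
noncomputable def secondCorrection (c s : SmoothFn U) (lam : ℝ)
    (hm : JetsMem U h (1, 0) (stripTime T) V) : SmoothFn (strip T) :=
  dx T (secondPotential c s lam hm)

theorem firstCorrection_eq (hm : JetsMem U h (1, 0) (stripTime T) V) : firstCorrection c hm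
    = dx T ((ring U h).euler (dx T) (jetMap _ _ V hm) (k1Fn h c)) := by
  rw [(isSubst_jetMap _ _ V hm dx_stripTime).euler_firstOrder (d2_k1Fn _), euler_k1Fn, firstCorrection]

theorem secondPotential_eq (hm : JetsMem U h (1, 0) (stripTime T) V) : secondPotential c s lam hm
    = (ring U h).euler (dx T) (jetMap _ _ V hm) (kappa3Fn h c s lam)
      + (1 / 2 : ℝ) • (ring U h).frechetEuler (dx T) (jetMap _ _ V hm) (k1Fn h c)
        (firstCorrection c hm) := by
  rw [(isSubst_jetMap _ _ V hm dx_stripTime).frechetEuler_firstOrder (d2_k1Fn _), euler_k1Fn,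
    secondPotential]

/-- The function `A = h''(v)` satisfies `A_t = A A_x`, and `t A_x = t h'''(v) v_x`; positivity of
`W` is the positivity of `1 + t A_x`. -/
theorem jetsMem_of_flow (hV : ∀ q, V q ∈ U)
    (hflow : dtime T V = along V hV (hFn U h 2) * dx T V) :
    JetsMem U h (1, 0) (stripTime T) V := by
  intro q
  refine ⟨hV q, ?_⟩
  have hA : dtime T (along V hV (hFn U h 2)) = along V hV (hFn U h 2)
      * dx T (along V hV (hFn U h 2)) := by
    rw [dir_along, dir_along, hflow]
    ring
  have := one_add_time_mul_pos hA q
  rw [dir_along, dir_hFn, SmoothFn.mul_apply, along_apply, hFn_apply] at this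
  simpa only [mul_assoc] using this

theorem d0_base_hFn (n : ℕ) :
    (ring U h).d0 (base (hFn U h n)) = base (hFn U h (n + 1)) := by
  rw [d0_base, dir_hFn]

theorem dtime_firstCorrection (hm : JetsMem U h (1, 0) (stripTime T) V) (hV : ∀ q, V q ∈ U)
    (hflow : dtime T V = along V hV (hFn U h 2) * dx T V) :
    dtime T (firstCorrection c hm)
      = dx T (jetMap _ _ V hm (base (hFn U h 2)) * firstCorrection c hm
        + jetMap _ _ V hm ((ring U h).quadEuler (base (cHFn h c)))) := by
  have H := isFlow_jetMap (1, 0) (0, 1) _ V hm dx_stripTime dtime_stripTime hflow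
  rw [firstCorrection, H.comm, H.apply_map, d0_base_hFn, flow_alphaFn_add]

theorem jetMap_quadEuler (hm : JetsMem U h (1, 0) (stripTime T) V) (hV : ∀ q, V q ∈ U)
    (f : SmoothFn U) : jetMap _ _ V hm ((ring U h).quadEuler (base f))
      = along V hV f * dx T (dx T V) + (1 / 2 : ℝ) • (along V hV (derivFn f 1) * dx T V ^ 2) := by
  have H := isSubst_jetMap _ _ V hm dx_stripTime
  simp only [JetRing.quadEuler, map_add, map_mul, map_smul, map_pow, jetMap_base, H.map_u1,
    H.map_u2, d0_base]
  rfl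

theorem dtime_secondCorrection (hm : JetsMem U h (1, 0) (stripTime T) V) (hV : ∀ q, V q ∈ U)
    (hflow : dtime T V = along V hV (hFn U h 2) * dx T V)
    (hp : p = (3 / 5 : ℝ) • (derivFn c 0 * derivFn c 1) + lam • derivFn c 0 ^ 3) :
    dtime T (secondCorrection c s lam hm)
      = dx T (jetMap _ _ V hm (base (hFn U h 2)) * secondCorrection c s lam hm
        + (1 / 2 : ℝ) • (jetMap _ _ V hm (base (hFn U h 3)) * firstCorrection c hm ^ 2)
        + (ring U h).frechet (dx T) (jetMap _ _ V hm)
          ((ring U h).quadEuler (base (cHFn h c))) (firstCorrection c hm)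
        + (ring U h).euler (dx T) (jetMap _ _ V hm)
          (base (pHFn h c p) * (ring U h).u2 ^ 2 + base (sHFn h c p s) * (ring U h).u1 ^ 4)) := by
  have H := isFlow_jetMap (1, 0) (0, 1) _ V hm dx_stripTime dtime_stripTime hflow
  have key := H.apply_secondCorrection (isBase (cHFn h c)) (d2_alphaFn c) (d2_betaFn c)
    (d1_alphaFn c) (by rw [d0_base_hFn, flow_alphaFn_add])
    (by rw [d0_base_hFn]; exact flow_kappa3Fn c p s lam hp) (euler_nullCoeff H.toIsSubst)
    (X := firstCorrection c hm) rfl (M := secondPotential c s lam hm) rfl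
  rw [secondCorrection, H.comm, key, d0_base_hFn]

/-- The linearization of `c_h v_xx + ½ c_h' v_x²` is the self-adjoint operator `X ↦ (c_h X_x)_x +
(c_h' v_xx + ½ c_h'' v_x²) X`; the other terms are the variational derivative of the `ε⁴` part of
the Hamiltonian. -/
theorem secondTransport_eq (hm : JetsMem U h (1, 0) (stripTime T) V) (hV : ∀ q, V q ∈ U)
    (X : SmoothFn (strip T)) :
    (ring U h).frechet (dx T) (jetMap _ _ V hm) ((ring U h).quadEuler (base (cHFn h c))) X
        + (ring U h).euler (dx T) (jetMap _ _ V hm)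
          (base (pHFn h c p) * (ring U h).u2 ^ 2 + base (sHFn h c p s) * (ring U h).u1 ^ 4)
      = dx T (along V hV (cHFn h c) * dx T X)
        + along V hV (derivFn (cHFn h c) 1) * dx T (dx T V) * X
        + (1 / 2 : ℝ) • (along V hV (derivFn (cHFn h c) 2) * dx T V ^ 2 * X)
        + 2 * along V hV (pHFn h c p) * dx T (dx T (dx T (dx T V)))
        + 4 * along V hV (derivFn (pHFn h c p) 1) * dx T V * dx T (dx T (dx T V))
        + 2 * along V hV (derivFn (pHFn h c p) 2) * dx T V ^ 2 * dx T (dx T V)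
        + 3 * along V hV (derivFn (pHFn h c p) 1) * dx T (dx T V) ^ 2
        - 12 * along V hV (sHFn h c p s) * dx T V ^ 2 * dx T (dx T V)
        - 3 * along V hV (derivFn (sHFn h c p s) 1) * dx T V ^ 4 := by
  have H := isSubst_jetMap _ _ V hm dx_stripTime
  rw [H.euler_quadratic (isBase _) (isBase _)]
  simp only [JetRing.frechet, JetRing.quadEuler, map_add, map_mul, map_smul, map_pow, map_ofNat,
    jetMap_base, H.map_u1, H.map_u2, d0_base, d1_base, d2_base, Derivation.map_smul,
    Derivation.leibniz, Derivation.map_sq, (ring U h).d0_u1, (ring U h).d0_u2, (ring U h).d1_u1,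
    (ring U h).d1_u2, (ring U h).d2_u1, (ring U h).d2_u2, dir_hFn, dir_along, smul_eq_mul,
    mul_zero, zero_mul, add_zero, zero_add, mul_one, map_one, map_zero, smul_zero]
  simp only [derivFn, Function.iterate_succ_apply', Function.iterate_zero_apply]
  algebra

end Corrections

/-! ### Pointwise form of the transport equations -/

section Pointwise

variable {U : Set ℝ} {h : ℝ → ℝ} [hU : Fact (IsOpen U)] [hh : SmoothHam U h] {c p s : ℝ → ℝ}

theorem cHFn_apply (hc : ContDiffOn ℝ ∞ c U) (u : U) : cHFn h (of c hc) u = cH h c u := by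
  simp only [cHFn, cH, SmoothFn.mul_apply, derivFn_of_apply, hFn_apply, iteratedDeriv_zero]

theorem pHFn_apply (hc : ContDiffOn ℝ ∞ c U) (hp : ContDiffOn ℝ ∞ p U) (u : U) :
    pHFn h (of c hc) (of p hp) u = pH h c p u := by
  simp only [pHFn, pH, SmoothFn.add_apply, SmoothFn.smul_apply, SmoothFn.pow_apply,
    SmoothFn.mul_apply, derivFn_of_apply, hFn_apply, iteratedDeriv_zero]
  ring

theorem sHFn_apply (hc : ContDiffOn ℝ ∞ c U) (hp : ContDiffOn ℝ ∞ p U) (hs : ContDiffOn ℝ ∞ s U)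
    (u : U) : sHFn h (of c hc) (of p hp) (of s hs) u = sH h c p s u := by
  simp only [sHFn, sH, SmoothFn.sub_apply, SmoothFn.smul_apply, SmoothFn.pow_apply,
    SmoothFn.mul_apply, derivFn_of_apply, hFn_apply, iteratedDeriv_zero, iteratedDeriv_one]
  ring

theorem derivFn_apply {F : SmoothFn U} {g : ℝ → ℝ} (hg : ∀ u : U, F u = g u) (n : ℕ) (u : U) :
    derivFn F n u = iteratedDeriv n g u :=
  iterate_dir_apply hU.out F hg n u

variable {T : ℝ} {V : SmoothFn (strip T)} {v0 : ℝ → ℝ → ℝ}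

theorem transport1_rhs (hm : JetsMem U h (1, 0) (stripTime T) V)
    (h0 : ∀ x t (ht : t ∈ Ico 0 T), v0 x t = V ⟨(x, t), mem_strip ht⟩) (hc : ContDiffOn ℝ ∞ c U)
    {v1 : ℝ → ℝ → ℝ} {X : SmoothFn (strip T)}
    (h1 : ∀ x t (ht : t ∈ Ico 0 T), v1 x t = X ⟨(x, t), mem_strip ht⟩) (x : ℝ) {t : ℝ}
    (ht : t ∈ Ico 0 T) :
    deriv (fun y => iteratedDeriv 2 h (v0 y t) * v1 y t
        + cH h c (v0 y t) * iteratedDeriv 2 (fun z => v0 z t) y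
        + 1 / 2 * deriv (cH h c) (v0 y t) * deriv (fun z => v0 z t) y ^ 2) x
      = dx T (jetMap _ _ V hm (base (hFn U h 2)) * X
        + jetMap _ _ V hm ((ring U h).quadEuler (base (cHFn h (of c hc)))))
          ⟨(x, t), mem_strip ht⟩ := by
  rw [jetMap_quadEuler hm fun q => (hm q).1, jetMap_base]
  refine deriv_eq_dx _ ht (fun y => ?_) x
  rw [deriv_eq_dx V ht (fun z => h0 z t ht), iteratedDeriv_eq_dx V ht (fun z => h0 z t ht) 2,
    h1 y t ht, h0 y t ht]
  simp only [SmoothFn.add_apply, SmoothFn.mul_apply, SmoothFn.smul_apply, SmoothFn.pow_apply,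
    along_apply, hFn_apply, cHFn_apply, derivFn_apply (cHFn_apply (h := h) hc), iteratedDeriv_one,
    Function.iterate_succ_apply', Function.iterate_zero_apply]
  ring

theorem transport2_rhs (hm : JetsMem U h (1, 0) (stripTime T) V)
    (h0 : ∀ x t (ht : t ∈ Ico 0 T), v0 x t = V ⟨(x, t), mem_strip ht⟩) (hc : ContDiffOn ℝ ∞ c U)
    (hp : ContDiffOn ℝ ∞ p U) (hs : ContDiffOn ℝ ∞ s U) {v1 v2 : ℝ → ℝ → ℝ}
    {X Y : SmoothFn (strip T)}
    (h1 : ∀ x t (ht : t ∈ Ico 0 T), v1 x t = X ⟨(x, t), mem_strip ht⟩)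
    (h2 : ∀ x t (ht : t ∈ Ico 0 T), v2 x t = Y ⟨(x, t), mem_strip ht⟩) (x : ℝ) {t : ℝ}
    (ht : t ∈ Ico 0 T) :
    deriv (fun y =>
      iteratedDeriv 2 h (v0 y t) * v2 y t
        + 1 / 2 * iteratedDeriv 3 h (v0 y t) * v1 y t ^ 2
        + deriv (fun z => cH h c (v0 z t) * deriv (fun w => v1 w t) z) y
        + deriv (cH h c) (v0 y t) * iteratedDeriv 2 (fun z => v0 z t) y * v1 y t
        + 1 / 2 * iteratedDeriv 2 (cH h c) (v0 y t) * deriv (fun z => v0 z t) y ^ 2 * v1 y t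
        + 2 * pH h c p (v0 y t) * iteratedDeriv 4 (fun z => v0 z t) y
        + 4 * deriv (pH h c p) (v0 y t) * deriv (fun z => v0 z t) y
            * iteratedDeriv 3 (fun z => v0 z t) y
        + 2 * iteratedDeriv 2 (pH h c p) (v0 y t) * deriv (fun z => v0 z t) y ^ 2
            * iteratedDeriv 2 (fun z => v0 z t) y
        + 3 * deriv (pH h c p) (v0 y t) * iteratedDeriv 2 (fun z => v0 z t) y ^ 2
        - 12 * sH h c p s (v0 y t) * deriv (fun z => v0 z t) y ^ 2
            * iteratedDeriv 2 (fun z => v0 z t) y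
        - 3 * deriv (sH h c p s) (v0 y t) * deriv (fun z => v0 z t) y ^ 4) x
      = dx T (jetMap _ _ V hm (base (hFn U h 2)) * Y
        + (1 / 2 : ℝ) • (jetMap _ _ V hm (base (hFn U h 3)) * X ^ 2)
        + (ring U h).frechet (dx T) (jetMap _ _ V hm)
          ((ring U h).quadEuler (base (cHFn h (of c hc)))) X
        + (ring U h).euler (dx T) (jetMap _ _ V hm)
          (base (pHFn h (of c hc) (of p hp)) * (ring U h).u2 ^ 2
            + base (sHFn h (of c hc) (of p hp) (of s hs)) * (ring U h).u1 ^ 4))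
          ⟨(x, t), mem_strip ht⟩ := by
  have hV : ∀ q, V q ∈ U := fun q => (hm q).1
  rw [add_assoc _ ((ring U h).frechet _ _ _ _), secondTransport_eq hm hV, jetMap_base, jetMap_base]
  refine deriv_eq_dx _ ht (fun y => ?_) x
  have e : deriv (fun z => cH h c (v0 z t) * deriv (fun w => v1 w t) z) y
      = dx T (along V hV (cHFn h (of c hc)) * dx T X) ⟨(y, t), mem_strip ht⟩ := by
    refine deriv_eq_dx _ ht (fun z => ?_) y
    rw [deriv_eq_dx X ht (fun z => h1 z t ht), h0 z t ht, SmoothFn.mul_apply, along_apply,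
      cHFn_apply]
  rw [e, deriv_eq_dx V ht (fun z => h0 z t ht), iteratedDeriv_eq_dx V ht (fun z => h0 z t ht) 2,
    iteratedDeriv_eq_dx V ht (fun z => h0 z t ht) 3,
    iteratedDeriv_eq_dx V ht (fun z => h0 z t ht) 4, h1 y t ht, h2 y t ht, h0 y t ht]
  simp only [SmoothFn.add_apply, SmoothFn.sub_apply, SmoothFn.mul_apply, SmoothFn.smul_apply,
    SmoothFn.pow_apply, SmoothFn.ofNat_apply, along_apply, hFn_apply, cHFn_apply, pHFn_apply,
    sHFn_apply, derivFn_apply (cHFn_apply (h := h) hc), derivFn_apply (pHFn_apply (h := h) hc hp),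
    derivFn_apply (sHFn_apply (h := h) hc hp hs), iteratedDeriv_one,
    Function.iterate_succ_apply', Function.iterate_zero_apply]
  ring

/-! ### Initial values -/

theorem dx_eq_zero_of_slice {f : SmoothFn (strip T)} {t : ℝ} (ht : t ∈ Ico 0 T)
    (hf : ∀ y, f ⟨(y, t), mem_strip ht⟩ = 0) (x : ℝ) : dx T f ⟨(x, t), mem_strip ht⟩ = 0 := by
  rw [← deriv_eq_dx f ht (g := fun _ => 0) (fun y => (hf y).symm), deriv_const]

/-- Functions of jets that vanish at time `0`. -/
def VanishesInitially (F : JetFn U h) : Prop :=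
  ∀ u u1 u2 (hm : ((0 : ℝ), u, u1, u2) ∈ jetDomain U h), F ⟨_, hm⟩ = 0

namespace VanishesInitially

variable {F : JetFn U h}

/-- The derivations `d0`, `d1`, `d2` are tangent to the slice `t = 0` and therefore preserve
vanishing there. -/
theorem d0 (hF : VanishesInitially F) : VanishesInitially ((ring U h).d0 F) :=
  fun u u1 u2 hm => by
    rw [← JetFn.deriv_d0 (L := fun _ _ _ => 0) (fun u u1 u2 hm => (hF u u1 u2 hm).symm) hm,
      deriv_const]

theorem d1 (hF : VanishesInitially F) : VanishesInitially ((ring U h).d1 F) :=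
  fun u u1 u2 hm => by
    rw [← JetFn.deriv_d1 (L := fun _ _ _ => 0) (fun u u1 u2 hm => (hF u u1 u2 hm).symm) hm,
      deriv_const]

theorem d2 (hF : VanishesInitially F) : VanishesInitially ((ring U h).d2 F) :=
  fun u u1 u2 hm => by
    rw [← JetFn.deriv_d2 (L := fun _ _ _ => 0) (fun u u1 u2 hm => (hF u u1 u2 hm).symm) hm,
      deriv_const]

variable (hm : JetsMem U h (1, 0) (stripTime T) V) (h0 : (0 : ℝ) ∈ Ico 0 T)

theorem jetMap (hF : VanishesInitially F) (y : ℝ) :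
    jetMap _ _ V hm F ⟨(y, 0), mem_strip h0⟩ = 0 := by
  rw [jetMap_apply]
  exact hF _ _ _ _

theorem euler (hF : VanishesInitially F) (y : ℝ) :
    (ring U h).euler (dx T) (_root_.jetMap _ _ V hm) F ⟨(y, 0), mem_strip h0⟩ = 0 := by
  rw [JetRing.euler, SmoothFn.add_apply, SmoothFn.sub_apply, hF.d0.jetMap hm h0,
    dx_eq_zero_of_slice h0 (hF.d1.jetMap hm h0),
    dx_eq_zero_of_slice h0 (dx_eq_zero_of_slice h0 (hF.d2.jetMap hm h0)), sub_zero, add_zero]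

theorem frechet (hF : VanishesInitially F) (X : SmoothFn (strip T)) (y : ℝ) :
    (ring U h).frechet (dx T) (_root_.jetMap _ _ V hm) F X ⟨(y, 0), mem_strip h0⟩ = 0 := by
  rw [JetRing.frechet, SmoothFn.add_apply, SmoothFn.add_apply, SmoothFn.mul_apply,
    SmoothFn.mul_apply, SmoothFn.mul_apply, hF.d0.jetMap hm h0, hF.d1.jetMap hm h0,
    hF.d2.jetMap hm h0]
  ring

end VanishesInitially

/-- At `t = 0` one has `W = 1`, so `1 - 1/W` vanishes; the remaining terms contain a factor `t`. -/
theorem vanishesInitially_alphaFn_add (c : SmoothFn U) :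
    VanishesInitially (alphaFn h c + betaFn h c * (ring U h).u2) := fun u u1 u2 hm => by
  simp only [alphaFn, betaFn, SmoothFn.add_apply, SmoothFn.sub_apply, SmoothFn.mul_apply,
    SmoothFn.smul_apply, SmoothFn.pow_apply, SmoothFn.one_apply, time_apply, winv_apply, wr]
  simp

theorem vanishesInitially_kappa3Fn (c s : SmoothFn U) (lam : ℝ) :
    VanishesInitially (kappa3Fn h c s lam) := fun _ _ _ _ => kappa3Fn_eq_zero lam _ (Or.inl rfl)

theorem firstCorrection_initial {c : SmoothFn U} (hm : JetsMem U h (1, 0) (stripTime T) V)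
    (h0 : (0 : ℝ) ∈ Ico 0 T) (x : ℝ) : firstCorrection c hm ⟨(x, 0), mem_strip h0⟩ = 0 :=
  dx_eq_zero_of_slice h0 ((vanishesInitially_alphaFn_add c).jetMap hm h0) x

theorem secondCorrection_initial {c s : SmoothFn U} {lam : ℝ}
    (hm : JetsMem U h (1, 0) (stripTime T) V) (h0 : (0 : ℝ) ∈ Ico 0 T) (x : ℝ) :
    secondCorrection c s lam hm ⟨(x, 0), mem_strip h0⟩ = 0 := by
  refine dx_eq_zero_of_slice h0 (fun y => ?_) x
  rw [secondPotential, SmoothFn.add_apply, SmoothFn.smul_apply,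
    (vanishesInitially_kappa3Fn c s lam).euler hm h0,
    (vanishesInitially_alphaFn_add c).frechet hm h0, mul_zero, add_zero]

/-! ### Existence and uniqueness for the transport equations -/

theorem flow_of_isUnperturbedSolution {φ : ℝ → ℝ} (hv : IsUnperturbedSolution U h φ T v0)
    (hVU : ∀ q, (of (fun q : ℝ × ℝ => v0 q.1 q.2) hv.smooth : SmoothFn (strip T)) q ∈ U) :
    dtime T (of (fun q : ℝ × ℝ => v0 q.1 q.2) hv.smooth)
      = along _ hVU (hFn U h 2) * dx T (of (fun q : ℝ × ℝ => v0 q.1 q.2) hv.smooth) := by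
  ext ⟨⟨x, t⟩, -, ht⟩
  rw [dtime_eq_of_hasDerivWithinAt _ ht (fun _ _ => rfl) (hv.eqn x t ht), SmoothFn.mul_apply,
    along_apply, hFn_apply, deriv_eq_dx (of (fun q : ℝ × ℝ => v0 q.1 q.2) hv.smooth) ht (g := fun y => v0 y t)
      (fun _ => rfl)]
  rfl

/-- Equal forcing terms cancel in the difference, which solves the homogeneous linear equation with
zero initial value. -/
theorem eq_of_transport {A W X : SmoothFn (strip T)} (hA : dtime T A = A * dx T A)
    (hWX : dtime T W - dtime T X = dx T (A * W) - dx T (A * X))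
    (hW0 : ∀ y (h0 : (0 : ℝ) ∈ Ico 0 T), W ⟨(y, 0), mem_strip h0⟩ = 0)
    (hX0 : ∀ y (h0 : (0 : ℝ) ∈ Ico 0 T), X ⟨(y, 0), mem_strip h0⟩ = 0) : W = X := by
  rw [← sub_eq_zero]
  refine eq_zero_of_transport hA ?_ fun y h0 => ?_
  · rw [map_sub, hWX, ← map_sub, mul_sub]
  · rw [SmoothFn.sub_apply, hW0 y h0, hX0 y h0, sub_zero]

end Pointwise

/-! ### The perturbed equation modulo `ε⁶` -/

theorem isBigO_cube_of_iteratedDeriv_eq_zero {g : ℝ → ℝ} {N : Set ℝ} (hN : IsOpen N)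
    (h0 : (0 : ℝ) ∈ N) (hg : ContDiffOn ℝ 3 g N) (h : ∀ n < 3, iteratedDeriv n g 0 = 0) :
    g =O[𝓝 0] fun r => r ^ 3 := by
  obtain ⟨δ, hδ, hsub⟩ := Metric.isOpen_iff.1 hN 0 h0
  have hmem := Metric.mem_ball_self (x := (0 : ℝ)) hδ
  have h1 := taylor_isLittleO (n := 3) (convex_ball (0 : ℝ) δ) hmem (hg.mono hsub)
  rw [nhdsWithin_eq_nhds.2 (Metric.ball_mem_nhds 0 hδ)] at h1
  simp only [taylor_within_apply, Finset.sum_range_succ, Finset.sum_range_zero,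
    iteratedDerivWithin_of_isOpen Metric.isOpen_ball hmem, h 0 (by norm_num), h 1 (by norm_num),
    h 2 (by norm_num), smul_zero, zero_add, sub_zero, smul_eq_mul] at h1
  have h2 : (fun r : ℝ => (↑(Nat.factorial 3))⁻¹ * r ^ 3 * iteratedDeriv 3 g 0)
      =O[𝓝 0] fun r => r ^ 3 := by
    refine ((isBigO_refl (fun r : ℝ => r ^ 3) (𝓝 0)).const_mul_left
      ((↑(Nat.factorial 3))⁻¹ * iteratedDeriv 3 g 0)).congr_left fun r => by ring
  simpa using h1.isBigO.add h2

theorem SmoothFn.algebraMap_apply {E : Type*} [NormedAddCommGroup E] [NormedSpace ℝ E] {S : Set E}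
    (a : ℝ) (x : S) : algebraMap ℝ (SmoothFn S) a x = a := rfl

section Perturbed

variable {U : Set ℝ} {h : ℝ → ℝ} [hU : Fact (IsOpen U)] [hh : SmoothHam U h] {c p s : ℝ → ℝ}

/-- The density of the perturbed Hamiltonian, as a function on the jet domain. -/
noncomputable def hamFn (h : ℝ → ℝ) [SmoothHam U h] (c p s : SmoothFn U) (ε : ℝ) : JetFn U h :=
  base (hFn U h 0) + ε ^ 2 • ((-(1 / 2) : ℝ) • (base (cHFn h c) * (ring U h).u1 ^ 2))
    + ε ^ 4 • (base (pHFn h c p) * (ring U h).u2 ^ 2 + base (sHFn h c p s) * (ring U h).u1 ^ 4)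

theorem hamFn_apply (hc : ContDiffOn ℝ ∞ c U) (hp : ContDiffOn ℝ ∞ p U) (hs : ContDiffOn ℝ ∞ s U)
    (ε : ℝ) (q : jetDomain U h) : hamDensity h c p s ε q.1.2.1 q.1.2.2.1 q.1.2.2.2
      = hamFn h (of c hc) (of p hp) (of s hs) ε q := by
  simp only [hamFn, hamDensity, SmoothFn.add_apply, SmoothFn.mul_apply, SmoothFn.smul_apply,
    SmoothFn.pow_apply, base_apply, hFn_apply, cHFn_apply, pHFn_apply, sHFn_apply, u1_apply,
    u2_apply, iteratedDeriv_zero]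
  ring

theorem euler_hamFn {R : Type*} [CommRing R] [Algebra ℝ R] {D : Derivation ℝ R R}
    {J : JetFn U h →ₐ[ℝ] R} {v : R} (H : (ring U h).IsSubst D J v) (c p s : SmoothFn U) (ε : ℝ) :
    (ring U h).euler D J (hamFn h c p s ε) = J (base (hFn U h 1))
      + ε ^ 2 • J ((ring U h).quadEuler (base (cHFn h c)))
      + ε ^ 4 • (ring U h).euler D J
        (base (pHFn h c p) * (ring U h).u2 ^ 2 + base (sHFn h c p s) * (ring U h).u1 ^ 4) := by
  have h0 : (ring U h).euler D J (base (hFn U h 0)) = J (base (hFn U h 1)) := by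
    rw [JetRing.euler, d0_base_hFn, d1_base, d2_base, map_zero, map_zero, map_zero, sub_zero,
      add_zero]
  have h1 : (ring U h).euler D J ((-(1 / 2) : ℝ) • (base (cHFn h c) * (ring U h).u1 ^ 2))
      = J ((ring U h).quadEuler (base (cHFn h c))) := by
    rw [JetRing.euler_smul]
    simp only [JetRing.euler, JetRing.quadEuler, Derivation.leibniz, Derivation.map_sq, d1_base,
      d2_base, d0_base, (ring U h).d0_u1, (ring U h).d1_u1, (ring U h).d2_u1, smul_eq_mul, map_mul,
      map_pow, map_add, map_smul, map_ofNat, map_zero, H.apply, H.map_u1, H.map_u2, mul_zero,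
      zero_mul, add_zero, zero_add, mul_one, map_one, Derivation.map_ofNat_eq_zero]
    algebra
  rw [hamFn, JetRing.euler_add, JetRing.euler_add, JetRing.euler_smul (ε ^ 2), JetRing.euler_smul (ε ^ 4), h0, h1]


/-- Only even powers of `ε` occur, so with `η = ε²` the field along `f0 + η f1 + η² f2` is a smooth
function of `η`. The hypotheses say that `a0`, `a1`, `a2` are its Taylor coefficients at 0; the
error is `O(η³)`. -/
theorem hamField_deformation_isBigO {t : ℝ} {f0 f1 f2 : LineFn}
    (hm : JetsMem U h 1 (algebraMap ℝ _ t) f0) (hc : ContDiffOn ℝ ∞ c U) (hp : ContDiffOn ℝ ∞ p U)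
    (hs : ContDiffOn ℝ ∞ s U) (x : ℝ) {a0 a1 a2 : ℝ}
    (h0 : a0 = dir 1 (jetMap 1 _ f0 hm (base (hFn U h 1))) ⟨x, mem_univ x⟩)
    {G1 G2 : LineFn} (h1 : a1 = dir 1 G1 ⟨x, mem_univ x⟩) (h2 : a2 = dir 1 G2 ⟨x, mem_univ x⟩)
    (hG1 : G1 = jetMap 1 _ f0 hm (base (hFn U h 2)) * f1
      + jetMap 1 _ f0 hm ((ring U h).quadEuler (base (cHFn h (of c hc)))))
    (hG2 : G2 = jetMap 1 _ f0 hm (base (hFn U h 2)) * f2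
      + (1 / 2 : ℝ) • (jetMap 1 _ f0 hm (base (hFn U h 3)) * f1 ^ 2)
      + (ring U h).frechet (dir 1) (jetMap 1 _ f0 hm)
        ((ring U h).quadEuler (base (cHFn h (of c hc)))) f1
      + (ring U h).euler (dir 1) (jetMap 1 _ f0 hm)
        (base (pHFn h (of c hc) (of p hp)) * (ring U h).u2 ^ 2
          + base (sHFn h (of c hc) (of p hp) (of s hs)) * (ring U h).u1 ^ 4)) :
    (fun ε : ℝ => a0 + ε ^ 2 * a1 + ε ^ 4 * a2 - hamField (hamDensity h c p s ε)
      (fun y => f0.extend y + ε ^ 2 * f1.extend y + ε ^ 4 * f2.extend y) x)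
      =O[𝓝 0] fun ε => ε ^ 6 := by
  obtain ⟨O, _, w, hw, hO, hOo, hwO, hw0, hw1, hw2, hJ⟩ := exists_deformation hm f1 f2
  have H := isSubst_jetMap (0, 1) _ w hw (Derivation.map_algebraMap _ t)
  have hd : ∀ F, dir (1, 0) (jetMap (0, 1) _ w hw F)
      = (ring U h).frechet (dir (0, 1)) (jetMap (0, 1) _ w hw) F (dir (1, 0) w) := fun F => by
    rw [dir_jetMap, Derivation.map_algebraMap, dir_comm (1, 0) (0, 1), dir_comm (1, 0) (0, 1),
      dir_comm (1, 0) (0, 1)]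
    simp only [JetRing.frechet, mul_zero, zero_add]
  have hdb : ∀ n, dir (1, 0) (jetMap (0, 1) _ w hw (base (hFn U h n)))
      = jetMap (0, 1) _ w hw (base (hFn U h (n + 1))) * dir (1, 0) w := fun n => by
    rw [hd]
    simp only [JetRing.frechet, d0_base_hFn, d1_base, d2_base, map_zero, zero_mul, add_zero]
  set Q := (ring U h).quadEuler (base (cHFn h (of c hc))) with hQ
  set H4 := base (pHFn h (of c hc) (of p hp)) * (ring U h).u2 ^ 2
    + base (sHFn h (of c hc) (of p hp) (of s hs)) * (ring U h).u1 ^ 4 with hH4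
  set r : SmoothFn O := of (fun q => q.1) contDiff_fst.contDiffOn with hr
  have hr1 : dir (1, 0) r = 1 :=
    (dir_of_clm (ContinuousLinearMap.fst ℝ ℝ ℝ) (1, 0)).trans (by simp)
  have hr2 : dir (0, 1) r = 0 :=
    (dir_of_clm (ContinuousLinearMap.fst ℝ ℝ ℝ) (0, 1)).trans (by simp)
  have hr0 : initial hO r = 0 := SmoothFn.ext fun _ => rfl
  set E2 := (ring U h).euler (dir (0, 1)) (jetMap (0, 1) _ w hw) H4 with hE2
  have hE20 : initial hO E2 = (ring U h).euler (dir 1) (jetMap 1 _ f0 hm) H4 :=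
    jetRing_euler_comp (ring U h) (initial hO) (initial_dir hO) hJ H4
  -- At `r = ε²` this is the variational derivative of the perturbed Hamiltonian along the
  -- deformation.
  set N := jetMap (0, 1) _ w hw (base (hFn U h 1)) + r * jetMap (0, 1) _ w hw Q + r ^ 2 * E2
    with hN
  set P : SmoothFn O := algebraMap ℝ _ a0 + r * algebraMap ℝ _ a1 + r ^ 2 * algebraMap ℝ _ a2
    - dir (0, 1) N with hP
  have hN1 : initial hO (dir (1, 0) N) = G1 := by
    simp only [hN, map_add, Derivation.leibniz, Derivation.map_sq, hdb, hr1, smul_eq_mul, map_mul,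
      map_pow, map_ofNat, hr0, hJ, hw1, map_one, hG1]
    ring
  -- The factor 2 is that of the second Taylor coefficient: `∂_r²` sends `r² f2` to `2 f2`, `r² E2`
  -- to `2 E2` at `r = 0`, and the middle term to twice the linearization in the direction `f1`.
  have hN2 : initial hO (dir (1, 0) (dir (1, 0) N)) = 2 * G2 := by
    have e : initial hO (dir (1, 0) (jetMap (0, 1) _ w hw Q))
        = (ring U h).frechet (dir 1) (jetMap 1 _ f0 hm) Q f1 := by
      rw [hd]
      simp only [JetRing.frechet, map_add, map_mul, initial_dir, hJ, hw1]
    simp only [hN, map_add, Derivation.leibniz, Derivation.map_sq, hdb, hr1, smul_eq_mul, map_mul,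
      map_pow, map_ofNat, hr0, hJ, hw1, hw2, map_one, Derivation.map_ofNat_eq_zero,
      Derivation.map_one_eq_zero, map_zero, e, hE20, hG2]
    algebra
  have hPd : ∀ n < 3, iteratedDeriv n (fun η => P.extend (η, x)) 0 = 0 := by
    intro n hn
    rw [SmoothFn.iteratedDeriv_curve P (γ := fun r => (r, x)) (N := (fun r => (r, x)) ⁻¹' O)
      (hOo.preimage (by fun_prop)) (fun _ hz => hz) (fun r _ => hasDerivAt_mk_right r x)
      (fun r hr => extend_apply P hr) n (hO x), ← initial_apply hO]
    interval_cases n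
    · simp only [Function.iterate_zero_apply, hP, hN, map_add, map_sub, map_mul, map_pow, hr0,
        Derivation.leibniz, Derivation.map_sq, hr2, smul_eq_mul, initial_dir, hJ, h0,
        AlgHom.commutes]
      simp [SmoothFn.algebraMap_apply]
    · simp only [Function.iterate_succ_apply', Function.iterate_zero_apply, hP, map_add, map_sub,
        dir_comm ((1, 0) : ℝ × ℝ) ((0, 1) : ℝ × ℝ), initial_dir, hN1]
      simp only [map_add, map_sub, map_mul, map_pow, hr0, hr1, Derivation.leibniz,
        Derivation.map_sq, Derivation.map_algebraMap, smul_eq_mul, initial_dir, h1,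
        AlgHom.commutes]
      simp [SmoothFn.algebraMap_apply]
    · simp only [Function.iterate_succ_apply', Function.iterate_zero_apply, hP, map_add, map_sub,
        dir_comm ((1, 0) : ℝ × ℝ) ((0, 1) : ℝ × ℝ), initial_dir, hN2]
      simp only [map_add, map_sub, map_mul, map_pow, hr0, hr1, Derivation.leibniz,
        Derivation.map_sq, Derivation.map_algebraMap, smul_eq_mul, initial_dir, h2,
        AlgHom.commutes, Derivation.map_ofNat_eq_zero, Derivation.map_one_eq_zero, map_ofNat]
      simp [SmoothFn.algebraMap_apply, SmoothFn.ofNat_apply, mul_comm]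
  have hNo : IsOpen ((fun r : ℝ => (r, x)) ⁻¹' O) := hOo.preimage (by fun_prop)
  -- Substituting `η = ε²` turns `O(η³)` into `O(ε⁶)`.
  have key := (isBigO_cube_of_iteratedDeriv_eq_zero hNo (hO x)
    ((P.contDiffOn_extend.comp (contDiff_id.prodMk contDiff_const).contDiffOn
      (fun _ hz => hz)).of_le (WithTop.coe_le_coe.2 (le_top : (3 : ℕ∞) ≤ ⊤))) hPd).comp_tendsto
    (show Tendsto (fun ε : ℝ => ε ^ 2) (𝓝 0) (𝓝 0) by
      simpa using (continuous_pow 2).tendsto (0 : ℝ))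
  refine (key.congr' ?_ ?_)
  · have : ∀ᶠ ε : ℝ in 𝓝 0, (ε ^ 2, x) ∈ O := by
      refine (show Continuous fun ε : ℝ => (ε ^ 2, x) by fun_prop).continuousAt.eventually_mem
        (hOo.mem_nhds ?_)
      simpa using hO x
    filter_upwards [this] with ε hε
    rw [hamField_deformation hOo hw (F := hamFn h (of c hc) (of p hp) (of s hs) ε)
      (fun u u1 u2 hm => hamFn_apply hc hp hs ε ⟨_, hm⟩) (r := ε ^ 2)
      (fun y hq => by rw [hwO _ y hq]; ring) hε, euler_hamFn H]
    change P.extend (ε ^ 2, x) = _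
    rw [extend_apply P hε, hP, hN]
    simp only [map_add, Derivation.leibniz, Derivation.map_sq, hr2, Derivation.map_smul,
      SmoothFn.add_apply, SmoothFn.sub_apply, SmoothFn.mul_apply, SmoothFn.smul_apply,
      SmoothFn.pow_apply, smul_eq_mul, mul_zero, SmoothFn.zero_apply]
    have e1 : r ⟨(ε ^ 2, x), hε⟩ = ε ^ 2 := rfl
    rw [e1, SmoothFn.algebraMap_apply, SmoothFn.algebraMap_apply, SmoothFn.algebraMap_apply]
    ring
  · exact Eventually.of_forall fun ε => by simp only [Function.comp_apply]; ring

end Perturbed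

/-! ### The explicit corrections for KdV -/

section KdV

variable {U : Set ℝ} {h : ℝ → ℝ} [hU : Fact (IsOpen U)] [hh : SmoothHam U h] {c s : SmoothFn U}

theorem hFn_three_of_kdv (hk : ∀ u ∈ U, h u = u ^ 3 / 6) : hFn U h 3 = 1 := by
  set X : SmoothFn U := of (fun u => u) contDiff_id.contDiffOn with hX
  have h1 : dir 1 X = 1 :=
    (dir_of_clm (ContinuousLinearMap.id ℝ ℝ) 1).trans (by simp)
  have h0 : of h SmoothHam.smooth = (1 / 6 : ℝ) • X ^ 3 := SmoothFn.ext fun u => by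
    rw [of_apply, hk u u.2, SmoothFn.smul_apply, SmoothFn.pow_apply, hX, of_apply]
    ring
  rw [hFn, h0]
  simp only [Function.iterate_succ_apply', Function.iterate_zero_apply, Derivation.map_smul,
    Derivation.map_cube, Derivation.map_sq, Derivation.leibniz, h1, smul_eq_mul, mul_one,
    Derivation.map_ofNat_eq_zero, mul_zero, add_zero, map_add]
  algebra

theorem hFn_eq_zero_of_kdv (hk : hFn U h 3 = 1) (n : ℕ) : hFn U h (n + 4) = 0 := by
  induction n with
  | zero => rw [← dir_hFn, hk, Derivation.map_one_eq_zero]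
  | succ n ih => rw [← dir_hFn, ih, map_zero]

theorem derivFn_one (n : ℕ) : derivFn (1 : SmoothFn U) (n + 1) = 0 := by
  induction n with
  | zero => rw [← dir_derivFn]; exact Derivation.map_one_eq_zero _
  | succ n ih => rw [← dir_derivFn, ih, map_zero]

theorem betaFn_kdv (hk : hFn U h 3 = 1) : betaFn (U := U) h 1 = (1 / 2 : ℝ) • (time * (winv + winv ^ 2)) := by
  have e : derivFn (1 : SmoothFn U) 0 = 1 := rfl
  rw [betaFn, hk, e, map_one, one_mul, mul_one]

theorem alphaFn_kdv (hk : hFn U h 3 = 1) : alphaFn (U := U) h 1 = 0 := by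
  rw [alphaFn, derivFn_one 0, hFn_eq_zero_of_kdv hk 0]
  simp

theorem kappa3Fn_kdv (hk : hFn U h 3 = 1) : kappa3Fn (U := U) h 1 0 0 = (ring U h).u2 ^ 3 * (time ^ 3
    * ((-1 / 40 : ℝ) • winv ^ 5 + (-3 / 40 : ℝ) • winv ^ 4 + (-1 / 40 : ℝ) • winv ^ 3)) := by
  have e : derivFn (1 : SmoothFn U) 0 = 1 := rfl
  have e' : derivFn (0 : SmoothFn U) 0 = 0 := rfl
  have r0 : remCoeff (U := U) h 1 = 0 := by
    simp only [remCoeff, derivFn_one, hFn_eq_zero_of_kdv hk 0, hFn_eq_zero_of_kdv hk 1,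
      hFn_eq_zero_of_kdv hk 2, map_zero]
    simp
  simp only [kappa3Fn, derivFn_one, hFn_eq_zero_of_kdv hk 0, hFn_eq_zero_of_kdv hk 1,
    hFn_eq_zero_of_kdv hk 2, e, e', hk, map_zero, map_one, r0]
  simp

variable {T : ℝ} {V : SmoothFn (strip T)}

/-- The bracket in the second correction for KdV. -/
noncomputable def kdvBracket (w V : SmoothFn (strip T)) : SmoothFn (strip T) :=
  (-(1 / 10) : ℝ) • (stripTime T ^ 2 * ((4 * w ^ 5 + w ^ 4) * dx T (dx T V) ^ 3))
    + stripTime T * dx T ((3 / 10 : ℝ) • ((8 * w ^ 5 + 9 * w ^ 4 + 3 * w ^ 3) * dx T (dx T V) ^ 2))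
    + dx T (dx T ((w ^ 4 + 2 * w ^ 3 + w ^ 2) * dx T (dx T V)))

theorem dx_winv_kdv (hk : hFn U h 3 = 1)
    (hm : JetsMem U h (1, 0) (stripTime T) V) : dx T (jetMap _ _ V hm winv)
    = -(jetMap _ _ V hm winv) ^ 2 * (stripTime T * dx T (dx T V)) := by
  rw [(isSubst_jetMap _ _ V hm dx_stripTime).apply, d0_winv, d1_winv, d2_winv, hk,
    hFn_eq_zero_of_kdv hk 0]
  have : jetMap _ _ V hm time = stripTime T := SmoothFn.ext fun q => jetMap_apply _ _ V hm _ q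
  simp only [map_mul, map_neg, map_pow, map_zero, map_one, this]
  ring

theorem firstCorrection_kdv (hk : hFn U h 3 = 1)
    (hm : JetsMem U h (1, 0) (stripTime T) V) : firstCorrection 1 hm
    = (1 / 2 : ℝ) • dx T (dx T (jetMap _ _ V hm logW - jetMap _ _ V hm winv)) := by
  have H := isSubst_jetMap _ _ V hm dx_stripTime
  rw [firstCorrection, alphaFn_kdv hk, betaFn_kdv hk, zero_add, map_sub (dx T) (jetMap _ _ V hm logW),
    dx_winv_kdv hk, H.apply logW, d0_logW, d1_logW, d2_logW, hk, hFn_eq_zero_of_kdv hk 0,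
    ← Derivation.map_smul]
  have : jetMap _ _ V hm time = stripTime T := SmoothFn.ext fun q => jetMap_apply _ _ V hm _ q
  congr 1
  simp only [map_mul, map_add, map_smul, map_pow, map_zero, map_one, this, H.map_u2]
  algebra

theorem secondPotential_kdv (hk : hFn U h 3 = 1)
    (hm : JetsMem U h (1, 0) (stripTime T) V) : secondPotential 1 0 0 hm
    = (1 / 8 : ℝ) • (stripTime T ^ 2 * dx T (kdvBracket (jetMap _ _ V hm winv) V)) := by
  have H := isSubst_jetMap _ _ V hm dx_stripTime
  have hw := dx_winv_kdv hk hm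
  have ht : jetMap _ _ V hm time = stripTime T := SmoothFn.ext fun q => jetMap_apply _ _ V hm _ q
  have hτ := dx_stripTime (T := T)
  rw [secondPotential, firstCorrection, alphaFn_kdv hk, betaFn_kdv hk, kappa3Fn_kdv hk, zero_add]
  simp only [JetRing.euler, JetRing.frechet, kdvBracket, Derivation.leibniz, Derivation.map_smul,
    map_add, map_mul, map_pow, map_smul, Derivation.map_sq, Derivation.map_cube,
    Derivation.map_pow_four, Derivation.map_pow_five, d0_time, d1_time, d2_time, d0_winv, d1_winv,
    d2_winv, hk, hFn_eq_zero_of_kdv hk 0, map_zero, map_one, (ring U h).d0_u2, (ring U h).d1_u2,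
    (ring U h).d2_u2, H.map_u2, ht, smul_eq_mul, mul_zero, zero_mul, add_zero, zero_add, smul_zero,
    mul_one, map_neg, map_ofNat, sub_zero, zero_sub]
  -- From here on only `D w = -w² τ b` and `D τ = 0` are needed; the identity is polynomial in `τ`,
  -- `w`, `b` and the derivatives of `b`.
  generalize jetMap _ _ V hm winv = w at *
  generalize stripTime T = τ at *
  generalize dx T (dx T V) = b at *
  simp only [Derivation.leibniz, Derivation.map_smul,
    map_add, map_neg, Derivation.map_sq, Derivation.map_cube,
    Derivation.map_pow_four, Derivation.map_pow_five, Derivation.map_pow_six, map_zero, hw, hτ,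
    smul_eq_mul, mul_zero, zero_mul, add_zero, zero_add, smul_zero,
    Derivation.map_ofNat_eq_zero]
  algebra

theorem kdvV1_eq (hk : hFn U h 3 = 1) (hm : JetsMem U h (1, 0) (stripTime T) V) {t : ℝ}
    (ht : t ∈ Ico 0 T) {v : ℝ → ℝ} (hv : ∀ y, v y = V ⟨(y, t), mem_strip ht⟩) (x : ℝ) :
    kdvV1 t v x = firstCorrection 1 hm ⟨(x, t), mem_strip ht⟩ := by
  rw [firstCorrection_kdv hk, SmoothFn.smul_apply, kdvV1]
  congr 1
  refine iteratedDeriv_eq_dx _ ht (fun y => ?_) 2 x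
  rw [deriv_eq_dx V ht hv, SmoothFn.sub_apply, jetMap_apply, jetMap_apply, logW_apply, winv_apply,
    wr, hk, map_one, mul_one, one_div]
  rfl

/-- With `W = 1 + t v_x` the numerators of the explicit formula become `4 + W`, `8 + 9W + 3W²` and
`(1 + W)²`; divided by the powers of `W` they give the coefficients of `kdvBracket`. The factor `t²`
passes through the outer x-derivative. -/
theorem kdvV2_eq (hk : hFn U h 3 = 1) (hm : JetsMem U h (1, 0) (stripTime T) V) {t : ℝ}
    (ht : t ∈ Ico 0 T) {v : ℝ → ℝ} (hv : ∀ y, v y = V ⟨(y, t), mem_strip ht⟩) (x : ℝ) :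
    kdvV2 t v x = secondCorrection 1 0 0 hm ⟨(x, t), mem_strip ht⟩ := by
  have hw : ∀ y, jetMap _ _ V hm winv ⟨(y, t), mem_strip ht⟩ = (1 + t * deriv v y)⁻¹ := fun y => by
    rw [deriv_eq_dx V ht hv, jetMap_apply, winv_apply, wr, hk, map_one, mul_one]
    rfl
  have hW : ∀ y, 1 + t * deriv v y ≠ 0 := fun y h0 => by
    have h1 := wr_pos ⟨_, hm ⟨(y, t), mem_strip ht⟩⟩
    rw [wr, hk, map_one, mul_one] at h1
    rw [deriv_eq_dx V ht hv] at h0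
    exact h1.ne' h0
  have hb : ∀ y, iteratedDeriv 2 v y = dx T (dx T V) ⟨(y, t), mem_strip ht⟩ :=
    fun y => iteratedDeriv_eq_dx V ht hv 2 y
  have hτ : ∀ y, stripTime T ⟨(y, t), mem_strip ht⟩ = t := fun _ => rfl
  have hD : secondCorrection 1 0 0 hm
      = (1 / 8 : ℝ) • (stripTime T ^ 2
        * dx T (dx T (kdvBracket (jetMap _ _ V hm winv) V))) := by
    rw [secondCorrection, secondPotential_kdv hk, Derivation.map_smul, Derivation.leibniz,
      Derivation.map_sq, dx_stripTime]
    simp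
  rw [hD, SmoothFn.smul_apply, SmoothFn.mul_apply, SmoothFn.pow_apply, kdvV2, hτ, ← mul_assoc,
    one_div_mul_eq_div]
  congr 1
  refine iteratedDeriv_eq_dx _ ht (fun y => ?_) 2 x
  rw [kdvBracket, SmoothFn.add_apply, SmoothFn.add_apply, SmoothFn.smul_apply, SmoothFn.mul_apply,
    SmoothFn.mul_apply, SmoothFn.mul_apply, SmoothFn.pow_apply, hτ]
  congr 1
  · congr 1
    · simp only [SmoothFn.add_apply, SmoothFn.mul_apply, SmoothFn.pow_apply, SmoothFn.ofNat_apply,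
        hw, ← hb]
      field_simp [hW y]
      ring
    · congr 1
      refine deriv_eq_dx _ ht (fun z => ?_) y
      simp only [SmoothFn.smul_apply, SmoothFn.add_apply, SmoothFn.mul_apply, SmoothFn.pow_apply,
        SmoothFn.ofNat_apply, hw, ← hb]
      have := hW z
      field_simp
      ring
  · refine iteratedDeriv_eq_dx _ ht (fun z => ?_) 2 y
    simp only [SmoothFn.add_apply, SmoothFn.mul_apply, SmoothFn.pow_apply, SmoothFn.ofNat_apply,
      hw, ← hb]
    have := hW z
    field_simp
    ring

end KdV

/-! ### The main theorem -/

section Main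

variable {U : Set ℝ} {h : ℝ → ℝ} [hU : Fact (IsOpen U)] [hh : SmoothHam U h] {c p s : ℝ → ℝ}
  {lam T : ℝ}

theorem pFn_eq (hc : ContDiffOn ℝ ∞ c U) (hps : ContDiffOn ℝ ∞ p U)
    (hp : ∀ u ∈ U, p u = 3 / 5 * c u * deriv c u + lam * c u ^ 3) :
    (of p hps : SmoothFn U) = (3 / 5 : ℝ) • (derivFn (of c hc) 0 * derivFn (of c hc) 1)
      + lam • derivFn (of c hc) 0 ^ 3 := by
  ext u
  simp only [of_apply, hp u u.2, SmoothFn.add_apply, SmoothFn.smul_apply, SmoothFn.mul_apply,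
    SmoothFn.pow_apply, derivFn_of_apply, iteratedDeriv_zero, iteratedDeriv_one]
  ring

theorem solvesTransport1_firstCorrection {V : SmoothFn (strip T)} {v0 : ℝ → ℝ → ℝ}
    (h0 : ∀ x t (ht : t ∈ Ico 0 T), v0 x t = V ⟨(x, t), mem_strip ht⟩) (hT : 0 < T)
    (hV : ∀ q, V q ∈ U) (hflow : dtime T V = along V hV (hFn U h 2) * dx T V)
    (hm : JetsMem U h (1, 0) (stripTime T) V) (hc : ContDiffOn ℝ ∞ c U) :
    SolvesTransport1 h c T v0 (fun x t => (firstCorrection (of c hc) hm).extend (x, t)) where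
  smooth := contDiffOn_extend _
  eqn x t ht := by
    rw [transport1_rhs hm h0 hc (fun x t ht => extend_apply _ (mem_strip ht)) x ht,
      ← dtime_firstCorrection hm hV hflow]
    exact hasDerivWithinAt_extend_snd _ x ht
  init x := by
    rw [extend_apply _ (mem_strip ⟨le_rfl, hT⟩)]
    exact firstCorrection_initial hm ⟨le_rfl, hT⟩ x

theorem solvesTransport2_secondCorrection {V : SmoothFn (strip T)} {v0 : ℝ → ℝ → ℝ}
    (h0 : ∀ x t (ht : t ∈ Ico 0 T), v0 x t = V ⟨(x, t), mem_strip ht⟩) (hT : 0 < T)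
    (hV : ∀ q, V q ∈ U) (hflow : dtime T V = along V hV (hFn U h 2) * dx T V)
    (hm : JetsMem U h (1, 0) (stripTime T) V) (hc : ContDiffOn ℝ ∞ c U)
    (hps : ContDiffOn ℝ ∞ p U) (hs : ContDiffOn ℝ ∞ s U)
    (hp : ∀ u ∈ U, p u = 3 / 5 * c u * deriv c u + lam * c u ^ 3) :
    SolvesTransport2 h c p s T v0 (fun x t => (firstCorrection (of c hc) hm).extend (x, t))
      (fun x t => (secondCorrection (of c hc) (of s hs) lam hm).extend (x, t)) where
  smooth := contDiffOn_extend _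
  eqn x t ht := by
    rw [transport2_rhs hm h0 hc hps hs (fun x t ht => extend_apply _ (mem_strip ht))
      (fun x t ht => extend_apply _ (mem_strip ht)) x ht,
      ← dtime_secondCorrection hm hV hflow (pFn_eq hc hps hp)]
    exact hasDerivWithinAt_extend_snd _ x ht
  init x := by
    rw [extend_apply _ (mem_strip ⟨le_rfl, hT⟩)]
    exact secondCorrection_initial hm ⟨le_rfl, hT⟩ x

/-- On each time slice the t-derivatives of `v⁰`, `v¹`, `v²`, given by the flow and the two
transport equations, are the three Taylor coefficients of the perturbed field in `ε²`. -/
theorem solvesPerturbedMod6 {V : SmoothFn (strip T)} {v0 : ℝ → ℝ → ℝ}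
    (h0 : ∀ x t (ht : t ∈ Ico 0 T), v0 x t = V ⟨(x, t), mem_strip ht⟩)
    (hV : ∀ q, V q ∈ U) (hflow : dtime T V = along V hV (hFn U h 2) * dx T V)
    (hm : JetsMem U h (1, 0) (stripTime T) V) (hc : ContDiffOn ℝ ∞ c U)
    (hps : ContDiffOn ℝ ∞ p U) (hs : ContDiffOn ℝ ∞ s U)
    (hp : ∀ u ∈ U, p u = 3 / 5 * c u * deriv c u + lam * c u ^ 3) :
    SolvesPerturbedMod6 h c p s T v0 (fun x t => (firstCorrection (of c hc) hm).extend (x, t))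
      (fun x t => (secondCorrection (of c hc) (of s hs) lam hm).extend (x, t)) := by
  intro x t ht
  set X := firstCorrection (of c hc) hm with hX
  set Y := secondCorrection (of c hc) (of s hs) lam hm with hY
  have hd : ∀ ε : ℝ, derivWithin (fun τ => v0 x τ + ε ^ 2 * X.extend (x, τ)
      + ε ^ 4 * Y.extend (x, τ)) (Ico 0 T) t
      = dtime T V ⟨(x, t), mem_strip ht⟩ + ε ^ 2 * dtime T X ⟨(x, t), mem_strip ht⟩
        + ε ^ 4 * dtime T Y ⟨(x, t), mem_strip ht⟩ := fun ε => by
    have e0 : HasDerivWithinAt (fun τ => v0 x τ) (dtime T V ⟨(x, t), mem_strip ht⟩) (Ico 0 T) t :=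
      (hasDerivWithinAt_extend_snd V x ht).congr
        (fun τ hτ => by rw [h0 x τ hτ, extend_apply _ (mem_strip hτ)])
        (by rw [h0 x t ht, extend_apply _ (mem_strip ht)])
    exact ((e0.add ((hasDerivWithinAt_extend_snd X x ht).const_mul (ε ^ 2))).add
      ((hasDerivWithinAt_extend_snd Y x ht).const_mul (ε ^ 4))).derivWithin
      (uniqueDiffOn_Ico 0 T t ht)
  simp only [hd]
  have H := isFlow_jetMap (1, 0) (0, 1) _ V hm dx_stripTime dtime_stripTime hflow
  have hJ := slice_jetMap hm ht
  have hD := slice_dx ht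
  have hXt := dtime_firstCorrection (c := of c hc) hm hV hflow
  have hYt := dtime_secondCorrection (s := of s hs) hm hV hflow (pFn_eq hc hps hp)
  have hg : ∀ ε : ℝ, (fun y => v0 y t + ε ^ 2 * X.extend (y, t) + ε ^ 4 * Y.extend (y, t))
      = fun y => (slice ht V).extend y + ε ^ 2 * (slice ht X).extend y
        + ε ^ 4 * (slice ht Y).extend y := fun ε => by
    funext y
    rw [slice_extend, slice_extend, slice_extend, h0 y t ht, extend_apply _ (mem_strip ht),
      extend_apply _ (mem_strip ht)]
  simp only [hg]
  refine hamField_deformation_isBigO (hm.slice ht) hc hps hs x ?_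
    (congrArg (fun f : LineFn => f ⟨x, mem_univ x⟩) ((congrArg (slice ht) hXt).trans (hD _)))
    (congrArg (fun f : LineFn => f ⟨x, mem_univ x⟩) ((congrArg (slice ht) hYt).trans (hD _))) ?_ ?_
  · have : dtime T V = dx T (jetMap _ _ V hm (base (hFn U h 1))) := by
      rw [H.apply, d0_base_hFn, d1_base, d2_base, H.eqn]
      simp only [map_zero, zero_mul, add_zero]
    rw [this, ← hJ, ← hD, slice_apply]
  · rw [map_add, map_mul, hJ, hJ]
  · rw [map_add, map_add, map_add, map_mul, map_smul, map_mul, map_pow, hJ, hJ,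
      jetRing_euler_comp (ring U h) (slice ht) hD hJ]
    simp only [JetRing.frechet, map_add, map_mul, hD, hJ, hX, hY]

/-- Both equations have the same linear part `F ↦ (h''(v⁰) F)_x`. The forcing of the first depends
on `v⁰` only; that of the second depends on `v⁰` and the first correction, which by then is known to
be unique. -/
theorem transport_unique {φ : ℝ → ℝ} {v0 v1 v2 w1 w2 : ℝ → ℝ → ℝ}
    (hv : IsUnperturbedSolution U h φ T v0) (hc : ContDiffOn ℝ ∞ c U)
    (hp : ContDiffOn ℝ ∞ p U) (hs : ContDiffOn ℝ ∞ s U)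
    (hv1 : SolvesTransport1 h c T v0 v1) (hv2 : SolvesTransport2 h c p s T v0 v1 v2)
    (hw1 : SolvesTransport1 h c T v0 w1) (hw2 : SolvesTransport2 h c p s T v0 w1 w2)
    (x : ℝ) {t : ℝ} (ht : t ∈ Ico 0 T) : w1 x t = v1 x t ∧ w2 x t = v2 x t := by
  set V : SmoothFn (strip T) := of (fun q : ℝ × ℝ => v0 q.1 q.2) hv.smooth
  have hV : ∀ q, V q ∈ U := fun q => hv.mem q.1.1 q.1.2 q.2.2
  have hflow := flow_of_isUnperturbedSolution hv hV
  have hm := jetsMem_of_flow hV hflow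
  have hA : dtime T (along V hV (hFn U h 2)) = along V hV (hFn U h 2)
      * dx T (along V hV (hFn U h 2)) := by
    rw [dir_along, dir_along, hflow]
    ring
  rw [show along V hV (hFn U h 2) = jetMap _ _ V hm (base (hFn U h 2)) from
    (jetMap_base _ _ V hm _).symm] at hA
  have ext1 : ∀ {u u' : ℝ → ℝ → ℝ} (hu : SmoothOnStrip T u) (hu' : SmoothOnStrip T u'),
      (of (fun q : ℝ × ℝ => u q.1 q.2) hu : SmoothFn (strip T))
        = of (fun q : ℝ × ℝ => u' q.1 q.2) hu' →
      ∀ y τ, τ ∈ Ico 0 T → u y τ = u' y τ := fun hu hu' he y τ hτ =>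
    congrArg (fun f : SmoothFn (strip T) => f ⟨(y, τ), mem_strip hτ⟩) he
  have key1 : ∀ {u : ℝ → ℝ → ℝ} (hu : SolvesTransport1 h c T v0 u),
      dtime T (of (fun q : ℝ × ℝ => u q.1 q.2) hu.smooth) = _ := fun {u} hu => SmoothFn.ext fun q =>
    (dtime_eq_of_hasDerivWithinAt _ q.2.2 (fun _ _ => rfl) (hu.eqn q.1.1 q.1.2 q.2.2)).trans
      (transport1_rhs hm (fun _ _ _ => rfl) hc (X := of (fun q : ℝ × ℝ => u q.1 q.2) hu.smooth)
        (fun _ _ _ => rfl) q.1.1 q.2.2)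
  have e1 := ext1 hw1.smooth hv1.smooth (eq_of_transport hA
    (by rw [key1 hw1, key1 hv1]; simp only [map_add]; abel)
    (fun y _ => hw1.init y) (fun y _ => hv1.init y))
  refine ⟨e1 x t ht, ?_⟩
  -- The right-hand side is expressed through `v1` even for the solution that belongs to `w1`, so
  -- that the two forcing terms coincide literally.
  have key2 : ∀ {u u' : ℝ → ℝ → ℝ} (_ : SolvesTransport1 h c T v0 u)
      (hu' : SolvesTransport2 h c p s T v0 u u') (_ : ∀ y τ, τ ∈ Ico 0 T → u y τ = v1 y τ),
      dtime T (of (fun q : ℝ × ℝ => u' q.1 q.2) hu'.smooth) = _ :=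
    fun {u u'} _ hu' he => SmoothFn.ext fun q =>
    (dtime_eq_of_hasDerivWithinAt _ q.2.2 (fun _ _ => rfl) (hu'.eqn q.1.1 q.1.2 q.2.2)).trans
      (transport2_rhs hm (fun _ _ _ => rfl) hc hp hs
        (X := of (fun q : ℝ × ℝ => v1 q.1 q.2) hv1.smooth)
        (Y := of (fun q : ℝ × ℝ => u' q.1 q.2) hu'.smooth)
        (fun y τ hτ => he y τ hτ) (fun _ _ _ => rfl) q.1.1 q.2.2)
  exact ext1 hw2.smooth hv2.smooth (eq_of_transport hA
    (by rw [key2 hw1 hw2 e1, key2 hv1 hv2 fun _ _ _ => rfl]; simp only [map_add, map_sub]; abel)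
    (fun y _ => hw2.init y) (fun y _ => hv2.init y)) x t ht

end Main

theorem mainTheorem9 (U : Set ℝ) (hU : IsOpen U) (h c p s : ℝ → ℝ) (lam : ℝ)
    (hh : ContDiffOn ℝ ∞ h U) (hc : ContDiffOn ℝ ∞ c U)
    (hps : ContDiffOn ℝ ∞ p U) (hs : ContDiffOn ℝ ∞ s U)
    (hp : ∀ u ∈ U, p u = 3 / 5 * c u * deriv c u + lam * c u ^ 3) :
    ∃ κ₃ : ℝ → ℝ → ℝ → ℝ → ℝ,
      -- `K₃` has a smooth density, given by the explicit formula
      ContDiffOn ℝ ∞ (fun q : ℝ × ℝ × ℝ × ℝ => κ₃ q.1 q.2.1 q.2.2.1 q.2.2.2) (jetDomain U h) ∧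
      (∀ t u u1 u2, (t, u, u1, u2) ∈ jetDomain U h → t ≠ 0 → iteratedDeriv 3 h u ≠ 0 →
        κ₃ t u u1 u2 = k3Formula h c s lam t u u1 u2) ∧
      (∀ t u u1 u2, (t, u, u1, u2) ∈ jetDomain U h →
        (t = 0 ∨ ∀ᶠ r in 𝓝 u, iteratedDeriv 3 h r = 0) → κ₃ t u u1 u2 = 0) ∧
      ∀ (T : ℝ) (φ : ℝ → ℝ) (v0 : ℝ → ℝ → ℝ), 0 < T → IsUnperturbedSolution U h φ T v0 →
        -- the transformation is well defined as long as `v0` is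
        (∀ x, ∀ t ∈ Ico 0 T,
          0 < 1 + t * iteratedDeriv 3 h (v0 x t) * deriv (fun y => v0 y t) x) ∧
        ∃ v1 v2 : ℝ → ℝ → ℝ,
          -- `v1` and `v2` are the coefficients of the canonical transformation
          (∀ x, ∀ t ∈ Ico 0 T,
            (fun ε : ℝ => canonicalMap ε (kDensity h c κ₃ ε t) (fun y => v0 y t) x
                - (v0 x t + ε ^ 2 * v1 x t + ε ^ 4 * v2 x t)) =O[𝓝 0] fun ε => ε ^ 6) ∧
          SolvesTransport1 h c T v0 v1 ∧
          SolvesTransport2 h c p s T v0 v1 v2 ∧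
          -- so they are the first two coefficients of the formal solution of the perturbed
          -- Cauchy problem, and they are the only ones
          SolvesPerturbedMod6 h c p s T v0 v1 v2 ∧
          (∀ w1 w2 : ℝ → ℝ → ℝ, SolvesTransport1 h c T v0 w1 → SolvesTransport2 h c p s T v0 w1 w2 →
            ∀ x, ∀ t ∈ Ico 0 T, w1 x t = v1 x t ∧ w2 x t = v2 x t) ∧
          -- the explicit formula for KdV
          ((∀ u ∈ U, h u = u ^ 3 / 6 ∧ c u = 1 ∧ s u = 0) → lam = 0 →
            ∀ x, ∀ t ∈ Ico 0 T,
              v1 x t = kdvV1 t (fun y => v0 y t) x ∧ v2 x t = kdvV2 t (fun y => v0 y t) x) := by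
  have : Fact (IsOpen U) := ⟨hU⟩
  have : SmoothHam U h := ⟨hh⟩
  set κ := kappa3Fn h (of c hc) (of s hs) lam with hκ
  have hκx : ∀ t u u1 u2 (hm : (t, u, u1, u2) ∈ jetDomain U h),
      κ.extend (t, u, u1, u2) = κ ⟨_, hm⟩ := fun t u u1 u2 hm => extend_apply κ hm
  refine ⟨fun t u u1 u2 => κ.extend (t, u, u1, u2), κ.contDiffOn_extend, ?_, ?_, ?_⟩
  · intro t u u1 u2 hm ht h3
    refine (hκx t u u1 u2 hm).trans ?_
    exact kappa3Fn_eq_k3Formula hc hs lam ⟨_, hm⟩ ht h3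
  · intro t u u1 u2 hm hz
    refine (hκx t u u1 u2 hm).trans ?_
    exact kappa3Fn_eq_zero lam ⟨_, hm⟩ hz
  · intro T φ v0 hT hv
    set V : SmoothFn (strip T) := of (fun q : ℝ × ℝ => v0 q.1 q.2) hv.smooth
    have hV : ∀ q, V q ∈ U := fun q => hv.mem q.1.1 q.1.2 q.2.2
    have h0 : ∀ x t (ht : t ∈ Ico 0 T), v0 x t = V ⟨(x, t), mem_strip ht⟩ := fun _ _ _ => rfl
    have hflow := flow_of_isUnperturbedSolution hv hV
    have hm := jetsMem_of_flow hV hflow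
    have h1 := solvesTransport1_firstCorrection h0 hT hV hflow hm hc
    have h2 := solvesTransport2_secondCorrection h0 hT hV hflow hm hc hps hs hp
    refine ⟨fun x t ht => ?_, _, _, fun x t ht => ?_, h1, h2,
      solvesPerturbedMod6 h0 hV hflow hm hc hps hs hp, fun w1 w2 hw1 hw2 x t ht =>
        transport_unique hv hc hps hs h1 h2 hw1 hw2 x ht, fun hk hlam x t ht => ?_⟩
    · rw [deriv_eq_dx V ht (fun y => h0 y t ht)]
      exact (hm ⟨(x, t), mem_strip ht⟩).2
    · have := canonicalMap_strip hm ht (L₁ := fun u u1 _ => k1Density h c t u u1)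
        (fun u u1 u2 hq => (k1Fn_apply hc ⟨_, hq⟩).symm)
        (hκx t) (fun y => h0 y t ht) x (firstCorrection_eq hm)
        (secondPotential_eq (s := of s hs) (lam := lam) hm)
      rw [extend_apply _ (mem_strip ht), extend_apply _ (mem_strip ht)]
      exact this
    · subst hlam
      -- The values of `c` and `s` are prescribed on `U` only, which suffices for equality in the
      -- algebra of functions on `U`.
      have hc1 : of c hc = (1 : SmoothFn U) := SmoothFn.ext fun u => (hk u u.2).2.1
      have hs0 : of s hs = (0 : SmoothFn U) := SmoothFn.ext fun u => (hk u u.2).2.2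
      have h3 : hFn U h 3 = 1 := hFn_three_of_kdv fun u hu => (hk u hu).1
      rw [extend_apply _ (mem_strip ht), extend_apply _ (mem_strip ht), hc1, hs0,
        kdvV1_eq h3 hm ht (fun y => h0 y t ht), kdvV2_eq h3 hm ht (fun y => h0 y t ht)]
      exact ⟨rfl, rfl⟩
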